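/- Let $(\overline M,\bar g)$ be an $(m+1)$-dimensional globally hyperbolic spacetime, $m\ge 1$, with a splitting time function $\tau$; that is, $\overline M=\mathbb R\times S$ with $\tau$ and $\pi$ the projections onto $\mathbb R$ and $S$, every slice $\{\tau=t\}$ is a Cauchy hypersurface, and $$\bar g=\bar\alpha^2\left(-d\tau^2+\bar\sigma\right),$$ where $\bar\alpha>0$ is smooth and $\bar\sigma$ is a smooth symmetric $2$-tensor whose kernel is spanned by $\partial_\tau$ and which is positive definite on each slice. Let $T=\bar\alpha^{-1}\partial_\tau$, which is taken to be future pointing. Let $\Sigma\subset\overline M$ be a compact connected smooth spacelike hypersurface with boundary (spacelike up to the boundary) which is achronal, i.e. every inextendible timelike curve meets it at most once, and suppose that its Cauchy development $D(\Sigma)$ is precompact in $\overline M$. Let $\varphi=\tau|_\Sigma$, and let $\mathring\Sigma=\Sigma\setminus\partial\Sigma$. For $u\in C^\infty(\Sigma)$ put $F_u(x)=(u(x),\pi(x))$, $\sigma_u=F_u^*\bar\sigma$ and $g=g_u=F_u^*\bar g$. Call $u$ admissible if $u\in C^\infty(\Sigma)$ (smooth up to the boundary), $u=\varphi$ on $\partial\Sigma$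 and $|du|_{\sigma_u}<1$ on $\Sigma$; these are the smooth elements $u$ of $$\mathscr Y_\tau(\Sigma)=\{u\in\operatorname{Lip}(\Sigma):\ |du|_{\sigma_u}\le 1 \text{ a.e.},\ u=\varphi\text{ on }\partial\Sigma\}$$ whose graph is spacelike. For such $u$ let $N$ be the future pointing unit normal of the graph $F_u(\Sigma)$, let $w=-\bar g(T,N)$ be the tilt function, $\operatorname{II}(X,Y)=-\bar g(\overline\nabla_{F_*X}F_*Y,N)$ the second fundamental form ($\overline\nabla$ being the Levi-Civita connection of $\bar g$), and $H=\operatorname{tr}_g\operatorname{II}$ the mean curvature. Then there is a constant $C$ depending only on $\Sigma$ and $\tau$ (and the spacetime) such that, for every admissible $u$ and every $\eta\in C^1_c(\mathring\Sigma)$, the function $\eta^2|\operatorname{II}|^2$ is integrable with respect to the Riemannian volume $dV_g$ and $$\int_\Sigma\eta^2|\operatorname{II}|^2\,dV_g\le C\left(\int_\Sigma|\nabla\eta|^2\,dV_g+\int_\Sigma\eta^2H^2\,dV_g+\int_\Sigma\eta^2w^2\,dV_g\right),$$ where $|\operatorname{II}|$ and $|\nabla\eta|$ are taken with respect to $g=g_u$.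 -/

import Mathlib

open scoped Manifold ContDiff Topology
open MeasureTheory Set Filter

noncomputable section

namespace Lorentz

/-! ### Tensors in charts -/

section Charts

variable {E : Type*} [NormedAddCommGroup E] [NormedSpace ℝ E]
  {H : Type*} [TopologicalSpace H] (I : ModelWithCorners ℝ E H)
  {X : Type*} [TopologicalSpace X] [ChartedSpace H X] [IsManifold I ∞ X]

/-- The tangent vector at `x` whose coordinates in the chart centred at `c` are `v`. (`TangentSpace`
is the model space, a vector being given by its coordinates in the preferred chart at its base
point.) -/
def vecOfChart (c x : X) (v : E) : TangentSpace I x :=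
  haveI : IsManifold I 1 X := IsManifold.of_le (n := ∞) (by norm_num)
  tangentCoordChange I c x x v

/-- The components of the field of bilinear forms `h` in the chart centred at `c`, at the point with
coordinates `z`. -/
def formInChart (h : ∀ x : X, TangentSpace I x → TangentSpace I x → ℝ) (c : X) (z : E)
    (a b : E) : ℝ :=
  h ((extChartAt I c).symm z) (vecOfChart I c ((extChartAt I c).symm z) a)
    (vecOfChart I c ((extChartAt I c).symm z) b)

/-- Christoffel symbols of the first kind of the (pseudo-Riemannian) metric `h` in the chart centred
at `c`: with `a, b, d` regarded as constant coordinate fields this is `h (∇_a b, d)`, where `∇` is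
the Levi-Civita connection of `h`, namely `1/2 (a h(b,d) + b h(a,d) - d h(a,b))`. -/
def christoffel (h : ∀ x : X, TangentSpace I x → TangentSpace I x → ℝ) (c : X) (z : E)
    (a b d : E) : ℝ :=
  (fderiv ℝ (fun y ↦ formInChart I h c y b d) z a
    + fderiv ℝ (fun y ↦ formInChart I h c y a d) z b
    - fderiv ℝ (fun y ↦ formInChart I h c y a b) z d) / 2

end Charts

/-! ### Spacetimes with a splitting time function -/

/-- The model with corners of `ℝ × S`, for an `m`-dimensional manifold `S`. -/
abbrev splitModel (m : ℕ) := (𝓘(ℝ, ℝ)).prod (𝓡 m)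

/-- The model vector space of `ℝ × S`. -/
abbrev SplitVec (m : ℕ) := ℝ × EuclideanSpace ℝ (Fin m)

/-- A metric `α² (-dτ² + σ)` on `ℝ × S`, where `τ` is the first projection, `α > 0` is smooth and
`σ` is a smooth symmetric `2`-tensor whose kernel is spanned by `∂_τ` and which is positive definite
on the slices. -/
structure SplitMetric (m : ℕ) (S : Type*) [TopologicalSpace S]
    [ChartedSpace (EuclideanSpace ℝ (Fin m)) S] [IsManifold (𝓡 m) ∞ S] where
  lapse : ℝ × S → ℝ
  lapse_pos : ∀ p, 0 < lapse p
  lapse_smooth : ContMDiff (splitModel m) 𝓘(ℝ, ℝ) ∞ lapse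
  sigma : ∀ p : ℝ × S,
    TangentSpace (splitModel m) p →L[ℝ] TangentSpace (splitModel m) p →L[ℝ] ℝ
  sigma_smooth : ContMDiff (splitModel m)
    ((splitModel m).prod 𝓘(ℝ, SplitVec m →L[ℝ] SplitVec m →L[ℝ] ℝ)) ∞
    (fun p ↦ Bundle.TotalSpace.mk' (SplitVec m →L[ℝ] SplitVec m →L[ℝ] ℝ)
      (E := fun p : ℝ × S ↦
        TangentSpace (splitModel m) p →L[ℝ] TangentSpace (splitModel m) p →L[ℝ] ℝ) p (sigma p))
  sigma_symm : ∀ p v w, sigma p v w = sigma p w v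
  sigma_ker : ∀ p (a : ℝ) w, sigma p ((a, 0) : SplitVec m) w = 0
  sigma_pos : ∀ p (v : SplitVec m), v.2 ≠ 0 → 0 < sigma p v v

section Spacetime

variable {m : ℕ} {S : Type*} [TopologicalSpace S]
  [ChartedSpace (EuclideanSpace ℝ (Fin m)) S] [IsManifold (𝓡 m) ∞ S]

namespace SplitMetric

variable (M : SplitMetric m S)

/-- The Lorentzian metric `α² (-dτ² + σ)`. -/
def metric (p : ℝ × S) (v w : TangentSpace (splitModel m) p) : ℝ :=
  M.lapse p ^ 2 * (-(v.1 * w.1) + M.sigma p v w)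

/-- The observer field `T = α⁻¹ ∂_τ`, that is, the unit vector field `- ∇τ / |∇τ|`, which gives the
time orientation. -/
def observer (p : ℝ × S) : TangentSpace (splitModel m) p :=
  (((M.lapse p)⁻¹, 0) : SplitVec m)

/-- Future pointing causal vectors. -/
def FutureCausal (p : ℝ × S) (v : TangentSpace (splitModel m) p) : Prop :=
  M.metric p v v ≤ 0 ∧ M.metric p (M.observer p) v < 0

/-- Past pointing causal vectors. -/
def PastCausal (p : ℝ × S) (v : TangentSpace (splitModel m) p) : Prop :=
  M.metric p v v ≤ 0 ∧ 0 < M.metric p (M.observer p) v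

/-- Future pointing timelike vectors. -/
def FutureTimelike (p : ℝ × S) (v : TangentSpace (splitModel m) p) : Prop :=
  M.metric p v v < 0 ∧ M.metric p (M.observer p) v < 0

end SplitMetric

/-- `γ` is continuous and piecewise `C¹` on the interval `J` (with break points that are finite in
number on each compact subinterval), and its velocities, one-sided ones at break points included,
have the property `Q`. -/
def PiecewiseCurve (Q : ∀ p : ℝ × S, TangentSpace (splitModel m) p → Prop)
    (γ : ℝ → ℝ × S) (J : Set ℝ) : Prop :=
  ContinuousOn γ J ∧ ∃ P : Set ℝ, (∀ a ∈ J, ∀ b ∈ J, (P ∩ Icc a b).Finite) ∧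
    ∀ a ∈ J, ∀ b ∈ J, a < b → Disjoint P (Ioo a b) →
      ContMDiffOn 𝓘(ℝ, ℝ) (splitModel m) 1 γ (Icc a b) ∧
      ∀ t ∈ Icc a b, Q (γ t) (mfderivWithin 𝓘(ℝ, ℝ) (splitModel m) γ (Icc a b) t (1 : ℝ))

namespace SplitMetric

variable (M : SplitMetric m S)

/-- An inextendible future pointing timelike curve, parametrized by `ℝ`: it has no end points. -/
def InextendibleTimelike (γ : ℝ → ℝ × S) : Prop :=
  PiecewiseCurve M.FutureTimelike γ univ ∧
    (¬ ∃ q, Tendsto γ atTop (𝓝 q)) ∧ ¬ ∃ q, Tendsto γ atBot (𝓝 q)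

/-- An inextendible future pointing causal curve starting at `p`, parametrized by `[0, ∞)`. -/
def FutureInextendibleFrom (p : ℝ × S) (γ : ℝ → ℝ × S) : Prop :=
  PiecewiseCurve M.FutureCausal γ (Ici 0) ∧ γ 0 = p ∧ ¬ ∃ q, Tendsto γ atTop (𝓝 q)

/-- An inextendible past pointing causal curve starting at `p`, parametrized by `[0, ∞)`. -/
def PastInextendibleFrom (p : ℝ × S) (γ : ℝ → ℝ × S) : Prop :=
  PiecewiseCurve M.PastCausal γ (Ici 0) ∧ γ 0 = p ∧ ¬ ∃ q, Tendsto γ atTop (𝓝 q)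

/-- Every inextendible timelike curve meets `A` at most once. -/
def Achronal (A : Set (ℝ × S)) : Prop :=
  ∀ γ, M.InextendibleTimelike γ → ∀ s t, γ s ∈ A → γ t ∈ A → s = t

/-- Every inextendible timelike curve meets `A` exactly once. -/
def IsCauchy (A : Set (ℝ × S)) : Prop :=
  ∀ γ, M.InextendibleTimelike γ → ∃! s, γ s ∈ A

/-- The Cauchy development `D(A) = D⁺(A) ∪ D⁻(A)`. -/
def cauchyDevelopment (A : Set (ℝ × S)) : Set (ℝ × S) :=
  {p | ∀ γ, M.PastInextendibleFrom p γ → ∃ s ≥ 0, γ s ∈ A} ∪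
    {p | ∀ γ, M.FutureInextendibleFrom p γ → ∃ s ≥ 0, γ s ∈ A}

/-- All the level sets of `τ` are Cauchy hypersurfaces, so that `ℝ × S` with the metric `M` is a
globally hyperbolic spacetime with splitting time function `τ`. -/
def CauchySlices : Prop := ∀ t : ℝ, M.IsCauchy {p | p.1 = t}

end SplitMetric

end Spacetime

/-! ### Spacelike hypersurfaces -/

/-- A smooth spacelike hypersurface of `ℝ × S`: the image of an injective smooth map of a manifold
with boundary `N` (used for compact `N`, where the map is then an embedding), with positive definite
induced metric up to the boundary, and achronal. -/
structure SpacelikeHypersurface {m : ℕ} [NeZero m] {S : Type*} [TopologicalSpace S]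
    [ChartedSpace (EuclideanSpace ℝ (Fin m)) S] [IsManifold (𝓡 m) ∞ S] (M : SplitMetric m S)
    (N : Type*) [TopologicalSpace N] [ChartedSpace (EuclideanHalfSpace m) N]
    [IsManifold (𝓡∂ m) ∞ N] where
  emb : N → ℝ × S
  smooth : ContMDiff (𝓡∂ m) (splitModel m) ∞ emb
  injective : Function.Injective emb
  spacelike : ∀ (x : N) (v : TangentSpace (𝓡∂ m) x), v ≠ 0 →
    0 < M.metric (emb x) (mfderiv (𝓡∂ m) (splitModel m) emb x v)
      (mfderiv (𝓡∂ m) (splitModel m) emb x v)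
  achronal : M.Achronal (range emb)

section Riemannian

variable {m : ℕ} [NeZero m] {N : Type*} [TopologicalSpace N]
  [ChartedSpace (EuclideanHalfSpace m) N] [IsManifold (𝓡∂ m) ∞ N]

/-- The matrix `h_{ij}` at `x` of the field of bilinear forms `h` in the chart centred at `c`. -/
def gram (h : ∀ x : N, TangentSpace (𝓡∂ m) x → TangentSpace (𝓡∂ m) x → ℝ) (c x : N) :
    Matrix (Fin m) (Fin m) ℝ :=
  Matrix.of fun i j ↦ h x (vecOfChart (𝓡∂ m) c x (EuclideanSpace.single i 1))
    (vecOfChart (𝓡∂ m) c x (EuclideanSpace.single j 1))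

/-- The components at `x` of the differential of `f` in the preferred chart at `x`. -/
def diffVec (f : N → ℝ) (x : N) : Fin m → ℝ :=
  fun i ↦ mfderiv (𝓡∂ m) 𝓘(ℝ, ℝ) f x (vecOfChart (𝓡∂ m) x x (EuclideanSpace.single i 1))

/-- `|df|²_h = h^{ij} f_i f_j`, for a Riemannian metric `h`. -/
def gradSq (h : ∀ x : N, TangentSpace (𝓡∂ m) x → TangentSpace (𝓡∂ m) x → ℝ) (f : N → ℝ)
    (x : N) : ℝ :=
  diffVec f x ⬝ᵥ ((gram h x x)⁻¹.mulVec (diffVec f x))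

/-- The Riemannian volume measure of `h`. In each chart it is the Lebesgue measure with density
`√ det h_{ij}`; the measures so obtained agree on overlaps, and the volume measure is their
supremum. -/
def volumeMeasure [MeasurableSpace N]
    (h : ∀ x : N, TangentSpace (𝓡∂ m) x → TangentSpace (𝓡∂ m) x → ℝ) : Measure N :=
  ⨆ c : N, (((volume : Measure (EuclideanSpace ℝ (Fin m))).restrict
    (extChartAt (𝓡∂ m) c).target).withDensity
      (fun z ↦ ENNReal.ofReal (√ (gram h c ((extChartAt (𝓡∂ m) c).symm z)).det))).map
        (extChartAt (𝓡∂ m) c).symm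

end Riemannian

namespace SpacelikeHypersurface

variable {m : ℕ} [NeZero m] {S : Type*} [TopologicalSpace S]
  [ChartedSpace (EuclideanSpace ℝ (Fin m)) S] [IsManifold (𝓡 m) ∞ S] {M : SplitMetric m S}
  {N : Type*} [TopologicalSpace N] [ChartedSpace (EuclideanHalfSpace m) N]
  [IsManifold (𝓡∂ m) ∞ N] (Sg : SpacelikeHypersurface M N)

/-- The graph map `F_u (x) = (u (x), π (x))`. -/
def graphMap (u : N → ℝ) (x : N) : ℝ × S := (u x, (Sg.emb x).2)

/-- The differential of the graph map. -/
def dGraph (u : N → ℝ) (x : N) :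
    TangentSpace (𝓡∂ m) x →L[ℝ] TangentSpace (splitModel m) (Sg.graphMap u x) :=
  mfderiv (𝓡∂ m) (splitModel m) (Sg.graphMap u) x

/-- The pull-back `σ_u = F_u^* σ`. -/
def sigmaPull (u : N → ℝ) (x : N) (v w : TangentSpace (𝓡∂ m) x) : ℝ :=
  M.sigma (Sg.graphMap u x) (Sg.dGraph u x v) (Sg.dGraph u x w)

/-- The induced metric `g_u`, the pull-back by `F_u` of the Lorentzian metric. -/
def inducedMetric (u : N → ℝ) (x : N) (v w : TangentSpace (𝓡∂ m) x) : ℝ :=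
  M.metric (Sg.graphMap u x) (Sg.dGraph u x v) (Sg.dGraph u x w)

/-- `u` is a smooth function on the hypersurface (up to the boundary) which equals the height of the
hypersurface on the boundary, and `|du|_{σ_u} < 1`: the smooth `u ∈ 𝒴_τ` with spacelike graph. -/
structure IsSpacelikeHeight (u : N → ℝ) : Prop where
  smooth : ContMDiff (𝓡∂ m) 𝓘(ℝ, ℝ) ∞ u
  boundary : ∀ x ∈ (𝓡∂ m).boundary N, u x = (Sg.emb x).1
  spacelike : ∀ x, gradSq (Sg.sigmaPull u) u x < 1

/-- `n` is a future pointing unit normal vector to the graph of `u` at `F_u (x)`. -/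
def IsFutureUnitNormal (u : N → ℝ) (x : N)
    (n : TangentSpace (splitModel m) (Sg.graphMap u x)) : Prop :=
  M.metric _ n n = -1 ∧ (∀ v, M.metric _ (Sg.dGraph u x v) n = 0) ∧
    M.metric _ (M.observer _) n < 0

/-- The future pointing unit normal `N_u` of a spacelike graph, at `F_u (x)`. -/
def unitNormal (u : N → ℝ) (x : N) : TangentSpace (splitModel m) (Sg.graphMap u x) :=
  Classical.epsilon (Sg.IsFutureUnitNormal u x)

/-- The tilt function `w_u = - ⟨T, N_u⟩`. -/
def tilt (u : N → ℝ) (x : N) : ℝ :=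
  -M.metric _ (M.observer (Sg.graphMap u x)) (Sg.unitNormal u x)

/-- `⟨∇_{F_* a} F_* b, N_u⟩` at `F_u (x)`, where `∇` is the Levi-Civita connection of the spacetime.
It is computed in the preferred charts at `x` and at `F_u (x)`, with `a, b` extended as constant
coordinate fields. -/
def connNormal (u : N → ℝ) (x : N) (a b : EuclideanSpace ℝ (Fin m)) : ℝ :=
  let F : EuclideanSpace ℝ (Fin m) → SplitVec m :=
    writtenInExtChartAt (𝓡∂ m) (splitModel m) x (Sg.graphMap u)
  let z := extChartAt (𝓡∂ m) x x
  let R : Set (EuclideanSpace ℝ (Fin m)) := range (𝓡∂ m)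
  M.metric (Sg.graphMap u x)
      (fderivWithin ℝ (fun y ↦ fderivWithin ℝ F R y b) R z a) (Sg.unitNormal u x)
    + christoffel (splitModel m) M.metric (Sg.graphMap u x) (F z)
      (fderivWithin ℝ F R z a) (fderivWithin ℝ F R z b) (Sg.unitNormal u x)

/-- The second fundamental form `II (a, b) = - ⟨∇_{F_* a} F_* b, N_u⟩` of the graph of `u`. -/
def secondFF (u : N → ℝ) (x : N) (a b : EuclideanSpace ℝ (Fin m)) : ℝ :=
  -Sg.connNormal u x a b

/-- The matrix of the second fundamental form at `x`, in the preferred chart at `x`. -/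
def secondFFMatrix (u : N → ℝ) (x : N) : Matrix (Fin m) (Fin m) ℝ :=
  Matrix.of fun i j ↦
    Sg.secondFF u x (EuclideanSpace.single i 1) (EuclideanSpace.single j 1)

/-- The mean curvature `H_u = g^{ij} II_{ij}`. -/
def meanCurvature (u : N → ℝ) (x : N) : ℝ :=
  ((gram (Sg.inducedMetric u) x x)⁻¹ * Sg.secondFFMatrix u x).trace

/-- `|II|² = g^{ik} g^{jl} II_{ij} II_{kl}`. -/
def secondFFSq (u : N → ℝ) (x : N) : ℝ :=
  ((gram (Sg.inducedMetric u) x x)⁻¹ * Sg.secondFFMatrix u x *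
    (gram (Sg.inducedMetric u) x x)⁻¹ * (Sg.secondFFMatrix u x).transpose).trace

end SpacelikeHypersurface

end Lorentz

end

/-!
The estimate is proved pointwise as a divergence identity with an absorbable error. Let `X` be the
part of `∂_τ` tangent to the graph, `S` the shape operator and `W = -⟨∂_τ, N⟩`, the tilt function
times the lapse. By the traced Codazzi equation the field `H X - S X` has divergence
`W (|II|² - H²)` plus terms that contain the spacetime geometry and at most one factor `II`
(`SplitPatch.Graph.divergence_flux`). Multiply by `η² / W` and integrate by parts. The derivative of
`1 / W` produces `|S X|² / W²`, and since `|X| ≤ W` the obvious bound for this is exactly `|II|²`,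
which cannot be absorbed. However, `S` is self-adjoint, and if its trace is small it cannot be
concentrated in the direction of `X`: the inequality
`(tr A)² ≤ n |A|²`, applied to the compression `A` of `S` to the complement of `X`, gives
`|S X|² ≤ |X|² (θ |II|² + 2 H²)` with a constant `θ < 1` that depends only on the dimension
(`IsInner.apply_le_refined`). The other terms are absorbed by Young's inequality (`young_absorb`),
because vectors tangent to the graph have coordinate length at most a multiple of `W` times their
length in the induced metric (`SplitPatch.Graph.sq_norm_le`), so that what remains of the errors is
at most of the order of `η² W²`. This is `SplitPatch.Graph.shapeSq_le_divergence`, and its integral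
over a coordinate patch is `SplitPatch.exists_local_estimate`.

The constants are uniform as long as the graphs stay in a compact part of the spacetime. This holds
because admissible graphs lie in the Cauchy development of the hypersurface: a causal curve which
leaves the graph towards the hypersurface cannot recross the graph, which is spacelike, nor escape
through the common boundary, so it remains in a compact region until it meets the hypersurface; and
an inextendible causal curve cannot remain in a compact set (`exists_tendsto_of_mem_compact`). As
the Cauchy development is precompact, the heights are bounded by a common constant
(`SpacelikeHypersurface.exists_height_mem_Icc`).

Finally, everything can be computed in charts of `S`. Vertical lines are timelike, so achronality
makes the projection of the hypersurface to `S` injective, and as the hypersurface is spacelike the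
projection is an immersion; hence the interior is a graph over an open subset of `S`. The normal,
the second fundamental form and the Riemannian volume are the ones of that graph, whichever chart is
used (`SpacelikeHypersurface.secondFFSq_eq`, `SpacelikeHypersurface.volumeMeasure_restrict_tile`).
To add up the local estimates, cover the compact projection of the hypersurface by finitely many
bump functions `χ` on `S`. These do not depend on the graph, and cutting off by one of them costs
only `|dχ|² ≤ C W²` (`SpacelikeHypersurface.exists_estimate_of_bump`).
-/

open scoped Manifold ContDiff Topology
open MeasureTheory Set Filter

noncomputable section

set_option linter.unusedSectionVars false
set_option maxSynthPendingDepth 3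

namespace Lorentz

/-! ### Split metrics in coordinates -/

/-- A metric `α² (-dt² + σ)` on `ℝ × base`, where `base` is an open subset of a vector space. The
conditions are imposed over `base` only; outside it `lapse` and `sigma` are arbitrary. -/
structure SplitPatch (E : Type*) [NormedAddCommGroup E] [NormedSpace ℝ E] where
  base : Set E
  isOpen_base : IsOpen base
  lapse : ℝ × E → ℝ
  sigma : ℝ × E → (ℝ × E) →L[ℝ] (ℝ × E) →L[ℝ] ℝ
  lapse_pos : ∀ p, p.2 ∈ base → 0 < lapse p
  lapse_smooth : ∀ p, p.2 ∈ base → ContDiffAt ℝ ∞ lapse p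
  sigma_smooth : ∀ p, p.2 ∈ base → ContDiffAt ℝ ∞ sigma p
  sigma_symm : ∀ p, p.2 ∈ base → ∀ v w, sigma p v w = sigma p w v
  sigma_ker : ∀ p, p.2 ∈ base → ∀ (a : ℝ) w, sigma p (a, 0) w = 0
  sigma_pos : ∀ p, p.2 ∈ base → ∀ v : ℝ × E, v.2 ≠ 0 → 0 < sigma p v v

section Christoffel

variable {L : Type*} [NormedAddCommGroup L] [NormedSpace ℝ L]

/-- Christoffel symbols of the first kind as a function of the derivative `d` of the metric. -/
def christoffelOfDeriv : (L →L[ℝ] L →L[ℝ] L →L[ℝ] ℝ) →L[ℝ] (L →L[ℝ] L →L[ℝ] L →L[ℝ] ℝ) :=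
  (2⁻¹ : ℝ) • (ContinuousLinearMap.id ℝ _ +
    (ContinuousLinearMap.flipₗᵢ ℝ L L (L →L[ℝ] ℝ)).toContinuousLinearEquiv.toContinuousLinearMap -
    (ContinuousLinearMap.compL ℝ L (L →L[ℝ] L →L[ℝ] ℝ) (L →L[ℝ] L →L[ℝ] ℝ)
      (ContinuousLinearMap.flipₗᵢ ℝ L L ℝ).toContinuousLinearEquiv.toContinuousLinearMap) ∘L
    (ContinuousLinearMap.flipₗᵢ ℝ L L (L →L[ℝ] ℝ)).toContinuousLinearEquiv.toContinuousLinearMap)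

theorem christoffelOfDeriv_apply (d : L →L[ℝ] L →L[ℝ] L →L[ℝ] ℝ) (a b c : L) :
    christoffelOfDeriv d a b c = (d a b c + d b a c - d c a b) / 2 := by
  simp [christoffelOfDeriv]
  ring

/-- Christoffel symbols of the second kind of the metric `G`: the Levi-Civita connection is
`∇_a Z = ∂_a Z + christoffelTwo G (a, Z)`. -/
def christoffelTwo (G : L → L →L[ℝ] L →L[ℝ] ℝ) (p : L) : L →L[ℝ] L →L[ℝ] L :=
  (ContinuousLinearMap.compL ℝ L (L →L[ℝ] ℝ) L (G p).inverse) ∘L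
    christoffelOfDeriv (fderiv ℝ G p)

theorem apply_christoffelTwo {G : L → L →L[ℝ] L →L[ℝ] ℝ} {p : L} (h : (G p).IsInvertible)
    (a b c : L) : G p (christoffelTwo G p a b) c =
      (fderiv ℝ G p a b c + fderiv ℝ G p b a c - fderiv ℝ G p c a b) / 2 := by
  rw [← christoffelOfDeriv_apply]
  simp [christoffelTwo, h.self_apply_inverse]

theorem fderiv_metric_symm {G : L → L →L[ℝ] L →L[ℝ] ℝ} {p : L}
    (hG : DifferentiableAt ℝ G p) (hs : ∀ᶠ q in 𝓝 p, ∀ v w, G q v w = G q w v) (a b c : L) :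
    fderiv ℝ G p a b c = fderiv ℝ G p a c b := by
  have key : ∀ v w, fderiv ℝ G p a v w = fderiv ℝ (fun q ↦ G q v w) p a := fun v w ↦ by
    have h1 := ((hG.hasFDerivAt.clm_apply (hasFDerivAt_const v p)).clm_apply
      (hasFDerivAt_const w p)).fderiv
    rw [h1]; simp
  rw [key, key]
  have : (fun q ↦ G q b c) =ᶠ[𝓝 p] fun q ↦ G q c b := hs.mono fun q hq ↦ hq b c
  rw [this.fderiv_eq]

theorem christoffelTwo_symm {G : L → L →L[ℝ] L →L[ℝ] ℝ} {p : L} (h : (G p).IsInvertible)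
    (hG : DifferentiableAt ℝ G p) (hs : ∀ᶠ q in 𝓝 p, ∀ v w, G q v w = G q w v) (a b : L) :
    christoffelTwo G p a b = christoffelTwo G p b a := by
  apply h.injective
  ext c
  rw [apply_christoffelTwo h, apply_christoffelTwo h, fderiv_metric_symm hG hs c a b]
  ring

/-- The connection is metric. -/
theorem metric_christoffelTwo_add {G : L → L →L[ℝ] L →L[ℝ] ℝ} {p : L} (h : (G p).IsInvertible)
    (hG : DifferentiableAt ℝ G p) (hs : ∀ᶠ q in 𝓝 p, ∀ v w, G q v w = G q w v) (a b c : L) :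
    G p (christoffelTwo G p a b) c + G p b (christoffelTwo G p a c) = fderiv ℝ G p a b c := by
  rw [hs.self_of_nhds b, apply_christoffelTwo h, apply_christoffelTwo h,
    fderiv_metric_symm hG hs a c b, fderiv_metric_symm hG hs c a b, fderiv_metric_symm hG hs b a c]
  ring

theorem contDiffAt_christoffelTwo [CompleteSpace L] {G : L → L →L[ℝ] L →L[ℝ] ℝ} {p : L}
    (h : (G p).IsInvertible) (hG : ContDiffAt ℝ ∞ G p) : ContDiffAt ℝ ∞ (christoffelTwo G) p := by
  have h1 : ContDiffAt ℝ ∞ (fun q ↦ (G q).inverse) p :=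
    (h.contDiffAt_map_inverse (n := ∞)).comp p hG
  have h2 : ContDiffAt ℝ ∞ (fderiv ℝ G) p := hG.fderiv_right (m := ∞) (by simp)
  have h3 := (ContinuousLinearMap.contDiff (n := ∞)
    (christoffelOfDeriv (L := L))).contDiffAt.comp p h2
  exact ((ContinuousLinearMap.contDiff (n := ∞) _).contDiffAt.comp p h1).clm_comp h3

end Christoffel

namespace SplitPatch

variable {E : Type*} [NormedAddCommGroup E] [NormedSpace ℝ E] (A : SplitPatch E)

/-- The Lorentzian metric `α² (-dt² + σ)`. -/
def metric (p : ℝ × E) : (ℝ × E) →L[ℝ] (ℝ × E) →L[ℝ] ℝ :=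
  A.lapse p ^ 2 • (A.sigma p -
    (ContinuousLinearMap.fst ℝ ℝ E).smulRight (ContinuousLinearMap.fst ℝ ℝ E))

theorem metric_apply (p v w : ℝ × E) :
    A.metric p v w = A.lapse p ^ 2 * (-(v.1 * w.1) + A.sigma p v w) := by
  simp only [metric, smul_apply, sub_apply, ContinuousLinearMap.smulRight_apply,
    ContinuousLinearMap.coe_fst', smul_eq_mul]
  ring

variable {A} {p : ℝ × E} (hp : p.2 ∈ A.base)
include hp

theorem eventually_mem_base : ∀ᶠ q in 𝓝 p, q.2 ∈ A.base :=
  (A.isOpen_base.preimage continuous_snd).mem_nhds hp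

theorem metric_symm (v w : ℝ × E) : A.metric p v w = A.metric p w v := by
  rw [metric_apply, metric_apply, A.sigma_symm p hp]; ring

theorem eventually_metric_symm : ∀ᶠ q in 𝓝 p, ∀ v w, A.metric q v w = A.metric q w v :=
  (eventually_mem_base hp).mono fun _ hq ↦ metric_symm hq

theorem sigma_eq (v w : ℝ × E) : A.sigma p v w = A.sigma p (0, v.2) (0, w.2) := by
  have h1 : v = (v.1, 0) + (0, v.2) := by simp
  have h2 : w = (w.1, 0) + (0, w.2) := by simp
  conv_lhs => rw [h1, h2]
  simp only [map_add, add_apply]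
  rw [A.sigma_ker p hp, A.sigma_ker p hp, A.sigma_symm p hp (0, v.2), A.sigma_ker p hp]
  simp

theorem sigma_nonneg (v : ℝ × E) : 0 ≤ A.sigma p v v := by
  by_cases h : v.2 = 0
  · rw [sigma_eq hp, h, A.sigma_ker p hp]
  · exact (A.sigma_pos p hp v h).le

theorem sigma_cauchy_schwarz (v w : ℝ × E) :
    A.sigma p v w ^ 2 ≤ A.sigma p v v * A.sigma p w w := by
  have h : ∀ t : ℝ, 0 ≤ A.sigma p w w * (t * t) + 2 * A.sigma p v w * t + A.sigma p v v := by
    intro t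
    have := sigma_nonneg hp (v + t • w)
    simp only [map_add, add_apply, map_smul, smul_apply, smul_eq_mul, A.sigma_symm p hp w v] at this
    linarith
  have := discrim_le_zero h
  unfold discrim at this
  nlinarith

theorem contDiffAt_metric : ContDiffAt ℝ ∞ A.metric p :=
  ((A.lapse_smooth p hp).pow 2).smul ((A.sigma_smooth p hp).sub contDiffAt_const)

variable [FiniteDimensional ℝ E]

theorem isInvertible_metric : (A.metric p).IsInvertible := by
  have hinj : Function.Injective (A.metric p : (ℝ × E) →ₗ[ℝ] ((ℝ × E) →L[ℝ] ℝ)) := by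
    refine (injective_iff_map_eq_zero _).2 fun v hv ↦ ?_
    have h1 : A.metric p v (-v.1, v.2) = 0 := by
      have : A.metric p v = 0 := hv
      rw [this]; simp
    rw [metric_apply, sigma_eq hp] at h1
    have h2 := pow_pos (A.lapse_pos p hp) 2
    have h3 := sigma_nonneg hp ((0, v.2) : ℝ × E)
    have h4 : v.1 * v.1 + A.sigma p (0, v.2) (0, v.2) = 0 := by
      rcases mul_eq_zero.1 h1 with h | h
      · exact absurd h h2.ne'
      · simp only at h; linarith
    have h5 : v.1 = 0 := by nlinarith [mul_self_nonneg v.1]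
    have h6 : v.2 = 0 := by
      by_contra h
      have := A.sigma_pos p hp (0, v.2) h
      nlinarith [mul_self_nonneg v.1]
    exact Prod.ext h5 h6
  have hfin : Module.finrank ℝ (ℝ × E) = Module.finrank ℝ ((ℝ × E) →L[ℝ] ℝ) := by
    rw [← (LinearMap.toContinuousLinearMap (𝕜 := ℝ) (E := ℝ × E) (F' := ℝ)).finrank_eq]
    exact (Subspace.dual_finrank_eq (K := ℝ) (V := ℝ × E)).symm
  exact ⟨(LinearEquiv.ofInjectiveOfFinrankEq _ hinj hfin).toContinuousLinearEquiv,
    ContinuousLinearMap.ext fun _ ↦ rfl⟩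

theorem contDiffAt_christoffel : ContDiffAt ℝ ∞ (christoffelTwo A.metric) p :=
  contDiffAt_christoffelTwo (isInvertible_metric hp) (contDiffAt_metric hp)

end SplitPatch

/-! ### Spacelike graphs -/

/-- A smooth spacelike graph `t = height x` over an open set `dom` of the base of a split patch. -/
structure SplitPatch.Graph {E : Type*} [NormedAddCommGroup E] [NormedSpace ℝ E]
    (A : SplitPatch E) where
  dom : Set E
  isOpen_dom : IsOpen dom
  dom_subset : dom ⊆ A.base
  height : E → ℝ
  smooth : ∀ x ∈ dom, ContDiffAt ℝ ∞ height x
  spacelike : ∀ x ∈ dom, ∀ a, a ≠ 0 →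
    (fderiv ℝ height x a) ^ 2 < A.sigma (height x, x) (0, a) (0, a)

namespace SplitPatch.Graph

variable {E : Type*} [NormedAddCommGroup E] [NormedSpace ℝ E] {A : SplitPatch E} (u : A.Graph)

/-- The graph map `x ↦ (u x, x)`. -/
def pt (x : E) : ℝ × E := (u.height x, x)

/-- The differential of the graph map. -/
def dPt (x : E) : E →L[ℝ] ℝ × E := (fderiv ℝ u.height x).prod (ContinuousLinearMap.id ℝ E)

/-- The covector `dt - du`, whose kernel is the tangent space of the graph. -/
def conormal (x : E) : (ℝ × E) →L[ℝ] ℝ :=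
  ContinuousLinearMap.fst ℝ ℝ E - (fderiv ℝ u.height x) ∘L (ContinuousLinearMap.snd ℝ ℝ E)

/-- The vector metrically dual to `dt - du`; it is normal to the graph, past pointing, and not
normalized. -/
def gradVec (x : E) : ℝ × E := (A.metric (u.pt x)).inverse (u.conormal x)

/-- `- ⟨∂_t, N⟩`, for the future unit normal `N`. This is the tilt function times the lapse. -/
def coordTilt (x : E) : ℝ := (√(-(u.conormal x (u.gradVec x))))⁻¹

/-- The future unit normal. -/
def normal (x : E) : ℝ × E := -u.coordTilt x • u.gradVec x

/-- The covariant derivative along the graph of a field `Z` of spacetime vectors. -/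
def cov (Z : E → ℝ × E) (x : E) : E →L[ℝ] ℝ × E :=
  fderiv ℝ Z x + ((christoffelTwo A.metric (u.pt x)).flip (Z x)) ∘L u.dPt x

/-- The shape operator `a ↦ ∇_a N`. Tangent vectors of the graph are identified with their
projections to `E` along `∂_t`. -/
def shape (x : E) : E →L[ℝ] E := ContinuousLinearMap.snd ℝ ℝ E ∘L u.cov u.normal x

/-- The induced metric. -/
def ind (x : E) : E →L[ℝ] E →L[ℝ] ℝ :=
  (A.metric (u.pt x)).bilinearComp (u.dPt x) (u.dPt x)

/-- The projection to `E` of the part of `∂_t` tangent to the graph. -/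
def tangTime (x : E) : E := -u.coordTilt x • (u.normal x).2

theorem dPt_apply (x a : E) : u.dPt x a = (fderiv ℝ u.height x a, a) := rfl

theorem conormal_apply (x : E) (v : ℝ × E) :
    u.conormal x v = v.1 - fderiv ℝ u.height x v.2 := by
  simp [conormal]

theorem conormal_dPt (x a : E) : u.conormal x (u.dPt x a) = 0 := by
  simp [conormal_apply, dPt_apply]

theorem eq_dPt_of_conormal {x : E} {v : ℝ × E} (h : u.conormal x v = 0) : v = u.dPt x v.2 := by
  rw [conormal_apply, sub_eq_zero] at h
  exact Prod.ext h rfl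

theorem ind_apply (x a b : E) :
    u.ind x a b = A.metric (u.pt x) (u.dPt x a) (u.dPt x b) := rfl

theorem cov_apply (Z : E → ℝ × E) (x a : E) :
    u.cov Z x a = fderiv ℝ Z x a + christoffelTwo A.metric (u.pt x) (u.dPt x a) (Z x) := rfl

variable {u} {x : E} (hx : x ∈ u.dom)
include hx

theorem mem_base : (u.pt x).2 ∈ A.base := u.dom_subset hx

theorem hasFDerivAt_pt : HasFDerivAt u.pt (u.dPt x) x :=
  ((u.smooth x hx).differentiableAt (by simp)).hasFDerivAt.prodMk (hasFDerivAt_id x)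

theorem contDiffAt_pt : ContDiffAt ℝ ∞ u.pt x := (u.smooth x hx).prodMk contDiffAt_id

theorem contDiffAt_fderiv_height : ContDiffAt ℝ ∞ (fderiv ℝ u.height) x :=
  (u.smooth x hx).fderiv_right (by simp)

theorem contDiffAt_dPt : ContDiffAt ℝ ∞ u.dPt x := by
  have h : u.dPt = fun y ↦ ContinuousLinearMap.inl ℝ ℝ E ∘L fderiv ℝ u.height y +
      ContinuousLinearMap.inr ℝ ℝ E := by
    ext y a <;> simp [dPt_apply]
  rw [h]
  exact (contDiffAt_const.clm_comp (contDiffAt_fderiv_height hx)).add contDiffAt_const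

theorem contDiffAt_conormal : ContDiffAt ℝ ∞ u.conormal x :=
  contDiffAt_const.sub ((contDiffAt_fderiv_height hx).clm_comp contDiffAt_const)

theorem contDiffAt_metric_pt : ContDiffAt ℝ ∞ (fun y ↦ A.metric (u.pt y)) x :=
  (contDiffAt_metric (mem_base hx)).comp x (contDiffAt_pt hx)

theorem eventually_mem_dom : ∀ᶠ y in 𝓝 x, y ∈ u.dom := u.isOpen_dom.mem_nhds hx

theorem ind_symm (a b : E) : u.ind x a b = u.ind x b a := metric_symm (mem_base hx) _ _

theorem ind_eq (a b : E) : u.ind x a b = A.lapse (u.pt x) ^ 2 *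
    (A.sigma (u.pt x) (0, a) (0, b) - fderiv ℝ u.height x a * fderiv ℝ u.height x b) := by
  rw [ind_apply, metric_apply, sigma_eq (mem_base hx)]
  simp only [dPt_apply]; ring

theorem ind_pos {a : E} (ha : a ≠ 0) : 0 < u.ind x a a := by
  rw [ind_eq hx]
  have := u.spacelike x hx a ha
  exact mul_pos (pow_pos (A.lapse_pos _ (mem_base hx)) 2)
    (by rw [pow_two] at this; exact sub_pos.2 this)

theorem ind_nonneg (a : E) : 0 ≤ u.ind x a a := by
  by_cases ha : a = 0
  · simp [ha]
  · exact (ind_pos hx ha).le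

variable [FiniteDimensional ℝ E]

theorem metric_gradVec (v : ℝ × E) : A.metric (u.pt x) (u.gradVec x) v = u.conormal x v := by
  rw [gradVec, (isInvertible_metric (mem_base hx)).self_apply_inverse]

theorem gradVec_fst : (u.gradVec x).1 = -(A.lapse (u.pt x) ^ 2)⁻¹ := by
  have h := metric_gradVec hx (1, 0)
  rw [metric_apply, A.sigma_symm _ (mem_base hx), A.sigma_ker _ (mem_base hx), conormal_apply] at h
  have h2 := pow_pos (A.lapse_pos _ (mem_base hx)) 2
  simp only [map_zero, sub_zero] at h
  rw [eq_neg_iff_add_eq_zero, ← mul_right_inj' h2.ne', mul_add, mul_inv_cancel₀ h2.ne']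
  linarith

theorem sigma_gradVec (b : E) :
    A.lapse (u.pt x) ^ 2 * A.sigma (u.pt x) (0, (u.gradVec x).2) (0, b) =
    -fderiv ℝ u.height x b := by
  have h := metric_gradVec hx (0, b)
  rw [metric_apply, conormal_apply, sigma_eq (mem_base hx)] at h
  simpa using h

theorem neg_conormal_gradVec : -(u.conormal x (u.gradVec x)) = (A.lapse (u.pt x) ^ 2)⁻¹ -
    A.lapse (u.pt x) ^ 2 * A.sigma (u.pt x) (0, (u.gradVec x).2) (0, (u.gradVec x).2) := by
  rw [conormal_apply, gradVec_fst hx, sigma_gradVec hx]; ring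

theorem neg_conormal_gradVec_pos : 0 < -(u.conormal x (u.gradVec x)) := by
  rw [neg_conormal_gradVec hx]
  have h2 := pow_pos (A.lapse_pos _ (mem_base hx)) 2
  set y := (u.gradVec x).2
  by_cases hy : y = 0
  · have : A.sigma (u.pt x) (0, y) (0, y) = 0 := by rw [hy]; exact A.sigma_ker _ (mem_base hx) _ _
    rw [this]; simpa using h2
  · have h1 := u.spacelike x hx y hy
    have h3 := sigma_gradVec hx y
    have h4 := A.sigma_pos _ (mem_base hx) (0, y) hy
    set s := A.sigma (u.pt x) (0, y) (0, y)
    have h5 : (A.lapse (u.pt x) ^ 2 * s) ^ 2 < s := by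
      rw [h3, neg_sq]; exact h1
    rw [sub_pos, inv_eq_one_div, lt_div_iff₀ h2]
    set l := A.lapse (u.pt x) ^ 2
    nlinarith

theorem coordTilt_pos : 0 < u.coordTilt x :=
  inv_pos.2 (Real.sqrt_pos.2 (neg_conormal_gradVec_pos hx))

theorem coordTilt_sq_inv : (u.coordTilt x ^ 2)⁻¹ = -(u.conormal x (u.gradVec x)) := by
  rw [coordTilt, inv_pow, inv_inv, Real.sq_sqrt (neg_conormal_gradVec_pos hx).le]

theorem metric_normal (v : ℝ × E) :
    A.metric (u.pt x) (u.normal x) v = -u.coordTilt x * u.conormal x v := by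
  rw [normal, map_smul, smul_apply, metric_gradVec hx, smul_eq_mul]

theorem metric_normal_right (v : ℝ × E) :
    A.metric (u.pt x) v (u.normal x) = -u.coordTilt x * u.conormal x v := by
  rw [metric_symm (mem_base hx), metric_normal hx]

theorem conormal_normal : u.conormal x (u.normal x) = (u.coordTilt x)⁻¹ := by
  have h := coordTilt_pos hx
  have h2 := coordTilt_sq_inv hx
  rw [normal, map_smul, smul_eq_mul, ← neg_eq_iff_eq_neg.2 h2.symm.symm]
  field_simp

theorem metric_normal_normal : A.metric (u.pt x) (u.normal x) (u.normal x) = -1 := by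
  have h := coordTilt_pos hx
  rw [metric_normal hx, conormal_normal hx]
  field_simp

theorem metric_time_normal : A.metric (u.pt x) (1, 0) (u.normal x) = -u.coordTilt x := by
  rw [metric_normal_right hx, conormal_apply]; simp

theorem metric_dPt_normal (a : E) : A.metric (u.pt x) (u.dPt x a) (u.normal x) = 0 := by
  rw [metric_normal_right hx, conormal_dPt, mul_zero]

theorem eq_dPt_of_metric {v : ℝ × E} (h : A.metric (u.pt x) v (u.normal x) = 0) :
    v = u.dPt x v.2 := by
  rw [metric_normal_right hx] at h
  have := coordTilt_pos hx
  exact eq_dPt_of_conormal u ((mul_eq_zero.1 h).resolve_left (by linarith))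

theorem time_eq : ((1, 0) : ℝ × E) = u.dPt x (u.tangTime x) + u.coordTilt x • u.normal x := by
  have h : A.metric (u.pt x) ((1, 0) - u.coordTilt x • u.normal x) (u.normal x) = 0 := by
    rw [map_sub, map_smul, sub_apply, smul_apply, metric_time_normal hx, metric_normal_normal hx]
    simp
  have h2 := eq_dPt_of_metric hx h
  rw [← sub_eq_iff_eq_add, h2]
  congr 1
  simp [tangTime]

theorem contDiffAt_gradVec : ContDiffAt ℝ ∞ u.gradVec x := by
  have h : ContDiffAt ℝ ∞ (fun y ↦ (A.metric (u.pt y)).inverse) x :=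
    ContDiffAt.comp (g := ContinuousLinearMap.inverse) (f := fun y ↦ A.metric (u.pt y)) x
      (isInvertible_metric (mem_base hx)).contDiffAt_map_inverse (contDiffAt_metric_pt hx)
  exact h.clm_apply (contDiffAt_conormal hx)

theorem contDiffAt_coordTilt : ContDiffAt ℝ ∞ u.coordTilt x := by
  have h := neg_conormal_gradVec_pos hx
  exact ((((contDiffAt_conormal hx).clm_apply (contDiffAt_gradVec hx)).neg).sqrt h.ne').inv
    (Real.sqrt_pos.2 h).ne'

theorem contDiffAt_normal : ContDiffAt ℝ ∞ u.normal x :=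
  (contDiffAt_coordTilt hx).neg.smul (contDiffAt_gradVec hx)

theorem contDiffAt_tangTime : ContDiffAt ℝ ∞ u.tangTime x :=
  (contDiffAt_coordTilt hx).neg.smul (contDiffAt_normal hx).snd

theorem contDiffAt_christoffel_pt : ContDiffAt ℝ ∞ (fun y ↦ christoffelTwo A.metric (u.pt y)) x :=
  (contDiffAt_christoffel (mem_base hx)).comp x (contDiffAt_pt hx)

theorem contDiffAt_cov {Z : E → ℝ × E} (hZ : ContDiffAt ℝ ∞ Z x) : ContDiffAt ℝ ∞ (u.cov Z) x := by
  have h1 : ContDiffAt ℝ ∞ (fun y ↦ (christoffelTwo A.metric (u.pt y)).flip) x :=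
    (ContinuousLinearMap.flipₗᵢ ℝ (ℝ × E) (ℝ × E) (ℝ × E)).contDiff.contDiffAt.comp x
      (contDiffAt_christoffel_pt hx)
  exact (hZ.fderiv_right (m := ∞) (by simp)).add ((h1.clm_apply hZ).clm_comp (contDiffAt_dPt hx))

theorem contDiffAt_shape : ContDiffAt ℝ ∞ u.shape x :=
  contDiffAt_const.clm_comp (contDiffAt_cov hx (contDiffAt_normal hx))

end SplitPatch.Graph

/-! ### Gauss, Weingarten and Codazzi equations of a graph -/

namespace SplitPatch.Graph

variable {E : Type*} [NormedAddCommGroup E] [NormedSpace ℝ E] {A : SplitPatch E} (u : A.Graph)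

/-- The Levi-Civita connection of the induced metric: the covariant derivative of the field `Z` in
the direction `a` is `∂_a Z + levi a Z`. -/
def levi (x a : E) : E →L[ℝ] E :=
  ContinuousLinearMap.snd ℝ ℝ E ∘L christoffelTwo A.metric (u.pt x) (u.dPt x a) ∘L u.dPt x -
    (u.ind x (u.shape x a)).smulRight (u.normal x).2

theorem levi_apply (x a b : E) : u.levi x a b =
    (christoffelTwo A.metric (u.pt x) (u.dPt x a) (u.dPt x b)).2 -
      u.ind x (u.shape x a) b • (u.normal x).2 := rfl

/-- The map `a ↦ R(a, b) N`, where `R` is the curvature of the spacetime, projected to `E`. -/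
def curvOp (x b : E) : E →L[ℝ] E :=
  let G := christoffelTwo A.metric (u.pt x)
  let D := fderiv ℝ (christoffelTwo A.metric) (u.pt x)
  ContinuousLinearMap.snd ℝ ℝ E ∘L
    ((D.flip (u.dPt x b)).flip (u.normal x) - (D (u.dPt x b)).flip (u.normal x)
      + G.flip (G (u.dPt x b) (u.normal x)) - G (u.dPt x b) ∘L G.flip (u.normal x)) ∘L u.dPt x

variable {u} {x : E} (hx : x ∈ u.dom) [FiniteDimensional ℝ E]
include hx

theorem hasFDerivAt_christoffel_pt : HasFDerivAt (fun y ↦ christoffelTwo A.metric (u.pt y))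
    (fderiv ℝ (christoffelTwo A.metric) (u.pt x) ∘L u.dPt x) x :=
  ((contDiffAt_christoffel (mem_base hx)).differentiableAt (by simp)).hasFDerivAt.comp x
    (hasFDerivAt_pt hx)

theorem christoffel_symm (a b : ℝ × E) :
    christoffelTwo A.metric (u.pt x) a b = christoffelTwo A.metric (u.pt x) b a :=
  christoffelTwo_symm (isInvertible_metric (mem_base hx))
    ((contDiffAt_metric (mem_base hx)).differentiableAt (by simp))
    (eventually_metric_symm (mem_base hx)) a b

/-- Compatibility of the connection with the metric, along the graph. -/
theorem fderiv_metric_along {Z Z' : E → ℝ × E} (hZ : DifferentiableAt ℝ Z x)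
    (hZ' : DifferentiableAt ℝ Z' x) (a : E) :
    fderiv ℝ (fun y ↦ A.metric (u.pt y) (Z y) (Z' y)) x a =
      A.metric (u.pt x) (u.cov Z x a) (Z' x) + A.metric (u.pt x) (Z x) (u.cov Z' x a) := by
  have hG := (contDiffAt_metric (mem_base hx)).differentiableAt (by simp)
  have h1 := (((hG.hasFDerivAt.comp x (hasFDerivAt_pt hx)).clm_apply hZ.hasFDerivAt).clm_apply
    hZ'.hasFDerivAt).fderiv
  have h2 : (fun y ↦ A.metric (u.pt y) (Z y) (Z' y)) =
    fun y ↦ ((A.metric ∘ u.pt) y) (Z y) (Z' y) := rfl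
  rw [h2, h1]
  have h3 := metric_christoffelTwo_add (isInvertible_metric (mem_base hx)) hG
    (eventually_metric_symm (mem_base hx)) (u.dPt x a) (Z x) (Z' x)
  simp only [cov_apply, map_add, add_apply, ContinuousLinearMap.comp_apply, Function.comp_apply,
    ContinuousLinearMap.flip_apply]
  rw [← h3]
  ring

theorem metric_cov_normal_normal (a : E) :
    A.metric (u.pt x) (u.cov u.normal x a) (u.normal x) = 0 := by
  have hN := (contDiffAt_normal hx).differentiableAt (by simp)
  have h := fderiv_metric_along hx hN hN a
  have h2 : (fun y ↦ A.metric (u.pt y) (u.normal y) (u.normal y)) =ᶠ[𝓝 x] fun _ ↦ -1 :=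
    (eventually_mem_dom hx).mono fun y hy ↦ metric_normal_normal hy
  rw [h2.fderiv_eq, metric_symm (mem_base hx) (u.normal x)] at h
  simp at h
  linarith

/-- The Weingarten equation. -/
theorem cov_normal (a : E) : u.cov u.normal x a = u.dPt x (u.shape x a) :=
  eq_dPt_of_metric hx (metric_cov_normal_normal hx a)

theorem fderiv_dPt_apply (b a : E) : fderiv ℝ (fun y ↦ u.dPt y b) x a =
    (fderiv ℝ (fderiv ℝ u.height) x a b, 0) := by
  have h := ((contDiffAt_fderiv_height hx).differentiableAt (by simp)).hasFDerivAt.clm_apply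
    (hasFDerivAt_const b x)
  have h2 := (h.prodMk (hasFDerivAt_const b x)).fderiv
  have h3 : (fun y ↦ u.dPt y b) = fun y ↦ (fderiv ℝ u.height y b, b) := rfl
  rw [h3, h2]; simp

theorem differentiableAt_dPt_apply (b : E) : DifferentiableAt ℝ (fun y ↦ u.dPt y b) x :=
  ((contDiffAt_dPt hx).differentiableAt (by simp)).clm_apply (differentiableAt_const b)

theorem fderiv_fderiv_height_symm (a b : E) : fderiv ℝ (fderiv ℝ u.height) x a b =
    fderiv ℝ (fderiv ℝ u.height) x b a :=
  (u.smooth x hx).isSymmSndFDerivAt (by simpa using ENat.LEInfty.out) a b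

/-- The Gauss equation `∇_a F_b = F_* (∇_a b) + II (a, b) N`. -/
theorem cov_dPt (a b : E) : u.cov (fun y ↦ u.dPt y b) x a =
    u.dPt x (u.levi x a b) + u.ind x (u.shape x a) b • u.normal x := by
  have h := fderiv_metric_along hx (differentiableAt_dPt_apply hx b)
    ((contDiffAt_normal hx).differentiableAt (by simp)) a
  have h2 : (fun y ↦ A.metric (u.pt y) (u.dPt y b) (u.normal y)) =ᶠ[𝓝 x] fun _ ↦ 0 :=
    (eventually_mem_dom hx).mono fun y hy ↦ metric_dPt_normal hy b
  rw [h2.fderiv_eq, cov_normal hx, ← ind_apply, ind_symm hx] at h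
  have h3 : A.metric (u.pt x) (u.cov (fun y ↦ u.dPt y b) x a -
      u.ind x (u.shape x a) b • u.normal x) (u.normal x) = 0 := by
    rw [map_sub, map_smul, sub_apply, smul_apply, metric_normal_normal hx]
    simp at h ⊢
    linarith
  rw [← sub_eq_iff_eq_add, eq_dPt_of_metric hx h3]
  congr 1
  rw [levi_apply, cov_apply, fderiv_dPt_apply hx]
  simp

theorem cov_dPt_symm (a b : E) :
    u.cov (fun y ↦ u.dPt y b) x a = u.cov (fun y ↦ u.dPt y a) x b := by
  rw [cov_apply, cov_apply, fderiv_dPt_apply hx, fderiv_dPt_apply hx,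
    fderiv_fderiv_height_symm hx, christoffel_symm hx]

theorem ind_shape_eq (a b : E) : u.ind x (u.shape x a) b =
    -A.metric (u.pt x) (u.cov (fun y ↦ u.dPt y b) x a) (u.normal x) := by
  rw [cov_dPt hx, map_add, map_smul, add_apply, smul_apply, metric_normal_normal hx,
    metric_dPt_normal hx]
  simp

/-- The second fundamental form is symmetric. -/
theorem ind_shape_symm (a b : E) : u.ind x (u.shape x a) b = u.ind x (u.shape x b) a := by
  rw [ind_shape_eq hx, ind_shape_eq hx, cov_dPt_symm hx]

theorem levi_symm (a b : E) : u.levi x a b = u.levi x b a := by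
  rw [levi_apply, levi_apply, ind_shape_symm hx, christoffel_symm hx]

theorem fderiv_ind (a b c : E) : fderiv ℝ (fun y ↦ u.ind y a b) x c =
    u.ind x (u.levi x c a) b + u.ind x a (u.levi x c b) := by
  have h := fderiv_metric_along hx (differentiableAt_dPt_apply hx a)
    (differentiableAt_dPt_apply hx b) c
  simp only [cov_dPt hx, map_add, add_apply, map_smul, smul_apply, metric_dPt_normal hx] at h
  rw [metric_symm (mem_base hx) (u.normal x), metric_dPt_normal hx] at h
  simpa [ind_apply] using h

theorem contDiffAt_ind : ContDiffAt ℝ ∞ u.ind x := by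
  have h : u.ind = fun y ↦ ((ContinuousLinearMap.flipₗᵢ ℝ E (ℝ × E) ℝ).toContinuousLinearEquiv
      (A.metric (u.pt y) ∘L u.dPt y) ∘L u.dPt y).flip := by
    ext y a b
    rfl
  rw [h]
  have h1 := (contDiffAt_metric_pt hx).clm_comp (contDiffAt_dPt hx)
  have h2 : ContDiffAt ℝ ∞ (fun y ↦ (A.metric (u.pt y) ∘L u.dPt y).flip) x :=
    (ContinuousLinearMap.flipₗᵢ ℝ E (ℝ × E) ℝ).contDiff.contDiffAt.comp x h1
  exact (ContinuousLinearMap.flipₗᵢ ℝ E E ℝ).contDiff.contDiffAt.comp x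
    (h2.clm_comp (contDiffAt_dPt hx))

theorem cov_const (v : ℝ × E) (a : E) :
    u.cov (fun _ ↦ v) x a = christoffelTwo A.metric (u.pt x) (u.dPt x a) v := by
  rw [cov_apply]; simp

theorem metric_time_dPt (b : E) :
    A.metric (u.pt x) (1, 0) (u.dPt x b) = u.ind x (u.tangTime x) b := by
  rw [time_eq hx, map_add, map_smul, add_apply, smul_apply, metric_symm (mem_base hx) (u.normal x),
    metric_dPt_normal hx, ind_apply]
  simp

/-- The gradient of the tilt is `-S X`, up to a term that does not contain the second fundamental
form. -/
theorem fderiv_coordTilt (a : E) : fderiv ℝ u.coordTilt x a =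
    -u.ind x (u.shape x a) (u.tangTime x) -
    A.metric (u.pt x) (christoffelTwo A.metric (u.pt x) (u.dPt x a) (1, 0)) (u.normal x) := by
  have h := fderiv_metric_along hx (differentiableAt_const ((1, 0) : ℝ × E))
    ((contDiffAt_normal hx).differentiableAt (by simp)) a
  have h2 : (fun y ↦ A.metric (u.pt y) (1, 0) (u.normal y)) =ᶠ[𝓝 x] -u.coordTilt :=
    (eventually_mem_dom hx).mono fun y hy ↦ metric_time_normal hy
  rw [h2.fderiv_eq, fderiv_neg, cov_const hx, cov_normal hx, metric_time_dPt hx, ind_symm hx] at h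
  simp only [neg_apply] at h
  linarith

/-- The covariant derivative of the tangential part of `∂_t`. -/
theorem ind_cov_tangTime (a b : E) : u.ind x (fderiv ℝ u.tangTime x a + u.levi x a (u.tangTime x) +
    u.coordTilt x • u.shape x a) b =
    A.metric (u.pt x) (christoffelTwo A.metric (u.pt x) (u.dPt x a) (1, 0)) (u.dPt x b) := by
  have h := fderiv_metric_along hx (differentiableAt_const ((1, 0) : ℝ × E))
    (differentiableAt_dPt_apply hx b) a
  have h2 : (fun y ↦ A.metric (u.pt y) (1, 0) (u.dPt y b)) =ᶠ[𝓝 x]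
      fun y ↦ u.ind y (u.tangTime y) b :=
    (eventually_mem_dom hx).mono fun y hy ↦ metric_time_dPt hy b
  have hX := (contDiffAt_tangTime hx).differentiableAt (by simp)
  have hI := (contDiffAt_ind hx).differentiableAt (by simp)
  have h3 := ((hI.hasFDerivAt.clm_apply hX.hasFDerivAt).clm_apply (hasFDerivAt_const b x)).fderiv
  have h4 := ((hI.hasFDerivAt.clm_apply (hasFDerivAt_const (u.tangTime x) x)).clm_apply
    (hasFDerivAt_const b x)).fderiv
  have h5 := fderiv_ind hx (u.tangTime x) b a
  rw [h4] at h5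
  rw [h2.fderiv_eq, h3, cov_const hx, cov_dPt hx, map_add, metric_time_dPt hx, map_smul,
    metric_time_normal hx] at h
  simp at h h5 ⊢
  linarith

omit hx in
theorem curvOp_apply (a b : E) : u.curvOp x b a =
    (fderiv ℝ (christoffelTwo A.metric) (u.pt x) (u.dPt x a) (u.dPt x b) (u.normal x) -
      fderiv ℝ (christoffelTwo A.metric) (u.pt x) (u.dPt x b) (u.dPt x a) (u.normal x) +
      christoffelTwo A.metric (u.pt x) (u.dPt x a)
        (christoffelTwo A.metric (u.pt x) (u.dPt x b) (u.normal x)) -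
      christoffelTwo A.metric (u.pt x) (u.dPt x b)
        (christoffelTwo A.metric (u.pt x) (u.dPt x a) (u.normal x))).2 := rfl

theorem fderiv_shape (a b : E) : fderiv ℝ u.shape x a b =
    (fderiv ℝ (fderiv ℝ u.normal) x a b +
      (fderiv ℝ (christoffelTwo A.metric) (u.pt x) (u.dPt x a) (u.dPt x b) (u.normal x) +
      christoffelTwo A.metric (u.pt x) (fderiv ℝ (fderiv ℝ u.height) x a b, 0) (u.normal x) +
      christoffelTwo A.metric (u.pt x) (u.dPt x b) (fderiv ℝ u.normal x a))).2 := by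
  have hN := contDiffAt_normal hx
  have h1 := ((((contDiffAt_shape hx).differentiableAt (by simp)).hasFDerivAt).clm_apply
    (hasFDerivAt_const b x)).fderiv
  have h2 := ((((hN.fderiv_right (m := ∞) (by simp)).differentiableAt
    (by simp)).hasFDerivAt).clm_apply (hasFDerivAt_const b x))
  have h3 := ((hasFDerivAt_christoffel_pt hx).clm_apply
    (differentiableAt_dPt_apply hx b).hasFDerivAt).clm_apply
      (hN.differentiableAt (by simp)).hasFDerivAt
  have h4 := ((h2.add h3).snd).fderiv
  have h5 : (fun y ↦ u.shape y b) = fun y ↦ (fderiv ℝ u.normal y b +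
    christoffelTwo A.metric (u.pt y) (u.dPt y b) (u.normal y)).2 := rfl
  have h6 := congrArg (fun f ↦ f a) h1
  rw [h5] at h6
  erw [h4] at h6
  simp [fderiv_dPt_apply hx] at h6 ⊢
  rw [← h6]
  abel

/-- The Codazzi equation. -/
theorem codazzi (a b : E) : fderiv ℝ u.shape x a b + u.levi x a (u.shape x b) =
    fderiv ℝ u.shape x b a + u.levi x b (u.shape x a) + u.curvOp x b a := by
  have hN := contDiffAt_normal hx
  have hs : fderiv ℝ (fderiv ℝ u.normal) x a b = fderiv ℝ (fderiv ℝ u.normal) x b a :=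
    hN.isSymmSndFDerivAt (by simpa using ENat.LEInfty.out) a b
  have hd : ∀ c, fderiv ℝ u.normal x c = u.dPt x (u.shape x c) -
      christoffelTwo A.metric (u.pt x) (u.dPt x c) (u.normal x) := fun c ↦ by
    rw [← cov_normal hx, cov_apply]; abel
  have hg : u.ind x (u.shape x a) (u.shape x b) = u.ind x (u.shape x b) (u.shape x a) :=
    ind_symm hx _ _
  rw [fderiv_shape hx, fderiv_shape hx, hs, fderiv_fderiv_height_symm hx a b, levi_apply,
    levi_apply, curvOp_apply, hg, hd a, hd b, map_sub, map_sub]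
  simp only [Prod.snd_add, Prod.snd_sub]
  abel

end SplitPatch.Graph

/-! ### The divergence identity -/

section Trace

variable {E : Type*} [NormedAddCommGroup E] [NormedSpace ℝ E] [FiniteDimensional ℝ E]

/-- The trace of an operator, as a continuous linear functional. -/
def traceL : (E →L[ℝ] E) →L[ℝ] ℝ :=
  LinearMap.toContinuousLinearMap ((LinearMap.trace ℝ E) ∘ₗ (ContinuousLinearMap.coeLM ℝ))

theorem traceL_apply (f : E →L[ℝ] E) : traceL f = LinearMap.trace ℝ E (f : E →ₗ[ℝ] E) := rfl

theorem contDiff_traceL : ContDiff ℝ ∞ (traceL (E := E)) := ContinuousLinearMap.contDiff _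

theorem traceL_comp_comm (f g : E →L[ℝ] E) : traceL (f ∘L g) = traceL (g ∘L f) :=
  LinearMap.trace_mul_comm ℝ (f : E →ₗ[ℝ] E) (g : E →ₗ[ℝ] E)

theorem traceL_smulRight (f : E →L[ℝ] ℝ) (v : E) : traceL (f.smulRight v) = f v :=
  LinearMap.trace_smulRight (f : E →ₗ[ℝ] ℝ) v

end Trace

namespace SplitPatch.Graph

variable {E : Type*} [NormedAddCommGroup E] [NormedSpace ℝ E] [FiniteDimensional ℝ E]
  {A : SplitPatch E} (u : A.Graph)

/-- The mean curvature. -/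
def meanCurv (x : E) : ℝ := traceL (u.shape x)

/-- The square `tr S²` of the norm of the second fundamental form. -/
def shapeSq (x : E) : ℝ := traceL (u.shape x ∘L u.shape x)

/-- The field `H X - S X`, where `X` is the tangential part of `∂_t`. Its divergence contains the
square of the second fundamental form. -/
def flux (x : E) : E := u.meanCurv x • u.tangTime x - u.shape x (u.tangTime x)

/-- The tangential part of `a ↦ ∇_a ∂_t`. -/
def covTime (x : E) : E →L[ℝ] E :=
  fderiv ℝ u.tangTime x + u.levi x (u.tangTime x) + u.coordTilt x • u.shape x

variable {u} {x : E} (hx : x ∈ u.dom)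
include hx

theorem contDiffAt_meanCurv : ContDiffAt ℝ ∞ u.meanCurv x :=
  ContDiffAt.comp (g := traceL (E := E)) (f := u.shape) x contDiff_traceL.contDiffAt
    (contDiffAt_shape hx)

theorem contDiffAt_shapeSq : ContDiffAt ℝ ∞ u.shapeSq x :=
  ContDiffAt.comp (g := traceL (E := E)) (f := fun y ↦ u.shape y ∘L u.shape y) x
    contDiff_traceL.contDiffAt ((contDiffAt_shape hx).clm_comp (contDiffAt_shape hx))

theorem contDiffAt_flux : ContDiffAt ℝ ∞ u.flux x :=
  ((contDiffAt_meanCurv hx).smul (contDiffAt_tangTime hx)).sub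
    ((contDiffAt_shape hx).clm_apply (contDiffAt_tangTime hx))

theorem ind_covTime (a b : E) : u.ind x (u.covTime x a) b =
    A.metric (u.pt x) (christoffelTwo A.metric (u.pt x) (u.dPt x a) (1, 0)) (u.dPt x b) := by
  rw [← ind_cov_tangTime hx, levi_symm hx a]; rfl

theorem fderiv_flux : fderiv ℝ u.flux x = u.meanCurv x • fderiv ℝ u.tangTime x +
    (traceL ∘L fderiv ℝ u.shape x).smulRight (u.tangTime x) -
    (u.shape x ∘L fderiv ℝ u.tangTime x + (fderiv ℝ u.shape x).flip (u.tangTime x)) := by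
  have hS := ((contDiffAt_shape hx).differentiableAt (by simp)).hasFDerivAt
  have hX := ((contDiffAt_tangTime hx).differentiableAt (by simp)).hasFDerivAt
  exact (((traceL.hasFDerivAt.comp x hS).smul hX).sub (hS.clm_apply hX)).fderiv

/-- The Codazzi equation, traced. -/
theorem traceL_fderiv_shape (b : E) : traceL ((fderiv ℝ u.shape x).flip b) =
    traceL (fderiv ℝ u.shape x b) + traceL (u.levi x b ∘L u.shape x) -
      traceL (u.levi x (u.shape x b)) + traceL (u.curvOp x b) := by
  have h : (fderiv ℝ u.shape x).flip b = fderiv ℝ u.shape x b + u.levi x b ∘L u.shape x -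
      u.levi x (u.shape x b) + u.curvOp x b := by
    ext a
    have := codazzi hx a b
    rw [levi_symm hx] at this
    simp only [ContinuousLinearMap.flip_apply, add_apply, sub_apply, ContinuousLinearMap.comp_apply]
    rw [eq_sub_of_add_eq this]
    abel
  rw [h, map_add, map_sub, map_add]

/-- The Riemannian divergence of `H X - S X`. The terms with derivatives of the second fundamental
form cancel by the Codazzi equation. -/
theorem divergence_flux : traceL (fderiv ℝ u.flux x) + traceL (u.levi x (u.flux x)) =
    u.coordTilt x * (u.shapeSq x - u.meanCurv x ^ 2) + u.meanCurv x * traceL (u.covTime x) -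
      traceL (u.shape x ∘L u.covTime x) - traceL (u.curvOp x (u.tangTime x)) := by
  have h1 : u.levi x (u.flux x) = u.meanCurv x • u.levi x (u.tangTime x) -
      u.levi x (u.shape x (u.tangTime x)) := by
    ext a
    rw [levi_symm hx]
    simp only [flux, map_sub, map_smul, sub_apply, smul_apply]
    rw [levi_symm hx a, levi_symm hx a]
  have h2 := traceL_comp_comm (u.levi x (u.tangTime x)) (u.shape x)
  rw [fderiv_flux hx, h1]
  simp only [map_add, map_sub, map_smul, traceL_fderiv_shape hx, traceL_smulRight, h2, covTime,
    ContinuousLinearMap.comp_add, ContinuousLinearMap.comp_smul, ContinuousLinearMap.comp_apply,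
    smul_eq_mul, shapeSq, meanCurv]
  ring

end SplitPatch.Graph

/-! ### Self-adjoint operators of an inner product -/

/-- `g` is an inner product. -/
structure IsInner {E : Type*} [NormedAddCommGroup E] [NormedSpace ℝ E] (g : E →L[ℝ] E →L[ℝ] ℝ) :
    Prop where
  symm : ∀ a b, g a b = g b a
  pos : ∀ a, a ≠ 0 → 0 < g a a

namespace IsInner

variable {E : Type*} [NormedAddCommGroup E] [NormedSpace ℝ E] [FiniteDimensional ℝ E]
  {g : E →L[ℝ] E →L[ℝ] ℝ} (hg : IsInner g)
include hg

theorem nonneg (a : E) : 0 ≤ g a a := by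
  by_cases ha : a = 0
  · simp [ha]
  · exact (hg.pos a ha).le

theorem cauchy_schwarz (v w : E) : g v w ^ 2 ≤ g v v * g w w := by
  have h : ∀ t : ℝ, 0 ≤ g w w * (t * t) + 2 * g v w * t + g v v := by
    intro t
    have := hg.nonneg (v + t • w)
    simp only [map_add, add_apply, map_smul, smul_apply, smul_eq_mul, hg.symm w v] at this
    linarith
  have := discrim_le_zero h
  unfold discrim at this
  nlinarith

theorem exists_basis : ∃ b : Module.Basis (Fin (Module.finrank ℝ E)) ℝ E,
    ∀ i j, g (b i) (b j) = if i = j then 1 else 0 := by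
  let B : LinearMap.BilinForm ℝ E := (ContinuousLinearMap.coeLM ℝ) ∘ₗ (g : E →ₗ[ℝ] (E →L[ℝ] ℝ))
  have hB : ∀ a b, B a b = g a b := fun _ _ ↦ rfl
  obtain ⟨v, hv⟩ := LinearMap.BilinForm.exists_orthogonal_basis (B := B)
    ⟨fun a b ↦ by simpa [hB] using hg.symm a b⟩
  have hp : ∀ i, 0 < √(g (v i) (v i)) := fun i ↦ Real.sqrt_pos.2 (hg.pos _ (v.ne_zero i))
  refine ⟨v.isUnitSMul (w := fun i ↦ (√(g (v i) (v i)))⁻¹)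
    fun i ↦ (inv_ne_zero (hp i).ne').isUnit, fun i j ↦ ?_⟩
  simp only [Module.Basis.isUnitSMul_apply, map_smul, smul_apply, smul_eq_mul]
  split_ifs with h
  · subst h
    rw [← mul_assoc, ← mul_inv, Real.mul_self_sqrt (hg.nonneg _),
      inv_mul_cancel₀ (hg.pos _ (v.ne_zero i)).ne']
  · have : g (v i) (v j) = 0 := hv h
    rw [this]; simp

theorem repr_eq {b : Module.Basis (Fin (Module.finrank ℝ E)) ℝ E}
    (hb : ∀ i j, g (b i) (b j) = if i = j then 1 else 0) (v : E) (i) : b.repr v i = g v (b i) := by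
  have h := congrArg (fun w ↦ g w (b i)) (b.sum_repr v)
  simpa [map_sum, sum_apply, hb, -Module.Basis.sum_repr] using h

theorem trace_eq {b : Module.Basis (Fin (Module.finrank ℝ E)) ℝ E}
    (hb : ∀ i j, g (b i) (b j) = if i = j then 1 else 0) (f : E →L[ℝ] E) :
    traceL f = ∑ i, g (f (b i)) (b i) := by
  rw [traceL_apply, LinearMap.trace_eq_matrix_trace ℝ b, Matrix.trace]
  refine Finset.sum_congr rfl fun i _ ↦ ?_
  rw [Matrix.diag_apply, LinearMap.toMatrix_apply, hg.repr_eq hb]; rfl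

theorem sum_sq {b : Module.Basis (Fin (Module.finrank ℝ E)) ℝ E}
    (hb : ∀ i j, g (b i) (b j) = if i = j then 1 else 0) (v : E) : g v v = ∑ i, g v (b i) ^ 2 := by
  have h := congrArg (fun w ↦ g v w) (b.sum_repr v)
  simp only [map_sum, map_smul, smul_eq_mul] at h
  rw [← h]
  exact Finset.sum_congr rfl fun i _ ↦ by rw [hg.repr_eq hb, pow_two]

theorem abs_trace_le {f : E →L[ℝ] E} {K : ℝ}
    (h : ∀ a, |g (f a) a| ≤ K * g a a) : |traceL f| ≤ Module.finrank ℝ E * K := by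
  obtain ⟨b, hb⟩ := hg.exists_basis
  rw [hg.trace_eq hb]
  calc |∑ i, g (f (b i)) (b i)| ≤ ∑ i, |g (f (b i)) (b i)| := Finset.abs_sum_le_sum_abs _ _
    _ ≤ ∑ i : Fin (Module.finrank ℝ E), K := Finset.sum_le_sum fun i _ ↦ by simpa [hb] using h (b i)
    _ = _ := by simp

section SelfAdjoint

variable {S : E →L[ℝ] E} (hS : ∀ a b, g (S a) b = g (S b) a)
include hS

theorem trace_comp_self {b : Module.Basis (Fin (Module.finrank ℝ E)) ℝ E}
    (hb : ∀ i j, g (b i) (b j) = if i = j then 1 else 0) :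
    traceL (S ∘L S) = ∑ i, g (S (b i)) (S (b i)) := by
  rw [hg.trace_eq hb]
  exact Finset.sum_congr rfl fun i _ ↦ hS _ _

theorem trace_comp_self_nonneg : 0 ≤ traceL (S ∘L S) := by
  obtain ⟨b, hb⟩ := hg.exists_basis
  rw [hg.trace_comp_self hS hb]
  exact Finset.sum_nonneg fun i _ ↦ hg.nonneg _

/-- `(tr S)² ≤ n tr (S²)`. -/
theorem trace_sq_le : traceL S ^ 2 ≤ Module.finrank ℝ E * traceL (S ∘L S) := by
  obtain ⟨b, hb⟩ := hg.exists_basis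
  rw [hg.trace_comp_self hS hb, hg.trace_eq hb]
  have h := sq_sum_le_card_mul_sum_sq (s := Finset.univ) (f := fun i ↦ g (S (b i)) (b i))
  rw [Finset.card_univ, Fintype.card_fin] at h
  refine h.trans (mul_le_mul_of_nonneg_left (Finset.sum_le_sum fun i _ ↦ ?_) (by positivity))
  have := hg.cauchy_schwarz (S (b i)) (b i)
  simpa [hb] using this

/-- A bound for `tr (S f)` by the norm of `S`, when the bilinear form of `f` is bounded by `K`. -/
theorem trace_comp_sq_le {f : E →L[ℝ] E} {K : ℝ}
    (h : ∀ a b, g (f a) b ^ 2 ≤ K ^ 2 * (g a a * g b b)) :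
    traceL (S ∘L f) ^ 2 ≤ Module.finrank ℝ E * (K ^ 2 * traceL (S ∘L S)) := by
  obtain ⟨b, hb⟩ := hg.exists_basis
  rw [hg.trace_comp_self hS hb, hg.trace_eq hb]
  have h1 := sq_sum_le_card_mul_sum_sq (s := Finset.univ) (f := fun i ↦ g ((S ∘L f) (b i)) (b i))
  rw [Finset.card_univ, Fintype.card_fin] at h1
  refine h1.trans (mul_le_mul_of_nonneg_left ?_ (by positivity))
  rw [Finset.mul_sum]
  refine Finset.sum_le_sum fun i _ ↦ ?_
  rw [ContinuousLinearMap.comp_apply, hS, hg.symm]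
  simpa [hb] using h (b i) (S (b i))

theorem apply_le (v : E) : g (S v) (S v) ≤ g v v * traceL (S ∘L S) := by
  obtain ⟨b, hb⟩ := hg.exists_basis
  rw [hg.trace_comp_self hS hb, hg.sum_sq hb (S v), Finset.mul_sum]
  refine Finset.sum_le_sum fun i _ ↦ ?_
  rw [hS, hg.symm, hg.symm (S (b i))]
  have := hg.cauchy_schwarz v (S (b i))
  rwa [hg.symm (S (b i))]

/-- A self-adjoint operator of small trace is not concentrated in a single direction: the bound
improves on `apply_le` by a factor less than one, up to the square of the trace. -/
theorem apply_le_refined (v : E) : (1 + 2 * Module.finrank ℝ E) * g (S v) (S v) ≤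
    g v v * (2 * traceL S ^ 2 + 2 * Module.finrank ℝ E * traceL (S ∘L S)) := by
  by_cases hv : v = 0
  · simp [hv]
  have hvp := hg.pos v hv
  -- reduce to a unit vector
  suffices key : ∀ e, g e e = 1 → (1 + 2 * Module.finrank ℝ E) * g (S e) (S e) ≤
      2 * traceL S ^ 2 + 2 * Module.finrank ℝ E * traceL (S ∘L S) by
    have hs := Real.sqrt_pos.2 hvp
    have h1 := key ((√(g v v))⁻¹ • v) (by
      simp only [map_smul, smul_apply, smul_eq_mul]
      rw [← mul_assoc, ← mul_inv, Real.mul_self_sqrt hvp.le, inv_mul_cancel₀ hvp.ne'])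
    simp only [map_smul, smul_apply, smul_eq_mul] at h1
    rw [← mul_assoc (√(g v v))⁻¹, ← mul_inv, Real.mul_self_sqrt hvp.le] at h1
    have h2 := mul_le_mul_of_nonneg_left h1 hvp.le
    refine le_trans (le_of_eq ?_) h2
    field_simp
  intro e he
  -- compress `S` to the orthogonal complement of `e` and apply `trace_sq_le` there
  let R : E →L[ℝ] E := (g e).smulRight e
  let Q : E →L[ℝ] E := ContinuousLinearMap.id ℝ E - R
  have hQ : ∀ a, Q a = a - g e a • e := fun _ ↦ rfl
  have hQQ : Q ∘L Q = Q := by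
    ext a
    simp [hQ, he]
  have hQs : ∀ a b, g (Q a) b = g a (Q b) := fun a b ↦ by
    simp [hQ, hg.symm a e]
    ring
  have hM : ∀ a b, g ((Q ∘L S ∘L Q) a) b = g ((Q ∘L S ∘L Q) b) a := fun a b ↦ by
    simp only [ContinuousLinearMap.comp_apply]
    rw [hQs, hS, ← hQs, hg.symm]
  have h1 := hg.trace_sq_le hM
  have h2 : traceL (Q ∘L S ∘L Q) = traceL S - g e (S e) := by
    rw [traceL_comp_comm, ContinuousLinearMap.comp_assoc, hQQ]
    have : S ∘L Q = S - (g e).smulRight (S e) := by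
      ext a; simp [hQ]
    rw [this, map_sub, traceL_smulRight]
  have h3 : traceL ((Q ∘L S ∘L Q) ∘L (Q ∘L S ∘L Q)) =
      traceL (S ∘L S) - 2 * g (S e) (S e) + g e (S e) ^ 2 := by
    have e1 : (Q ∘L S ∘L Q) ∘L (Q ∘L S ∘L Q) = Q ∘L (S ∘L (Q ∘L Q) ∘L S ∘L Q) := by
      ext a; rfl
    have e2 : (S ∘L (Q ∘L Q) ∘L S ∘L Q) ∘L Q = S ∘L Q ∘L S ∘L Q := by
      rw [hQQ]
      have : (S ∘L Q ∘L S ∘L Q) ∘L Q = S ∘L Q ∘L S ∘L (Q ∘L Q) := by ext a; rfl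
      rw [this, hQQ]
    rw [e1, traceL_comp_comm, e2]
    have e3 : S ∘L Q ∘L S ∘L Q = S ∘L S - (g e ∘L S).smulRight (S e) -
        (g e).smulRight (S (S e)) + (g e (S e)) • (g e).smulRight (S e) := by
      ext a
      simp [hQ]
      module
    rw [e3, map_add, map_sub, map_sub, map_smul, traceL_smulRight, traceL_smulRight,
      traceL_smulRight, ContinuousLinearMap.comp_apply, hg.symm e (S (S e)), hS (S e) e]
    simp only [smul_eq_mul]
    ring
  rw [h2, h3] at h1
  have h4 := hg.cauchy_schwarz e (S e)
  rw [he, one_mul] at h4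
  have h5 : (0 : ℝ) ≤ Module.finrank ℝ E := by positivity
  have h6 : (1 : ℝ) ≤ Module.finrank ℝ E := by
    have : Nontrivial E := ⟨e, 0, by rintro rfl; simp at he⟩
    exact_mod_cast Module.finrank_pos (R := ℝ) (M := E)
  have h7 := sq_nonneg (2 * traceL S - g e (S e))
  have h8 := mul_nonneg (sub_nonneg.2 h6) (sub_nonneg.2 h4)
  nlinarith

end SelfAdjoint
end IsInner

/-! ### Uniform bounds over compact sets -/

/-- The constant `k` bounds the geometry of the patch at `p`: the inverse of the lapse, the
norms of the metric, its inverse and its connection coefficients with their derivatives, and the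
ellipticity of `σ`. -/
structure SplitPatch.BoundAt {E : Type*} [NormedAddCommGroup E] [NormedSpace ℝ E]
    (A : SplitPatch E) (k : ℝ) (p : ℝ × E) : Prop where
  one_le : 1 ≤ k
  lapse_inv : (A.lapse p)⁻¹ ≤ k
  sigma : ‖A.sigma p‖ ≤ k
  metric : ‖A.metric p‖ ≤ k
  inverse : ‖(A.metric p).inverse‖ ≤ k
  conn : ‖christoffelTwo A.metric p‖ ≤ k
  dconn : ‖fderiv ℝ (christoffelTwo A.metric) p‖ ≤ k
  elliptic : ∀ a : E, ‖a‖ ^ 2 ≤ k * A.sigma p (0, a) (0, a)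

namespace SplitPatch

variable {E : Type*} [NormedAddCommGroup E] [NormedSpace ℝ E] [FiniteDimensional ℝ E]
  {A : SplitPatch E}

/-- By compactness of the unit sphere, `σ` is uniformly positive definite over a compact set. -/
theorem exists_elliptic {Q : Set (ℝ × E)} (hQ : IsCompact Q) (hb : ∀ p ∈ Q, p.2 ∈ A.base) :
    ∃ k, ∀ p ∈ Q, ∀ a : E, ‖a‖ ^ 2 ≤ k * A.sigma p (0, a) (0, a) := by
  have hcont : ContinuousOn (fun q : (ℝ × E) × E ↦ (A.sigma q.1 (0, q.2) (0, q.2))⁻¹)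
      (Q ×ˢ Metric.sphere 0 1) := by
    rintro ⟨p, a⟩ ⟨hp, ha⟩
    have h1 : ContinuousAt (fun q : (ℝ × E) × E ↦ A.sigma q.1) (p, a) :=
      (A.sigma_smooth p (hb p hp)).continuousAt.comp continuousAt_fst
    have h2 : ContinuousAt (fun q : (ℝ × E) × E ↦ ((0 : ℝ), q.2)) (p, a) := by fun_prop
    have ha0 : a ≠ 0 := by
      rintro rfl; simp at ha
    exact (((h1.clm_apply h2).clm_apply h2).inv₀
      (A.sigma_pos p (hb p hp) (0, a) ha0).ne').continuousWithinAt
  obtain ⟨k, hk⟩ := (hQ.prod (isCompact_sphere (0 : E) 1)).exists_bound_of_continuousOn hcont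
  refine ⟨k, fun p hp a ↦ ?_⟩
  by_cases ha : a = 0
  · have : A.sigma p (0, a) (0, a) = 0 := by rw [ha]; exact A.sigma_ker p (hb p hp) _ _
    rw [this, ha]; simp
  have hn : 0 < ‖a‖ := norm_pos_iff.2 ha
  have h1 := hk (p, ‖a‖⁻¹ • a) ⟨hp, by simp [norm_smul, hn.ne']⟩
  have h2 : ((0 : ℝ), ‖a‖⁻¹ • a) = ‖a‖⁻¹ • ((0 : ℝ), a) := by simp
  have h3 := A.sigma_pos p (hb p hp) (0, a) ha
  simp only [h2, map_smul, smul_apply, smul_eq_mul] at h1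
  rw [Real.norm_of_nonneg (by positivity)] at h1
  have h4 : (‖a‖⁻¹ * (‖a‖⁻¹ * A.sigma p (0, a) (0, a)))⁻¹ * A.sigma p (0, a) (0, a) = ‖a‖ ^ 2 := by
    field_simp
  rw [← h4]
  exact mul_le_mul_of_nonneg_right h1 h3.le

/-- The geometry is bounded on compact sets of points over the base. -/
theorem exists_boundAt {Q : Set (ℝ × E)} (hQ : IsCompact Q) (hb : ∀ p ∈ Q, p.2 ∈ A.base) :
    ∃ k, ∀ p ∈ Q, A.BoundAt k p := by
  have hl : ContinuousOn A.lapse Q := fun p hp ↦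
    (A.lapse_smooth p (hb p hp)).continuousAt.continuousWithinAt
  have hli : ContinuousOn (fun p ↦ (A.lapse p)⁻¹) Q :=
    hl.inv₀ fun p hp ↦ (A.lapse_pos p (hb p hp)).ne'
  have hs : ContinuousOn A.sigma Q := fun p hp ↦
    (A.sigma_smooth p (hb p hp)).continuousAt.continuousWithinAt
  have hm : ContinuousOn A.metric Q := fun p hp ↦
    (contDiffAt_metric (hb p hp)).continuousAt.continuousWithinAt
  have hi : ContinuousOn (fun p ↦ (A.metric p).inverse) Q := fun p hp ↦
    (ContinuousAt.comp (g := ContinuousLinearMap.inverse) (f := A.metric)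
      ((isInvertible_metric (hb p hp)).contDiffAt_map_inverse (n := ∞)).continuousAt
      (contDiffAt_metric (hb p hp)).continuousAt).continuousWithinAt
  have hc : ContinuousOn (christoffelTwo A.metric) Q := fun p hp ↦
    (contDiffAt_christoffel (hb p hp)).continuousAt.continuousWithinAt
  have hd : ContinuousOn (fderiv ℝ (christoffelTwo A.metric)) Q := fun p hp ↦
    ((contDiffAt_christoffel (hb p hp)).fderiv_right (m := ∞)
      (by simp)).continuousAt.continuousWithinAt
  obtain ⟨k2, h2⟩ := hQ.exists_bound_of_continuousOn hli
  obtain ⟨k3, h3⟩ := hQ.exists_bound_of_continuousOn hs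
  obtain ⟨k4, h4⟩ := hQ.exists_bound_of_continuousOn hm
  obtain ⟨k5, h5⟩ := hQ.exists_bound_of_continuousOn hi
  obtain ⟨k6, h6⟩ := hQ.exists_bound_of_continuousOn hc
  obtain ⟨k7, h7⟩ := hQ.exists_bound_of_continuousOn hd
  obtain ⟨k8, h8⟩ := exists_elliptic hQ hb
  let k := 1 + |k2| + |k3| + |k4| + |k5| + |k6| + |k7| + |k8|
  have a2 := abs_nonneg k2
  have a3 := abs_nonneg k3
  have a4 := abs_nonneg k4
  have a5 := abs_nonneg k5
  have a6 := abs_nonneg k6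
  have a7 := abs_nonneg k7
  have a8 := abs_nonneg k8
  refine ⟨k, fun p hp ↦ ⟨by linarith, ?_, ?_, ?_, ?_, ?_, ?_, fun a ↦ ?_⟩⟩
  · have := (le_abs_self _).trans (h2 p hp); linarith [le_abs_self k2]
  · have := h3 p hp; linarith [le_abs_self k3]
  · have := h4 p hp; linarith [le_abs_self k4]
  · have := h5 p hp; linarith [le_abs_self k5]
  · have := h6 p hp; linarith [le_abs_self k6]
  · have := h7 p hp; linarith [le_abs_self k7]
  · exact (h8 p hp a).trans (mul_le_mul_of_nonneg_right (by linarith [le_abs_self k8])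
      (sigma_nonneg (hb p hp) _))

namespace Graph

variable {u : A.Graph} {x : E} (hx : x ∈ u.dom) {k : ℝ} (hk : A.BoundAt k (u.pt x))
include hx hk

theorem sq_fderiv_height_le (a : E) : (fderiv ℝ u.height x a) ^ 2 ≤ k * ‖a‖ ^ 2 := by
  have h1 : (fderiv ℝ u.height x a) ^ 2 ≤ A.sigma (u.pt x) (0, a) (0, a) := by
    by_cases ha : a = 0
    · simpa [ha] using sigma_nonneg (mem_base hx) _
    · exact (u.spacelike x hx a ha).le
  refine h1.trans ?_
  have h2 := (A.sigma (u.pt x)).le_opNorm₂ (0, a) (0, a)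
  rw [Real.norm_of_nonneg (sigma_nonneg (mem_base hx) _)] at h2
  have h3 : ‖((0 : ℝ), a)‖ = ‖a‖ := by simp [Prod.norm_def]
  rw [h3, mul_assoc, ← pow_two] at h2
  exact h2.trans (mul_le_mul_of_nonneg_right hk.sigma (by positivity))

theorem abs_fderiv_height_le (a : E) : |fderiv ℝ u.height x a| ≤ k * ‖a‖ := by
  refine abs_le_of_sq_le_sq ?_ (mul_nonneg (by linarith [hk.one_le]) (norm_nonneg _))
  have h := sq_fderiv_height_le hx hk a
  have := hk.one_le
  nlinarith [sq_nonneg ‖a‖]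

theorem norm_dPt_apply_le (a : E) : ‖u.dPt x a‖ ≤ k * ‖a‖ := by
  rw [dPt_apply, Prod.norm_def]
  refine max_le (abs_fderiv_height_le hx hk a) ?_
  have := hk.one_le
  nlinarith [norm_nonneg a]

theorem norm_conormal_le : ‖u.conormal x‖ ≤ 2 * k := by
  have h1 := hk.one_le
  refine ContinuousLinearMap.opNorm_le_bound _ (by linarith) fun v ↦ ?_
  rw [conormal_apply]
  have h2 := norm_fst_le v
  have h3 := norm_snd_le v
  have h4 := abs_fderiv_height_le hx hk v.2
  refine (abs_sub _ _).trans ?_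
  rw [Real.norm_eq_abs] at h2
  have h5 : k * ‖v.2‖ ≤ k * ‖v‖ := mul_le_mul_of_nonneg_left h3 (by linarith)
  have h6 : 1 * ‖v‖ ≤ k * ‖v‖ := mul_le_mul_of_nonneg_right h1 (norm_nonneg _)
  linarith

/-- The coordinates of the unit normal grow at most like the tilt. -/
theorem norm_normal_le : ‖u.normal x‖ ≤ 2 * k ^ 2 * u.coordTilt x := by
  have h1 := hk.one_le
  rw [normal, norm_smul, norm_neg, Real.norm_of_nonneg (coordTilt_pos hx).le, mul_comm]
  refine mul_le_mul_of_nonneg_right ?_ (coordTilt_pos hx).le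
  refine (ContinuousLinearMap.le_opNorm _ _).trans ?_
  refine (mul_le_mul hk.inverse (norm_conormal_le hx hk) (norm_nonneg _) (by linarith)).trans ?_
  nlinarith

theorem norm_tangTime_le : ‖u.tangTime x‖ ≤ 2 * k ^ 2 * u.coordTilt x ^ 2 := by
  have h := (norm_snd_le (u.normal x)).trans (norm_normal_le hx hk)
  rw [tangTime, norm_smul, norm_neg, Real.norm_of_nonneg (coordTilt_pos hx).le]
  have := mul_le_mul_of_nonneg_left h (coordTilt_pos hx).le
  linarith

/-- The induced metric degenerates at most like the inverse square of the tilt. -/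
theorem sq_norm_le (a : E) : ‖a‖ ^ 2 ≤ k ^ 5 * u.coordTilt x ^ 2 * u.ind x a a := by
  have hl := A.lapse_pos _ (mem_base hx)
  have hW := coordTilt_pos hx
  have h1 := hk.one_le
  have hs := sigma_nonneg (mem_base hx) ((0 : ℝ), a)
  -- Cauchy-Schwarz for `σ` bounds `du (a)²`
  have key : A.sigma (u.pt x) (0, a) (0, a) ≤
      (A.lapse (u.pt x))⁻¹ ^ 4 * u.coordTilt x ^ 2 * u.ind x a a := by
    have e1 := sigma_gradVec hx a
    have e2 := neg_conormal_gradVec hx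
    rw [← coordTilt_sq_inv hx] at e2
    have e3 := sigma_cauchy_schwarz (mem_base hx) ((0 : ℝ), (u.gradVec x).2) (0, a)
    rw [ind_eq hx]
    set s := A.sigma (u.pt x) (0, a) (0, a)
    set y := A.sigma (u.pt x) (0, (u.gradVec x).2) (0, (u.gradVec x).2)
    set c := A.sigma (u.pt x) (0, (u.gradVec x).2) (0, a)
    set l := A.lapse (u.pt x)
    set W := u.coordTilt x
    have e4 : fderiv ℝ u.height x a * fderiv ℝ u.height x a = l ^ 4 * c ^ 2 := by
      have : fderiv ℝ u.height x a = -(l ^ 2 * c) := by linarith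
      rw [this]; ring
    rw [e4]
    have e5 : l ^ 2 * (s - l ^ 4 * c ^ 2) ≥ l ^ 2 * (s - l ^ 4 * (y * s)) :=
      mul_le_mul_of_nonneg_left (by nlinarith [pow_pos hl 4]) (by positivity)
    have e6 : l ^ 2 * (s - l ^ 4 * (y * s)) = l ^ 4 * s * (W ^ 2)⁻¹ := by
      rw [e2]; field_simp
    rw [e6] at e5
    have e7 : s = l⁻¹ ^ 4 * W ^ 2 * (l ^ 4 * s * (W ^ 2)⁻¹) := by field_simp
    calc s = l⁻¹ ^ 4 * W ^ 2 * (l ^ 4 * s * (W ^ 2)⁻¹) := e7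
      _ ≤ _ := mul_le_mul_of_nonneg_left e5 (by positivity)
  calc ‖a‖ ^ 2 ≤ k * A.sigma (u.pt x) (0, a) (0, a) := hk.elliptic a
    _ ≤ k * ((A.lapse (u.pt x))⁻¹ ^ 4 * u.coordTilt x ^ 2 * u.ind x a a) :=
      mul_le_mul_of_nonneg_left key (by linarith)
    _ ≤ k * (k ^ 4 * u.coordTilt x ^ 2 * u.ind x a a) := by
      have := ind_nonneg hx a
      have h2 : (A.lapse (u.pt x))⁻¹ ^ 4 ≤ k ^ 4 :=
        pow_le_pow_left₀ (by positivity) hk.lapse_inv 4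
      gcongr
    _ = _ := by ring

/-- A vector of unit length for the induced metric has coordinate length at most of the order of the
tilt. -/
theorem norm_le_sqrt (a : E) : ‖a‖ ≤ k ^ 3 * u.coordTilt x * √(u.ind x a a) := by
  have h1 := hk.one_le
  have hW := coordTilt_pos hx
  refine le_of_sq_le_sq ?_ (by positivity)
  rw [mul_pow, Real.sq_sqrt (ind_nonneg hx a), mul_pow]
  refine (sq_norm_le hx hk a).trans ?_
  have h2 : k ^ 5 ≤ (k ^ 3) ^ 2 := by rw [← pow_mul]; exact pow_le_pow_right₀ h1 (by norm_num)
  have := ind_nonneg hx a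
  gcongr

theorem abs_metric_conn_le (a : E) (v w : ℝ × E) :
    |A.metric (u.pt x) (christoffelTwo A.metric (u.pt x) (u.dPt x a) v) w| ≤
      k ^ 3 * ‖a‖ * ‖v‖ * ‖w‖ := by
  have h1 := hk.one_le
  calc _ ≤ ‖A.metric (u.pt x)‖ * ‖christoffelTwo A.metric (u.pt x) (u.dPt x a) v‖ * ‖w‖ :=
        (A.metric (u.pt x)).le_opNorm₂ _ _
    _ ≤ k * (k * (k * ‖a‖) * ‖v‖) * ‖w‖ := by
        have e1 := (christoffelTwo A.metric (u.pt x)).le_opNorm₂ (u.dPt x a) v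
        have e2 : ‖christoffelTwo A.metric (u.pt x)‖ * ‖u.dPt x a‖ * ‖v‖ ≤ k * (k * ‖a‖) * ‖v‖ :=
          mul_le_mul_of_nonneg_right (mul_le_mul hk.conn (norm_dPt_apply_le hx hk a)
            (norm_nonneg _) (by linarith)) (norm_nonneg _)
        exact mul_le_mul_of_nonneg_right (mul_le_mul hk.metric (e1.trans e2) (norm_nonneg _)
          (by linarith)) (norm_nonneg _)
    _ = _ := by ring

theorem abs_ind_covTime_le (a b : E) : |u.ind x (u.covTime x a) b| ≤
    k ^ 10 * u.coordTilt x ^ 2 * (√(u.ind x a a) * √(u.ind x b b)) := by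
  have h1 := hk.one_le
  have hW := coordTilt_pos hx
  rw [ind_covTime hx]
  refine (abs_metric_conn_le hx hk a _ _).trans ?_
  have e : ‖((1 : ℝ), (0 : E))‖ = 1 := by simp [Prod.norm_def]
  rw [e]
  calc k ^ 3 * ‖a‖ * 1 * ‖u.dPt x b‖ ≤ k ^ 3 * (k ^ 3 * u.coordTilt x * √(u.ind x a a)) * 1 *
        (k * (k ^ 3 * u.coordTilt x * √(u.ind x b b))) := by
        gcongr
        · exact norm_le_sqrt hx hk a
        · refine (norm_dPt_apply_le hx hk b).trans ?_
          gcongr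
          exact norm_le_sqrt hx hk b
    _ = _ := by ring

theorem norm_curvOp_le (b : E) : ‖u.curvOp x b‖ ≤ 8 * k ^ 6 * ‖b‖ * u.coordTilt x := by
  have h1 := hk.one_le
  have hW := coordTilt_pos hx
  have hn := norm_normal_le hx hk
  have hF := norm_dPt_apply_le hx hk
  have hC : ∀ v w, ‖christoffelTwo A.metric (u.pt x) v w‖ ≤ k * ‖v‖ * ‖w‖ := fun v w ↦
    ((christoffelTwo A.metric (u.pt x)).le_opNorm₂ v w).trans (by gcongr; exact hk.conn)
  have hD : ∀ v w z, ‖fderiv ℝ (christoffelTwo A.metric) (u.pt x) v w z‖ ≤ k * ‖v‖ * ‖w‖ * ‖z‖ :=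
    fun v w z ↦ by
      have e1 := (fderiv ℝ (christoffelTwo A.metric) (u.pt x)).le_opNorm₂ v w
      have e2 := (fderiv ℝ (christoffelTwo A.metric) (u.pt x) v w).le_opNorm z
      refine e2.trans (mul_le_mul_of_nonneg_right (e1.trans ?_) (norm_nonneg _))
      gcongr
      exact hk.dconn
  refine ContinuousLinearMap.opNorm_le_bound _ (by positivity) fun a ↦ ?_
  rw [curvOp_apply]
  refine (norm_snd_le _).trans ?_
  have hab : 0 ≤ ‖a‖ * ‖b‖ * ‖u.normal x‖ := by positivity
  have t1 : ‖fderiv ℝ (christoffelTwo A.metric) (u.pt x) (u.dPt x a) (u.dPt x b) (u.normal x)‖ ≤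
      k ^ 4 * (‖a‖ * ‖b‖ * ‖u.normal x‖) := by
    calc _ ≤ k * (k * ‖a‖) * (k * ‖b‖) * ‖u.normal x‖ := (hD _ _ _).trans (by
            gcongr
            exacts [hF a, hF b])
      _ = k ^ 3 * (‖a‖ * ‖b‖ * ‖u.normal x‖) := by ring
      _ ≤ _ := mul_le_mul_of_nonneg_right (pow_le_pow_right₀ h1 (by norm_num)) hab
  have t2 : ‖fderiv ℝ (christoffelTwo A.metric) (u.pt x) (u.dPt x b) (u.dPt x a) (u.normal x)‖ ≤
      k ^ 4 * (‖a‖ * ‖b‖ * ‖u.normal x‖) := by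
    calc _ ≤ k * (k * ‖b‖) * (k * ‖a‖) * ‖u.normal x‖ := (hD _ _ _).trans (by
            gcongr
            exacts [hF b, hF a])
      _ = k ^ 3 * (‖a‖ * ‖b‖ * ‖u.normal x‖) := by ring
      _ ≤ _ := mul_le_mul_of_nonneg_right (pow_le_pow_right₀ h1 (by norm_num)) hab
  have t3 : ∀ c d : E, ‖christoffelTwo A.metric (u.pt x) (u.dPt x c)
      (christoffelTwo A.metric (u.pt x) (u.dPt x d) (u.normal x))‖ ≤
      k ^ 4 * (‖c‖ * ‖d‖ * ‖u.normal x‖) := fun c d ↦ by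
    calc _ ≤ k * (k * ‖c‖) * (k * (k * ‖d‖) * ‖u.normal x‖) := (hC _ _).trans (by
            gcongr
            · exact hF c
            · exact (hC _ _).trans (by gcongr; exact hF d))
      _ = _ := by ring
  have t4 := t3 a b
  have t5 := t3 b a
  rw [mul_comm ‖b‖] at t5
  calc _ ≤ 4 * (k ^ 4 * (‖a‖ * ‖b‖ * ‖u.normal x‖)) := by
        refine (norm_sub_le _ _).trans ?_
        have := (norm_add_le (fderiv ℝ (christoffelTwo A.metric) (u.pt x) (u.dPt x a) (u.dPt x b)
          (u.normal x) - fderiv ℝ (christoffelTwo A.metric) (u.pt x) (u.dPt x b) (u.dPt x a)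
          (u.normal x)) (christoffelTwo A.metric (u.pt x) (u.dPt x a)
          (christoffelTwo A.metric (u.pt x) (u.dPt x b) (u.normal x))))
        have := norm_sub_le (fderiv ℝ (christoffelTwo A.metric) (u.pt x) (u.dPt x a) (u.dPt x b)
          (u.normal x)) (fderiv ℝ (christoffelTwo A.metric) (u.pt x) (u.dPt x b) (u.dPt x a)
          (u.normal x))
        linarith
    _ ≤ 4 * (k ^ 4 * (‖a‖ * ‖b‖ * (2 * k ^ 2 * u.coordTilt x))) := by gcongr
    _ = _ := by ring

end Graph
end SplitPatch

/-! ### The pointwise estimate -/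

/-- Young's inequality for the terms of the divergence identity. Here `P²` and `H` stand for the
squared norm and the trace of the second fundamental form, `W` for the tilt, `z` for `|∇η|`. -/
theorem young_absorb {δ K W P H η z t₁ t₂ t₃ sx hx e d : ℝ} (hδ : 0 < δ) (hK : 0 ≤ K) (hW : 0 < W)
    (hP : 0 ≤ P) (h₁ : |t₁| ≤ K * W ^ 2) (h₂ : |t₂| ≤ K * W ^ 2 * P)
    (h₃ : |t₃| ≤ K * W ^ 3) (hsx : sx ≤ W ^ 2 * (2 * H ^ 2 + (1 - δ) * P ^ 2))
    (hhx : |hx| ≤ W ^ 2 * P) (he : |e| ≤ K * W ^ 3 * (|H| + P)) (hd : |d| ≤ z * W * (|H| + P)) :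
    δ / 2 * (η ^ 2 * P ^ 2) ≤ (η ^ 2 / W * (W * (P ^ 2 - H ^ 2) + H * t₁ - t₂ - t₃) +
      2 * η / W * d + η ^ 2 / W ^ 2 * (H * hx - sx + e)) +
      (4 + 2 * K + 6 * K ^ 2 / δ + 6 / δ) * (z ^ 2 + η ^ 2 * H ^ 2 + η ^ 2 * W ^ 2) := by
  -- divide by the powers of the tilt
  have n₁ : |t₁ / W| ≤ K * W := by
    rw [abs_div, abs_of_pos hW, div_le_iff₀ hW]; linarith
  have n₂ : |t₂ / W| ≤ K * W * P := by
    rw [abs_div, abs_of_pos hW, div_le_iff₀ hW]; linarith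
  have n₃ : |t₃ / W| ≤ K * W ^ 2 := by
    rw [abs_div, abs_of_pos hW, div_le_iff₀ hW]; linarith
  have hW2 : 0 < W ^ 2 := by positivity
  have nsx : sx / W ^ 2 ≤ 2 * H ^ 2 + (1 - δ) * P ^ 2 := by
    rw [div_le_iff₀ hW2]; linarith
  have nhx : |hx / W ^ 2| ≤ P := by
    rw [abs_div, abs_of_pos hW2, div_le_iff₀ hW2]; linarith
  have ne : |e / W ^ 2| ≤ K * W * (|H| + P) := by
    rw [abs_div, abs_of_pos hW2, div_le_iff₀ hW2]; linarith
  have nd : |d / W| ≤ z * (|H| + P) := by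
    rw [abs_div, abs_of_pos hW, div_le_iff₀ hW]; linarith
  have expand : (η ^ 2 / W * (W * (P ^ 2 - H ^ 2) + H * t₁ - t₂ - t₃) +
      2 * η / W * d + η ^ 2 / W ^ 2 * (H * hx - sx + e)) =
      η ^ 2 * (P ^ 2 - H ^ 2 + H * (t₁ / W) - t₂ / W - t₃ / W + H * (hx / W ^ 2) - sx / W ^ 2 +
        e / W ^ 2) + 2 * (η * (d / W)) := by
    field_simp
    ring
  rw [expand]
  have hH : |H| ^ 2 = H ^ 2 := sq_abs H
  have hη : |η| ^ 2 = η ^ 2 := sq_abs η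
  have m₁ : -(|H| * (K * W)) ≤ H * (t₁ / W) := by
    have := mul_le_mul_of_nonneg_left n₁ (abs_nonneg H)
    rw [← abs_mul] at this
    linarith [neg_abs_le (H * (t₁ / W))]
  have mh : -(|H| * P) ≤ H * (hx / W ^ 2) := by
    have := mul_le_mul_of_nonneg_left nhx (abs_nonneg H)
    rw [← abs_mul] at this
    linarith [neg_abs_le (H * (hx / W ^ 2))]
  have md : -(|η| * (z * (|H| + P))) ≤ η * (d / W) := by
    have := mul_le_mul_of_nonneg_left nd (abs_nonneg η)
    rw [← abs_mul] at this
    linarith [neg_abs_le (η * (d / W))]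
  have m₂ := le_of_abs_le n₂
  have m₃ := le_of_abs_le n₃
  have me := neg_le_of_abs_le ne
  -- Young's inequality
  have y₁ : 2 * (K * W * P) ≤ δ / 6 * P ^ 2 + 6 * K ^ 2 / δ * W ^ 2 := by
    have h := sq_nonneg (δ * P - 6 * (K * W))
    have : δ / 6 * P ^ 2 + 6 * K ^ 2 / δ * W ^ 2 - 2 * (K * W * P) =
      (δ * P - 6 * (K * W)) ^ 2 / (6 * δ) := by field_simp; ring
    have h2 : 0 ≤ (δ * P - 6 * (K * W)) ^ 2 / (6 * δ) := by positivity
    linarith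
  have y₂ : |H| * P ≤ δ / 6 * P ^ 2 + 6 / δ * H ^ 2 := by
    have : δ / 6 * P ^ 2 + 6 / δ * |H| ^ 2 - 2 * (|H| * P) =
      (δ * P - 6 * |H|) ^ 2 / (6 * δ) := by field_simp; ring
    have h2 : 0 ≤ (δ * P - 6 * |H|) ^ 2 / (6 * δ) := by positivity
    have h3 := mul_nonneg (abs_nonneg H) hP
    rw [hH] at this
    linarith
  have y₃ : 2 * (|η| * (z * P)) ≤ δ / 6 * (η ^ 2 * P ^ 2) + 6 / δ * z ^ 2 := by
    have : δ / 6 * (|η| ^ 2 * P ^ 2) + 6 / δ * z ^ 2 - 2 * (|η| * (z * P)) =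
      (δ * (|η| * P) - 6 * z) ^ 2 / (6 * δ) := by field_simp; ring
    have h2 : 0 ≤ (δ * (|η| * P) - 6 * z) ^ 2 / (6 * δ) := by positivity
    rw [hη] at this
    linarith
  have y₄ : 2 * (|η| * (z * |H|)) ≤ z ^ 2 + η ^ 2 * H ^ 2 := by
    have h := sq_nonneg (z - |η| * |H|)
    have : (z - |η| * |H|) ^ 2 = z ^ 2 + |η| ^ 2 * |H| ^ 2 - 2 * (|η| * (z * |H|)) := by ring
    rw [this, hη, hH] at h
    linarith
  have y₅ : 2 * (|H| * (K * W)) ≤ K * (H ^ 2 + W ^ 2) := by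
    have h := mul_nonneg hK (sq_nonneg (|H| - W))
    have : K * (|H| - W) ^ 2 = K * (|H| ^ 2 + W ^ 2) - 2 * (|H| * (K * W)) := by ring
    rw [this, hH] at h
    linarith
  have inner : P ^ 2 - H ^ 2 + H * (t₁ / W) - t₂ / W - t₃ / W + H * (hx / W ^ 2) - sx / W ^ 2 +
        e / W ^ 2 ≥ 2 * δ / 3 * P ^ 2 - (3 + K + 6 / δ) * H ^ 2 -
          (2 * K + 6 * K ^ 2 / δ) * W ^ 2 := by
    linarith
  have h1 := mul_le_mul_of_nonneg_left inner (sq_nonneg η)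
  have p1 : 0 ≤ 6 * K ^ 2 / δ := by positivity
  have p2 : 0 ≤ 6 / δ := by positivity
  have q1 : 0 ≤ η ^ 2 * H ^ 2 := by positivity
  have q2 : 0 ≤ η ^ 2 * W ^ 2 := by positivity
  have q3 : 0 ≤ z ^ 2 := by positivity
  have r1 := mul_nonneg hK q1
  have r2 := mul_nonneg p1 q1
  have r3 := mul_nonneg p2 q2
  have r4 := mul_nonneg hK q3
  have r5 := mul_nonneg p1 q3
  generalize 6 * K ^ 2 / δ = a at *
  generalize 6 / δ = b at *
  linarith

namespace SplitPatch.Graph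

variable {E : Type*} [NormedAddCommGroup E] [NormedSpace ℝ E] [FiniteDimensional ℝ E]
  {A : SplitPatch E} {u : A.Graph} {x : E} (hx : x ∈ u.dom)
include hx

theorem isInner_ind : IsInner (u.ind x) := ⟨ind_symm hx, fun _ ↦ ind_pos hx⟩

/-- `|X|² ≤ W²`, because `|∂_t|² = |X|² - W²` is negative. -/
theorem ind_tangTime_le : u.ind x (u.tangTime x) (u.tangTime x) ≤ u.coordTilt x ^ 2 := by
  have h := metric_time_dPt hx (u.tangTime x)
  have h2 : A.metric (u.pt x) (1, 0) (1, 0) ≤ 0 := by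
    rw [metric_apply, A.sigma_ker _ (mem_base hx)]
    nlinarith [sq_nonneg (A.lapse (u.pt x))]
  have h3 := congrArg (A.metric (u.pt x) (1, 0)) (time_eq hx)
  rw [map_add, map_smul, metric_time_normal hx, h, smul_eq_mul] at h3
  nlinarith

/-- A bound for the constants in `young_absorb`, in terms of the bound for the geometry. -/
def errorConst (E : Type*) [NormedAddCommGroup E] [NormedSpace ℝ E] [FiniteDimensional ℝ E]
    (k : ℝ) : ℝ := (Module.finrank ℝ E + 1) * k ^ 10 + ‖traceL (E := E)‖ * (16 * k ^ 8)

/-- The divergence of the flux with weight `ρ η² / W`. By the hypothesis on `ρ`, which holds for the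
volume density, the coordinate divergence of `ρ Y` is `ρ` times the Riemannian divergence of `Y`. -/
theorem traceL_fderiv_weighted_flux {ρ η : E → ℝ}
    (hρ : DifferentiableAt ℝ ρ x) (hρ' : ∀ c, fderiv ℝ ρ x c = ρ x * traceL (u.levi x c))
    (hη : DifferentiableAt ℝ η x) :
    traceL (fderiv ℝ (fun y ↦ (ρ y * (η y ^ 2 * (u.coordTilt y)⁻¹)) • u.flux y) x) =
      ρ x * (η x ^ 2 / u.coordTilt x * (traceL (fderiv ℝ u.flux x) + traceL (u.levi x (u.flux x))) +
        2 * η x / u.coordTilt x * fderiv ℝ η x (u.flux x) +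
        η x ^ 2 / u.coordTilt x ^ 2 * -fderiv ℝ u.coordTilt x (u.flux x)) := by
  have hW := coordTilt_pos hx
  have hWd := (contDiffAt_coordTilt hx).differentiableAt (by simp)
  have hfl := (contDiffAt_flux hx).differentiableAt (by simp)
  have hφ := hρ.hasFDerivAt.mul ((hη.hasFDerivAt.pow 2).mul
    ((hasFDerivAt_inv hW.ne').comp x hWd.hasFDerivAt))
  have hY := (hφ.smul hfl.hasFDerivAt).fderiv
  have e : (fun y ↦ (ρ y * (η y ^ 2 * (u.coordTilt y)⁻¹)) • u.flux y) =
    fun y ↦ (ρ * (η ^ 2 * (Inv.inv ∘ u.coordTilt))) y • u.flux y := rfl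
  rw [e]
  erw [hY]
  rw [map_add, map_smul, traceL_smulRight]
  simp [hρ']
  field_simp
  ring

/-- The derivative of `1 / W` along the flux, times `W²`. Its term `-|S X|²` has the unfavourable
sign and is of the same order as `W² |II|²`. -/
theorem neg_fderiv_coordTilt_flux : -fderiv ℝ u.coordTilt x (u.flux x) =
    u.meanCurv x * u.ind x (u.shape x (u.tangTime x)) (u.tangTime x) -
    u.ind x (u.shape x (u.tangTime x)) (u.shape x (u.tangTime x)) +
    A.metric (u.pt x) (christoffelTwo A.metric (u.pt x) (u.dPt x (u.flux x)) (1, 0))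
      (u.normal x) := by
  have hg := isInner_ind hx
  rw [fderiv_coordTilt hx, ind_shape_symm hx, hg.symm, flux]
  simp only [map_sub, map_smul, sub_apply, smul_apply, smul_eq_mul]
  rw [hg.symm (u.tangTime x), hg.symm]
  ring

theorem shapeSq_nonneg : 0 ≤ u.shapeSq x :=
  (isInner_ind hx).trace_comp_self_nonneg (ind_shape_symm hx)

theorem ind_shape_tangTime_le : u.ind x (u.shape x (u.tangTime x)) (u.shape x (u.tangTime x)) ≤
    u.coordTilt x ^ 2 * u.shapeSq x :=
  ((isInner_ind hx).apply_le (ind_shape_symm hx) _).trans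
    (mul_le_mul_of_nonneg_right (ind_tangTime_le hx) (shapeSq_nonneg hx))

theorem abs_ind_le (a b : E) : |u.ind x a b| ≤ √(u.ind x a a) * √(u.ind x b b) := by
  have hg := isInner_ind hx
  refine abs_le_of_sq_le_sq ?_ (by positivity)
  rw [mul_pow, Real.sq_sqrt (hg.nonneg _), Real.sq_sqrt (hg.nonneg _)]
  exact hg.cauchy_schwarz a b

theorem sqrt_ind_shape_tangTime_le :
    √(u.ind x (u.shape x (u.tangTime x)) (u.shape x (u.tangTime x))) ≤
      u.coordTilt x * √(u.shapeSq x) := by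
  have hW := coordTilt_pos hx
  refine Real.sqrt_le_iff.2 ⟨by positivity, ?_⟩
  rw [mul_pow, Real.sq_sqrt (shapeSq_nonneg hx)]
  exact ind_shape_tangTime_le hx

theorem sqrt_ind_tangTime_le : √(u.ind x (u.tangTime x) (u.tangTime x)) ≤ u.coordTilt x :=
  Real.sqrt_le_iff.2 ⟨(coordTilt_pos hx).le, ind_tangTime_le hx⟩

/-- The factor `1 - δ` is what makes the term `|S X|²` absorbable. -/
theorem ind_shape_tangTime_le_refined {δ : ℝ} (hδ : δ = (1 + 2 * (Module.finrank ℝ E : ℝ))⁻¹) :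
    u.ind x (u.shape x (u.tangTime x)) (u.shape x (u.tangTime x)) ≤
      u.coordTilt x ^ 2 * (2 * u.meanCurv x ^ 2 + (1 - δ) * u.shapeSq x) := by
  have h := (isInner_ind hx).apply_le_refined (ind_shape_symm hx) (u.tangTime x)
  change _ ≤ _ * (2 * u.meanCurv x ^ 2 + 2 * Module.finrank ℝ E * u.shapeSq x) at h
  have hP := shapeSq_nonneg hx
  have hXX := ind_tangTime_le hx
  have hn : (0 : ℝ) ≤ Module.finrank ℝ E := by positivity
  generalize u.ind x (u.shape x (u.tangTime x)) (u.shape x (u.tangTime x)) = s at *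
  generalize u.ind x (u.tangTime x) (u.tangTime x) = t at *
  generalize (Module.finrank ℝ E : ℝ) = n at *
  generalize u.shapeSq x = P at *
  generalize u.meanCurv x = H at *
  generalize u.coordTilt x = W at *
  have e1 : 0 ≤ 2 * H ^ 2 + 2 * n * P := by positivity
  have e2 := h.trans (mul_le_mul_of_nonneg_right hXX e1)
  rw [← le_div_iff₀' (by positivity)] at e2
  refine e2.trans ?_
  rw [div_le_iff₀' (by positivity), hδ]
  have e3 : (1 + 2 * n) * (W ^ 2 * (2 * H ^ 2 + (1 - (1 + 2 * n)⁻¹) * P)) =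
      W ^ 2 * ((1 + 2 * n) * (2 * H ^ 2) + 2 * n * P) := by
    field_simp
    ring
  rw [e3]
  refine mul_le_mul_of_nonneg_left ?_ (by positivity)
  nlinarith [mul_nonneg hn (sq_nonneg H)]

theorem sqrt_ind_flux_le : √(u.ind x (u.flux x) (u.flux x)) ≤
    u.coordTilt x * (|u.meanCurv x| + √(u.shapeSq x)) := by
  have hg := isInner_ind hx
  have hW := coordTilt_pos hx
  have hP0 := Real.sqrt_nonneg (u.shapeSq x)
  have hPP := Real.sq_sqrt (shapeSq_nonneg hx)
  refine Real.sqrt_le_iff.2 ⟨by positivity, ?_⟩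
  have e2 : |u.ind x (u.tangTime x) (u.shape x (u.tangTime x))| ≤
      u.coordTilt x * (u.coordTilt x * √(u.shapeSq x)) :=
    (abs_ind_le hx _ _).trans (mul_le_mul (sqrt_ind_tangTime_le hx) (sqrt_ind_shape_tangTime_le hx)
      (Real.sqrt_nonneg _) hW.le)
  have e3 : u.ind x (u.flux x) (u.flux x) =
      u.meanCurv x ^ 2 * u.ind x (u.tangTime x) (u.tangTime x) -
      2 * (u.meanCurv x * u.ind x (u.tangTime x) (u.shape x (u.tangTime x))) +
      u.ind x (u.shape x (u.tangTime x)) (u.shape x (u.tangTime x)) := by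
    rw [flux]
    simp only [map_sub, map_smul, sub_apply, smul_apply, smul_eq_mul]
    rw [hg.symm (u.shape x (u.tangTime x)) (u.tangTime x)]
    ring
  have e5 := ind_shape_tangTime_le hx
  rw [← hPP] at e5
  have e6 := mul_le_mul_of_nonneg_left e2 (abs_nonneg (u.meanCurv x))
  rw [← abs_mul] at e6
  have e6' := neg_abs_le (u.meanCurv x * u.ind x (u.tangTime x) (u.shape x (u.tangTime x)))
  have e7 := mul_le_mul_of_nonneg_left (ind_tangTime_le hx) (sq_nonneg (u.meanCurv x))
  have e8 : (u.coordTilt x * (|u.meanCurv x| + √(u.shapeSq x))) ^ 2 =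
      u.meanCurv x ^ 2 * u.coordTilt x ^ 2 +
      2 * (|u.meanCurv x| * (u.coordTilt x * (u.coordTilt x * √(u.shapeSq x)))) +
      u.coordTilt x ^ 2 * √(u.shapeSq x) ^ 2 := by
    rw [← sq_abs (u.meanCurv x)]; ring
  rw [e3, e8]
  linarith

variable {k : ℝ} (hk : A.BoundAt k (u.pt x))
include hk

theorem abs_traceL_covTime_le :
    |traceL (u.covTime x)| ≤ errorConst E k * u.coordTilt x ^ 2 := by
  have hk1 := hk.one_le
  refine ((isInner_ind hx).abs_trace_le (K := k ^ 10 * u.coordTilt x ^ 2) fun a ↦ ?_).trans ?_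
  · have := abs_ind_covTime_le hx hk a a
    rwa [Real.mul_self_sqrt (ind_nonneg hx a)] at this
  · rw [← mul_assoc]
    refine mul_le_mul_of_nonneg_right ?_ (by positivity)
    rw [errorConst]
    have : 0 ≤ k ^ 10 := by positivity
    have : 0 ≤ ‖traceL (E := E)‖ * (16 * k ^ 8) := by positivity
    linarith

theorem abs_traceL_shape_covTime_le : |traceL (u.shape x ∘L u.covTime x)| ≤
    errorConst E k * u.coordTilt x ^ 2 * √(u.shapeSq x) := by
  have hk1 := hk.one_le
  have hn : (0 : ℝ) ≤ Module.finrank ℝ E := by positivity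
  have hKa : (Module.finrank ℝ E + 1) * k ^ 10 ≤ errorConst E k := by
    rw [errorConst]
    have : 0 ≤ ‖traceL (E := E)‖ * (16 * k ^ 8) := by positivity
    linarith
  have hK : 0 ≤ errorConst E k := le_trans (by positivity) hKa
  refine abs_le_of_sq_le_sq ?_ (by positivity)
  refine ((isInner_ind hx).trace_comp_sq_le (ind_shape_symm hx) (K := k ^ 10 * u.coordTilt x ^ 2)
    fun a b ↦ ?_).trans ?_
  · have := pow_le_pow_left₀ (abs_nonneg _) (abs_ind_covTime_le hx hk a b) 2
    rwa [sq_abs, mul_pow _ (√_ * √_), mul_pow √_, Real.sq_sqrt (ind_nonneg hx a),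
      Real.sq_sqrt (ind_nonneg hx b)] at this
  · have e1 : Module.finrank ℝ E * (k ^ 10) ^ 2 ≤ errorConst E k ^ 2 := by
      refine le_trans ?_ (pow_le_pow_left₀ (by positivity) hKa 2)
      rw [mul_pow]
      refine mul_le_mul_of_nonneg_right ?_ (by positivity)
      nlinarith
    change Module.finrank ℝ E * ((k ^ 10 * u.coordTilt x ^ 2) ^ 2 * u.shapeSq x) ≤ _
    rw [mul_pow _ √_, Real.sq_sqrt (shapeSq_nonneg hx)]
    have := shapeSq_nonneg hx
    calc _ = Module.finrank ℝ E * (k ^ 10) ^ 2 * (u.coordTilt x ^ 4 * u.shapeSq x) := by ring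
      _ ≤ errorConst E k ^ 2 * (u.coordTilt x ^ 4 * u.shapeSq x) :=
        mul_le_mul_of_nonneg_right e1 (by positivity)
      _ = _ := by ring

theorem abs_traceL_curvOp_le :
    |traceL (u.curvOp x (u.tangTime x))| ≤ errorConst E k * u.coordTilt x ^ 3 := by
  have hk1 := hk.one_le
  have hW := coordTilt_pos hx
  have e1 := norm_curvOp_le hx hk (u.tangTime x)
  have e2 := norm_tangTime_le hx hk
  calc |traceL (u.curvOp x (u.tangTime x))| ≤ ‖traceL (E := E)‖ * ‖u.curvOp x (u.tangTime x)‖ :=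
        (traceL (E := E)).le_opNorm _
    _ ≤ ‖traceL (E := E)‖ * (8 * k ^ 6 * (2 * k ^ 2 * u.coordTilt x ^ 2) * u.coordTilt x) := by
        refine mul_le_mul_of_nonneg_left (e1.trans ?_) (norm_nonneg _)
        gcongr
    _ = ‖traceL (E := E)‖ * (16 * k ^ 8) * u.coordTilt x ^ 3 := by ring
    _ ≤ _ := by
        refine mul_le_mul_of_nonneg_right ?_ (by positivity)
        rw [errorConst]
        have : 0 ≤ (Module.finrank ℝ E + 1) * k ^ 10 := by positivity
        linarith

theorem abs_metric_conn_flux_le :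
    |A.metric (u.pt x) (christoffelTwo A.metric (u.pt x) (u.dPt x (u.flux x)) (1, 0))
      (u.normal x)| ≤
    errorConst E k * u.coordTilt x ^ 3 * (|u.meanCurv x| + √(u.shapeSq x)) := by
  have hk1 := hk.one_le
  have hW := coordTilt_pos hx
  have hK : 0 ≤ errorConst E k := by rw [errorConst]; positivity
  have hn : (0 : ℝ) ≤ Module.finrank ℝ E := by positivity
  refine (abs_metric_conn_le hx hk _ _ _).trans ?_
  have e1 : ‖((1 : ℝ), (0 : E))‖ = 1 := by simp [Prod.norm_def]
  rw [e1]
  have e2 := (norm_le_sqrt hx hk (u.flux x)).trans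
    (mul_le_mul_of_nonneg_left (sqrt_ind_flux_le hx) (by positivity))
  rcases Nat.eq_zero_or_pos (Module.finrank ℝ E) with h0 | h1
  · have : Subsingleton E := Module.finrank_zero_iff.1 h0
    rw [Subsingleton.elim (u.flux x) 0]
    simp only [norm_zero, mul_zero, zero_mul]
    positivity
  · have h1' : (1 : ℝ) ≤ Module.finrank ℝ E := by exact_mod_cast h1
    have e4 : 2 * k ^ 8 ≤ errorConst E k := by
      have e5 : k ^ 8 ≤ k ^ 10 := pow_le_pow_right₀ hk1 (by norm_num)
      have e6 : 0 ≤ k ^ 10 := by positivity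
      have e7 : 0 ≤ ‖traceL (E := E)‖ * (16 * k ^ 8) := by positivity
      rw [errorConst]
      nlinarith
    calc k ^ 3 * ‖u.flux x‖ * 1 * ‖u.normal x‖ ≤
          k ^ 3 * (k ^ 3 * u.coordTilt x * (u.coordTilt x *
            (|u.meanCurv x| + √(u.shapeSq x)))) * 1 *
            (2 * k ^ 2 * u.coordTilt x) := by
          gcongr
          exact norm_normal_le hx hk
      _ = 2 * k ^ 8 * (u.coordTilt x ^ 3 * (|u.meanCurv x| + √(u.shapeSq x))) := by ring
      _ ≤ errorConst E k * (u.coordTilt x ^ 3 * (|u.meanCurv x| + √(u.shapeSq x))) :=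
        mul_le_mul_of_nonneg_right e4 (by positivity)
      _ = _ := by ring

/-- The pointwise form of the estimate: up to controlled terms, the squared norm of the second
fundamental form is the divergence of `ρ (η² / W) (H X - S X)`, where `ρ` is the volume density. -/
theorem shapeSq_le_divergence {ρ η : E → ℝ} (hρ0 : 0 ≤ ρ x)
    (hρ : DifferentiableAt ℝ ρ x) (hρ' : ∀ c, fderiv ℝ ρ x c = ρ x * traceL (u.levi x c))
    (hη : DifferentiableAt ℝ η x) {q : ℝ} (hq0 : 0 ≤ q)
    (hq : ∀ a, fderiv ℝ η x a ^ 2 ≤ q * u.ind x a a) {δ K : ℝ}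
    (hδ : δ = (1 + 2 * (Module.finrank ℝ E : ℝ))⁻¹) (hK : K = errorConst E k) :
    δ / 2 * (η x ^ 2 * u.shapeSq x * ρ x) ≤
      traceL (fderiv ℝ (fun y ↦ (ρ y * (η y ^ 2 * (u.coordTilt y)⁻¹)) • u.flux y) x) +
      (4 + 2 * K + 6 * K ^ 2 / δ + 6 / δ) *
        ((q + η x ^ 2 * u.meanCurv x ^ 2 + η x ^ 2 * u.coordTilt x ^ 2) * ρ x) := by
  have hg := isInner_ind hx
  have hW := coordTilt_pos hx
  have hk1 := hk.one_le
  have hδ0 : 0 < δ := by rw [hδ]; positivity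
  have hPP := Real.sq_sqrt (shapeSq_nonneg hx)
  have hP0 := Real.sqrt_nonneg (u.shapeSq x)
  have hK0 : 0 ≤ K := by rw [hK, errorConst]; positivity
  have bsx := ind_shape_tangTime_le_refined hx hδ
  rw [← hPP] at bsx
  have bhx : |u.ind x (u.shape x (u.tangTime x)) (u.tangTime x)| ≤
      u.coordTilt x ^ 2 * √(u.shapeSq x) := by
    refine (abs_ind_le hx _ _).trans ?_
    calc _ ≤ u.coordTilt x * √(u.shapeSq x) * u.coordTilt x :=
          mul_le_mul (sqrt_ind_shape_tangTime_le hx) (sqrt_ind_tangTime_le hx) (Real.sqrt_nonneg _)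
            (by positivity)
      _ = _ := by ring
  have bd : |fderiv ℝ η x (u.flux x)| ≤
      √q * u.coordTilt x * (|u.meanCurv x| + √(u.shapeSq x)) := by
    refine (abs_le_of_sq_le_sq (b := √q * √(u.ind x (u.flux x) (u.flux x))) ?_
      (by positivity)).trans ?_
    · rw [mul_pow, Real.sq_sqrt hq0, Real.sq_sqrt (hg.nonneg _)]
      exact hq _
    · rw [mul_assoc]
      exact mul_le_mul_of_nonneg_left (sqrt_ind_flux_le hx) (Real.sqrt_nonneg _)
  have main := young_absorb (η := η x) hδ0 hK0 hW hP0
    (hK ▸ abs_traceL_covTime_le hx hk) (hK ▸ abs_traceL_shape_covTime_le hx hk)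
    (hK ▸ abs_traceL_curvOp_le hx hk) bsx bhx (hK ▸ abs_metric_conn_flux_le hx hk) bd
  rw [Real.sq_sqrt hq0, hPP, ← divergence_flux hx, ← neg_fderiv_coordTilt_flux hx] at main
  have main2 := mul_le_mul_of_nonneg_right main hρ0
  rw [traceL_fderiv_weighted_flux hx hρ hρ' hη]
  linarith

end SplitPatch.Graph

/-! ### The volume density and the divergence theorem -/

/-- Jacobi's formula for the derivative of a determinant. -/
theorem hasFDerivAt_det {E : Type*} [NormedAddCommGroup E] [NormedSpace ℝ E] {n : ℕ}
    {M : E → Matrix (Fin n) (Fin n) ℝ} {M' : Fin n → Fin n → E →L[ℝ] ℝ} {x : E}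
    (hM : ∀ i j, HasFDerivAt (fun y ↦ M y i j) (M' i j) x) :
    DifferentiableAt ℝ (fun y ↦ (M y).det) x ∧ ∀ c, fderiv ℝ (fun y ↦ (M y).det) x c =
      ((M x).adjugate * Matrix.of fun i j ↦ M' i j c).trace := by
  let D : ContinuousMultilinearMap ℝ (fun _ : Fin n ↦ Fin n → ℝ) ℝ :=
    { toMultilinearMap := (Matrix.detRowAlternating (n := Fin n) (R := ℝ)).toMultilinearMap
      cont := Continuous.matrix_det (A := fun M : Matrix (Fin n) (Fin n) ℝ ↦ M) continuous_id }
  have h1 : HasFDerivAt (fun y ↦ (fun i j ↦ M y i j : Fin n → Fin n → ℝ))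
      (ContinuousLinearMap.pi fun i ↦ ContinuousLinearMap.pi fun j ↦ M' i j) x :=
    hasFDerivAt_pi.2 fun i ↦ hasFDerivAt_pi.2 fun j ↦ hM i j
  have h2 := (D.hasFDerivAt (fun i j ↦ M x i j)).comp x h1
  have h3 : (D ∘ fun y ↦ (fun i j ↦ M y i j : Fin n → Fin n → ℝ)) = fun y ↦ (M y).det := rfl
  rw [h3] at h2
  refine ⟨h2.differentiableAt, fun c ↦ ?_⟩
  rw [h2.fderiv, ContinuousLinearMap.comp_apply, ContinuousMultilinearMap.linearDeriv_apply,
    Matrix.trace_mul_comm]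
  simp only [Matrix.trace, Matrix.diag_apply]
  refine Finset.sum_congr rfl fun i _ ↦ ?_
  have h4 := Matrix.cramer_transpose_apply (M x) (fun j ↦ M' i j c) i
  rw [Matrix.cramer_eq_adjugate_mulVec, ← Matrix.adjugate_transpose] at h4
  refine h4.symm.trans ?_
  simp [Matrix.mulVec, dotProduct, Matrix.mul_apply, mul_comm]

section Euclidean

variable {m : ℕ}

theorem traceL_eq_sum (f : EuclideanSpace ℝ (Fin m) →L[ℝ] EuclideanSpace ℝ (Fin m)) :
    traceL f = ∑ i, f (EuclideanSpace.single i 1) i := by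
  rw [traceL_apply, LinearMap.trace_eq_matrix_trace ℝ (EuclideanSpace.basisFun (Fin m) ℝ).toBasis,
    Matrix.trace]
  refine Finset.sum_congr rfl fun i _ ↦ ?_
  rw [Matrix.diag_apply, LinearMap.toMatrix_apply]
  simp

theorem sum_apply_smul_single (v : EuclideanSpace ℝ (Fin m)) :
    ∑ i, v i • EuclideanSpace.single i (1 : ℝ) = v := by
  have := (EuclideanSpace.basisFun (Fin m) ℝ).sum_repr v
  simpa using this

/-- The divergence theorem for compactly supported vector fields. -/
theorem integral_traceL_fderiv_eq_zero
    {Y : EuclideanSpace ℝ (Fin m) → EuclideanSpace ℝ (Fin m)} (hY : ContDiff ℝ 1 Y)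
    (hc : HasCompactSupport Y) :
    Integrable (fun x ↦ traceL (fderiv ℝ Y x)) ∧ ∫ x, traceL (fderiv ℝ Y x) = 0 := by
  have h1 : ∀ i, Integrable (fun x ↦ fderiv ℝ Y x (EuclideanSpace.single i 1) i) := fun i ↦ by
    refine Continuous.integrable_of_hasCompactSupport ?_ ?_
    · have := hY.continuous_fderiv (by simp)
      fun_prop
    · exact (hc.fderiv ℝ).comp_left (g := fun f : EuclideanSpace ℝ (Fin m) →L[ℝ]
        EuclideanSpace ℝ (Fin m) ↦ f (EuclideanSpace.single i 1) i) (by simp)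
  simp only [traceL_eq_sum]
  refine ⟨integrable_finsetSum _ fun i _ ↦ h1 i, ?_⟩
  rw [integral_finsetSum _ fun i _ ↦ h1 i]
  refine Finset.sum_eq_zero fun i _ ↦ ?_
  have h2 : ∀ x, fderiv ℝ Y x (EuclideanSpace.single i 1) i =
      fderiv ℝ (fun y ↦ Y y i) x (EuclideanSpace.single i 1) := fun x ↦ by
    have := ((EuclideanSpace.proj (𝕜 := ℝ) i).hasFDerivAt.comp x
      ((hY.differentiable (by simp)) x).hasFDerivAt).fderiv
    have e : (EuclideanSpace.proj i ∘ Y : EuclideanSpace ℝ (Fin m) → ℝ) = fun y ↦ Y y i := rfl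
    rw [e] at this
    rw [this]; simp
  have h3 := h1 i
  simp only [h2] at h3 ⊢
  have hci : HasCompactSupport fun y ↦ Y y i :=
    hc.comp_left (g := fun v : EuclideanSpace ℝ (Fin m) ↦ v i) (by simp)
  have hcont : Continuous fun y ↦ Y y i := by
    have := hY.continuous
    fun_prop
  have hd : Differentiable ℝ fun y ↦ Y y i := fun x ↦
    (EuclideanSpace.proj (𝕜 := ℝ) i).differentiableAt.comp x ((hY.differentiable (by simp)) x)
  have := integral_mul_fderiv_eq_neg_fderiv_mul_of_integrable (μ := volume)
    (f := fun _ : EuclideanSpace ℝ (Fin m) ↦ (1 : ℝ)) (g := fun y ↦ Y y i)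
    (v := EuclideanSpace.single i 1) (by simp) (by simpa using h3)
    (by simpa using hcont.integrable_of_hasCompactSupport hci)
    (fun _ _ ↦ differentiableAt_const _) (fun x _ ↦ hd x)
  simpa using this

end Euclidean

namespace SplitPatch.Graph

variable {m : ℕ} {A : SplitPatch (EuclideanSpace ℝ (Fin m))} (u : A.Graph)

/-- The matrix of the induced metric. -/
def indMatrix (x : EuclideanSpace ℝ (Fin m)) : Matrix (Fin m) (Fin m) ℝ :=
  Matrix.of fun i j ↦ u.ind x (EuclideanSpace.single i 1) (EuclideanSpace.single j 1)

/-- The Riemannian volume density of the induced metric. -/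
def dens (x : EuclideanSpace ℝ (Fin m)) : ℝ := √(u.indMatrix x).det

theorem ind_eq_dotProduct (x a b : EuclideanSpace ℝ (Fin m)) :
    u.ind x a b = a.ofLp ⬝ᵥ (u.indMatrix x).mulVec b.ofLp := by
  conv_lhs => rw [← sum_apply_smul_single a, ← sum_apply_smul_single b]
  simp [dotProduct, Matrix.mulVec, indMatrix, sum_apply, Finset.mul_sum]
  rw [Finset.sum_comm]
  exact Finset.sum_congr rfl fun i _ ↦ Finset.sum_congr rfl fun j _ ↦ by ring

variable {u} {x : EuclideanSpace ℝ (Fin m)} (hx : x ∈ u.dom)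
include hx

theorem posDef_indMatrix : (u.indMatrix x).PosDef := by
  refine Matrix.PosDef.of_dotProduct_mulVec_pos ?_ fun v hv ↦ ?_
  · ext i j
    simp [indMatrix, ind_symm hx (EuclideanSpace.single j 1)]
  · have h : WithLp.toLp 2 v ≠ 0 := by simpa using hv
    simpa [ind_eq_dotProduct] using ind_pos hx h

theorem det_indMatrix_pos : 0 < (u.indMatrix x).det := (posDef_indMatrix hx).det_pos

theorem dens_pos : 0 < u.dens x := Real.sqrt_pos.2 (det_indMatrix_pos hx)

theorem contDiffAt_dens : ContDiffAt ℝ ∞ u.dens x := by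
  refine ContDiffAt.sqrt ?_ (det_indMatrix_pos hx).ne'
  have h : ∀ i j, ContDiffAt ℝ ∞ (fun y ↦ u.indMatrix y i j) x := fun i j ↦
    ((contDiffAt_ind hx).clm_apply contDiffAt_const).clm_apply contDiffAt_const
  simp only [Matrix.det_apply]
  refine ContDiffAt.sum fun s _ ↦ ContDiffAt.const_smul _ (contDiffAt_prod fun i _ ↦ h _ _)

/-- The logarithmic derivative of the volume density is the trace of the connection. -/
theorem fderiv_dens (c : EuclideanSpace ℝ (Fin m)) :
    fderiv ℝ u.dens x c = u.dens x * traceL (u.levi x c) := by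
  have hp := det_indMatrix_pos hx
  have hI := (contDiffAt_ind hx).differentiableAt (by simp)
  have hM : ∀ i j, HasFDerivAt (fun y ↦ u.indMatrix y i j) (fderiv ℝ (fun y ↦ u.ind y
      (EuclideanSpace.single i 1) (EuclideanSpace.single j 1)) x) x := fun i j ↦
    ((hI.clm_apply (differentiableAt_const _)).clm_apply (differentiableAt_const _)).hasFDerivAt
  obtain ⟨h1, h2⟩ := hasFDerivAt_det hM
  have h3 := (h1.hasFDerivAt.sqrt hp.ne').fderiv
  let Lm : Matrix (Fin m) (Fin m) ℝ := Matrix.of fun k j ↦ u.levi x c (EuclideanSpace.single j 1) k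
  have h4 : (Matrix.of fun i j ↦ fderiv ℝ (fun y ↦ u.ind y
      (EuclideanSpace.single i 1) (EuclideanSpace.single j 1)) x c) =
      Lm.transpose * u.indMatrix x + u.indMatrix x * Lm := by
    ext i j
    rw [Matrix.of_apply, fderiv_ind hx, Matrix.add_apply]
    have e1 : ∀ v w : EuclideanSpace ℝ (Fin m),
        u.ind x v w = ∑ k, v k * u.ind x (EuclideanSpace.single k 1) w := fun v w ↦ by
      conv_lhs => rw [← sum_apply_smul_single v]
      simp [sum_apply]
    congr 1
    · rw [e1]; rfl
    · rw [ind_symm hx, e1, Matrix.mul_apply]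
      refine Finset.sum_congr rfl fun k _ ↦ ?_
      rw [ind_symm hx, mul_comm]; rfl
  have h5 : traceL (u.levi x c) = Lm.trace := by
    rw [traceL_eq_sum]; rfl
  have h6 : fderiv ℝ u.dens x c = 1 / (2 * √(u.indMatrix x).det) *
      fderiv ℝ (fun y ↦ (u.indMatrix y).det) x c := by
    change fderiv ℝ (fun y ↦ √(u.indMatrix y).det) x c = _
    rw [h3]; rfl
  rw [h6, h2, h4, h5, mul_add, Matrix.trace_add, ← mul_assoc, ← mul_assoc, Matrix.adjugate_mul,
    Matrix.trace_mul_comm, ← mul_assoc, Matrix.mul_adjugate]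
  simp only [Matrix.smul_mul, one_mul, Matrix.trace_smul, Matrix.trace_transpose, smul_eq_mul, dens]
  have h7 := Real.mul_self_sqrt hp.le
  have h8 := Real.sqrt_pos.2 hp
  field_simp
  rw [pow_two, h7]
  ring

end SplitPatch.Graph

/-! ### The integral estimate in coordinates -/

/-- A function that is continuous on a compact set and vanishes on the rest of `s` is integrable
on `s`. -/
theorem integrableOn_of_vanish_off {X : Type*} [TopologicalSpace X] [MeasurableSpace X]
    [OpensMeasurableSpace X] [T2Space X] {μ : Measure X} [IsFiniteMeasureOnCompacts μ]
    {f : X → ℝ} {s Q : Set X} (hs : MeasurableSet s) (hQ : IsCompact Q) (hf : ContinuousOn f Q)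
    (h : ∀ x ∈ s, f x ≠ 0 → x ∈ Q) : IntegrableOn f s μ := by
  have h1 : IntegrableOn f (s ∩ Q) μ := (hf.integrableOn_compact hQ).mono_set inter_subset_right
  refine h1.of_forall_sdiff_eq_zero hs fun x hx ↦ ?_
  by_contra h0
  exact hx.2 ⟨hx.1, h x hx.1 h0⟩

namespace SplitPatch

open Lorentz.SplitPatch.Graph

variable {m : ℕ} (A : SplitPatch (EuclideanSpace ℝ (Fin m)))

/-- The estimate for a graph in a split patch, localized by a fixed cutoff function `χ`. The
constant depends on the patch, on `χ` and on the range of heights only. -/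
theorem exists_local_estimate {K : Set (EuclideanSpace ℝ (Fin m))} (hK : IsCompact K)
    (hKb : K ⊆ A.base) {χ : EuclideanSpace ℝ (Fin m) → ℝ} (hχ : ContDiffOn ℝ 1 χ A.base)
    (hχK : ∀ x ∈ A.base, x ∉ K → χ =ᶠ[𝓝 x] 0) (a b : ℝ) :
    ∃ C, 0 ≤ C ∧ ∀ u : A.Graph, (∀ x ∈ u.dom ∩ K, u.height x ∈ Icc a b) →
      ∀ ζ : EuclideanSpace ℝ (Fin m) → ℝ, (∀ x ∈ u.dom, ContDiffAt ℝ 1 ζ x) →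
      ∀ Q : Set (EuclideanSpace ℝ (Fin m)), IsCompact Q → Q ⊆ u.dom →
      (∀ x ∈ u.dom ∩ K, ζ x ≠ 0 → x ∈ Q) →
      ∀ q : EuclideanSpace ℝ (Fin m) → ℝ, (∀ x ∈ u.dom, 0 ≤ q x) →
      (∀ x ∈ u.dom, ∀ a, fderiv ℝ ζ x a ^ 2 ≤ q x * u.ind x a a) →
      IntegrableOn (fun x ↦ q x * u.dens x) (u.dom ∩ K) →
      ∫ x in u.dom, (χ x * ζ x) ^ 2 * u.shapeSq x * u.dens x ≤
        C * ∫ x in u.dom ∩ K, (q x + ζ x ^ 2 * u.meanCurv x ^ 2 + ζ x ^ 2 * u.coordTilt x ^ 2) *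
          u.dens x := by
  have hb := A.isOpen_base
  obtain ⟨k, hk⟩ := exists_boundAt (A := A) (isCompact_Icc (a := a) (b := b) |>.prod hK)
    fun p hp ↦ hKb hp.2
  obtain ⟨M₁, hM₁⟩ := hK.exists_bound_of_continuousOn (hχ.continuousOn.mono hKb)
  obtain ⟨M₂, hM₂⟩ := hK.exists_bound_of_continuousOn
    ((hχ.continuousOn_fderiv_of_isOpen hb le_rfl).mono hKb)
  let δ : ℝ := (1 + 2 * (Module.finrank ℝ (EuclideanSpace ℝ (Fin m)) : ℝ))⁻¹
  have hδ : 0 < δ := by positivity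
  let K' : ℝ := errorConst (EuclideanSpace ℝ (Fin m)) k
  let C₀ : ℝ := 4 + 2 * |K'| + 6 * K' ^ 2 / δ + 6 / δ
  have hC₀ : 0 ≤ C₀ := by positivity
  let B : ℝ := 2 * M₁ ^ 2 + 2 * M₂ ^ 2 * |k| ^ 5
  have hB : 0 ≤ B := by positivity
  let C : ℝ := 2 / δ * (C₀ * (2 * B))
  refine ⟨C, by positivity, fun u hu ζ hζ Q hQ hQd hQζ q hq0 hq hqi ↦ ?_⟩
  have hdo := u.isOpen_dom
  -- the test function, extended by zero
  let η : EuclideanSpace ℝ (Fin m) → ℝ := u.dom.indicator fun x ↦ χ x * ζ x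
  have hηx : ∀ x ∈ u.dom, η x = χ x * ζ x := fun x hx ↦ indicator_of_mem hx _
  have hηd : ∀ x ∈ u.dom, η =ᶠ[𝓝 x] fun y ↦ χ y * ζ y := fun x hx ↦
    (eventually_mem_dom hx).mono hηx
  have hη1 : ∀ x ∈ u.dom, ContDiffAt ℝ 1 η x := fun x hx ↦
    ((hχ.contDiffAt (hb.mem_nhds (u.dom_subset hx))).mul (hζ x hx)).congr_of_eventuallyEq (hηd x hx)
  have hηQ : ∀ x, x ∉ Q → η x = 0 := fun x hx ↦ by
    by_cases hxd : x ∈ u.dom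
    · rw [hηx x hxd]
      by_cases hxK : x ∈ K
      · have : ζ x = 0 := by
          by_contra h0
          exact hx (hQζ x ⟨hxd, hxK⟩ h0)
        rw [this, mul_zero]
      · rw [(hχK x (u.dom_subset hxd) hxK).self_of_nhds]; simp
    · exact indicator_of_notMem hxd _
  have hη0 : ∀ x, x ∉ u.dom ∩ K → η =ᶠ[𝓝 x] 0 := fun x hx ↦ by
    by_cases hxd : x ∈ u.dom
    · have hxK : x ∉ K := fun h ↦ hx ⟨hxd, h⟩
      filter_upwards [hηd x hxd, hχK x (u.dom_subset hxd) hxK] with y h1 h2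
      rw [h1, h2]; simp
    · filter_upwards [hQ.isClosed.isOpen_compl.mem_nhds fun h ↦ hxd (hQd h)] with y hy
      exact hηQ y hy
  -- the vector field
  let Y : EuclideanSpace ℝ (Fin m) → EuclideanSpace ℝ (Fin m) :=
    fun y ↦ (u.dens y * (η y ^ 2 * (u.coordTilt y)⁻¹)) • u.flux y
  have hY0 : ∀ x, x ∉ u.dom ∩ K → Y =ᶠ[𝓝 x] 0 := fun x hx ↦
    (hη0 x hx).mono fun y hy ↦ by simp [Y, hy]
  have hY : ContDiff ℝ 1 Y := contDiff_iff_contDiffAt.2 fun x ↦ by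
    by_cases hx : x ∈ u.dom
    · exact ((((contDiffAt_dens hx).of_le (by simp)).mul (((hη1 x hx).pow 2).mul
        (((contDiffAt_coordTilt hx).inv (coordTilt_pos hx).ne').of_le (by simp)))).smul
        ((contDiffAt_flux hx).of_le (by simp)))
    · exact contDiffAt_const.congr_of_eventuallyEq (hY0 x fun h ↦ hx h.1)
  have hYc : HasCompactSupport Y := HasCompactSupport.intro hQ fun x hx ↦ by
    simp [Y, hηQ x hx]
  obtain ⟨hYi, hYz⟩ := integral_traceL_fderiv_eq_zero hY hYc
  -- integrability of the right hand side
  have hKm : MeasurableSet (u.dom ∩ K) := hdo.measurableSet.inter hK.measurableSet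
  have hcont : ∀ f : EuclideanSpace ℝ (Fin m) → ℝ, (∀ x ∈ u.dom, ContDiffAt ℝ ∞ f x) →
      IntegrableOn (fun x ↦ ζ x ^ 2 * f x ^ 2 * u.dens x) (u.dom ∩ K) := fun f hf ↦ by
    refine integrableOn_of_vanish_off hKm hQ (fun x hx ↦ ?_) fun x hx h0 ↦ hQζ x hx ?_
    · have hxd := hQd hx
      exact ((((hζ x hxd).continuousAt.pow 2).mul ((hf x hxd).continuousAt.pow 2)).mul
        (contDiffAt_dens hxd).continuousAt).continuousWithinAt
    · rintro h; simp [h] at h0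
  have hH := hcont u.meanCurv fun x hx ↦ contDiffAt_meanCurv hx
  have hW := hcont u.coordTilt fun x hx ↦ contDiffAt_coordTilt hx
  have hRi : IntegrableOn (fun x ↦ (q x + ζ x ^ 2 * u.meanCurv x ^ 2 +
      ζ x ^ 2 * u.coordTilt x ^ 2) * u.dens x) (u.dom ∩ K) :=
    ((hqi.add hH).add hW).congr_fun (fun x _ ↦ by simp only [Pi.add_apply]; ring) hKm
  let R : EuclideanSpace ℝ (Fin m) → ℝ := (u.dom ∩ K).indicator fun x ↦
    (q x + ζ x ^ 2 * u.meanCurv x ^ 2 + ζ x ^ 2 * u.coordTilt x ^ 2) * u.dens x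
  have hRi' : Integrable R := (integrable_indicator_iff hKm).2 hRi
  let F : EuclideanSpace ℝ (Fin m) → ℝ := u.dom.indicator fun x ↦
    (χ x * ζ x) ^ 2 * u.shapeSq x * u.dens x
  have hF0 : ∀ x, 0 ≤ F x := fun x ↦ indicator_nonneg (fun x hx ↦
    mul_nonneg (mul_nonneg (sq_nonneg _) (shapeSq_nonneg hx)) (dens_pos hx).le) x
  -- the pointwise estimate
  have hpt : ∀ x, F x ≤ 2 / δ * (traceL (fderiv ℝ Y x) + C₀ * (2 * B) * R x) := fun x ↦ by
    by_cases hx : x ∈ u.dom ∩ K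
    · obtain ⟨hxd, hxK⟩ := hx
      have hkx : A.BoundAt k (u.pt x) := hk _ ⟨hu x ⟨hxd, hxK⟩, hxK⟩
      have hk1 := hkx.one_le
      have hK'0 : 0 ≤ K' := by simp only [K', errorConst]; positivity
      have hχd := (hχ.contDiffAt (hb.mem_nhds (u.dom_subset hxd))).differentiableAt (by simp)
      have hζd := (hζ x hxd).differentiableAt (by simp)
      have hηf : fderiv ℝ η x = χ x • fderiv ℝ ζ x + ζ x • fderiv ℝ χ x := by
        rw [(hηd x hxd).fderiv_eq, fderiv_fun_mul hχd hζd]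
      have m1 : χ x ^ 2 ≤ M₁ ^ 2 := by
        have := pow_le_pow_left₀ (norm_nonneg _) (hM₁ x hxK) 2
        rwa [Real.norm_eq_abs, sq_abs] at this
      have m2 := pow_le_pow_left₀ (norm_nonneg _) (hM₂ x hxK) 2
      have hq0x := hq0 x hxd
      have hWp := coordTilt_pos hxd
      -- the gradient of the cutoff function is controlled by the tilt
      have hgrad : ∀ v, fderiv ℝ η x v ^ 2 ≤
          (B * (q x + ζ x ^ 2 * u.coordTilt x ^ 2)) * u.ind x v v := fun v ↦ by
        have e1 := hq x hxd v
        have e2 : fderiv ℝ χ x v ^ 2 ≤ M₂ ^ 2 * (k ^ 5 * u.coordTilt x ^ 2 * u.ind x v v) := by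
          have := pow_le_pow_left₀ (norm_nonneg _) ((fderiv ℝ χ x).le_opNorm v) 2
          rw [Real.norm_eq_abs, sq_abs, mul_pow] at this
          exact this.trans (mul_le_mul m2 (sq_norm_le hxd hkx v) (by positivity) (by positivity))
        have e3 := ind_nonneg hxd v
        rw [hηf]
        simp only [add_apply, smul_apply, smul_eq_mul]
        have e4 : (χ x * fderiv ℝ ζ x v + ζ x * fderiv ℝ χ x v) ^ 2 ≤
            2 * (χ x ^ 2 * fderiv ℝ ζ x v ^ 2) + 2 * (ζ x ^ 2 * fderiv ℝ χ x v ^ 2) := by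
          nlinarith [sq_nonneg (χ x * fderiv ℝ ζ x v - ζ x * fderiv ℝ χ x v)]
        have e5 : χ x ^ 2 * fderiv ℝ ζ x v ^ 2 ≤ M₁ ^ 2 * (q x * u.ind x v v) :=
          mul_le_mul m1 e1 (sq_nonneg _) (sq_nonneg _)
        have e6 := mul_le_mul_of_nonneg_left e2 (sq_nonneg (ζ x))
        have e7 : 0 ≤ (2 * M₂ ^ 2 * |k| ^ 5) * (q x * u.ind x v v) := by positivity
        have e8 : 0 ≤ (2 * M₁ ^ 2) * (ζ x ^ 2 * u.coordTilt x ^ 2 * u.ind x v v) := by positivity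
        have e9 : |k| = k := abs_of_nonneg (by linarith)
        simp only [B]
        rw [e9] at e7 ⊢
        linarith
      have main := shapeSq_le_divergence hxd hkx (η := η) (dens_pos hxd).le
        ((contDiffAt_dens hxd).differentiableAt (by simp)) (fderiv_dens hxd)
        ((hη1 x hxd).differentiableAt (by simp)) (q := B * (q x + ζ x ^ 2 * u.coordTilt x ^ 2))
        (by positivity) hgrad (δ := δ) (K := K') rfl rfl
      have hFx : F x = η x ^ 2 * u.shapeSq x * u.dens x := by
        rw [hηx x hxd]; exact indicator_of_mem hxd _
      have hRx : R x = (q x + ζ x ^ 2 * u.meanCurv x ^ 2 + ζ x ^ 2 * u.coordTilt x ^ 2) *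
        u.dens x := indicator_of_mem (show x ∈ u.dom ∩ K from ⟨hxd, hxK⟩) _
      have m3 : η x ^ 2 ≤ B * ζ x ^ 2 := by
        rw [hηx x hxd, mul_pow]
        refine mul_le_mul_of_nonneg_right ?_ (sq_nonneg _)
        have : 0 ≤ M₁ ^ 2 + 2 * M₂ ^ 2 * |k| ^ 5 := by positivity
        simp only [B]
        linarith
      have m4 := mul_le_mul_of_nonneg_right m3 (sq_nonneg (u.meanCurv x))
      have m5 := mul_le_mul_of_nonneg_right m3 (sq_nonneg (u.coordTilt x))
      have m6 : B * (q x + ζ x ^ 2 * u.coordTilt x ^ 2) + η x ^ 2 * u.meanCurv x ^ 2 +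
          η x ^ 2 * u.coordTilt x ^ 2 ≤ 2 * B * (q x + ζ x ^ 2 * u.meanCurv x ^ 2 +
            ζ x ^ 2 * u.coordTilt x ^ 2) := by
        have : 0 ≤ B * q x := by positivity
        have : 0 ≤ B * (ζ x ^ 2 * u.meanCurv x ^ 2) := by positivity
        linarith
      have m7 := mul_le_mul_of_nonneg_left
        (mul_le_mul_of_nonneg_right m6 (dens_pos hxd).le) hC₀
      have hC₀' : C₀ = 4 + 2 * K' + 6 * K' ^ 2 / δ + 6 / δ := by
        simp only [C₀, abs_of_nonneg hK'0]
      rw [← hC₀', ← hFx] at main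
      have main2 := main.trans (add_le_add_right m7 _)
      rw [hRx]
      have e : F x = 2 / δ * (δ / 2 * F x) := by field_simp
      rw [e]
      refine mul_le_mul_of_nonneg_left (main2.trans (le_of_eq ?_)) (by positivity)
      ring
    · have e1 : F x = 0 := by
        by_cases hxd : x ∈ u.dom
        · have : F x = η x ^ 2 * u.shapeSq x * u.dens x := by
            rw [hηx x hxd]; exact indicator_of_mem hxd _
          rw [this, (hη0 x hx).self_of_nhds]; simp
        · exact indicator_of_notMem hxd _
      have e2 : fderiv ℝ Y x = 0 := by
        rw [(hY0 x hx).fderiv_eq]; simp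
      have e3 : R x = 0 := indicator_of_notMem hx _
      rw [e1, e2, e3]; simp
  have hint : Integrable fun x ↦ 2 / δ * (traceL (fderiv ℝ Y x) + C₀ * (2 * B) * R x) :=
    (hYi.add (hRi'.const_mul _)).const_mul _
  have h1 := integral_mono_of_nonneg (Eventually.of_forall hF0) hint (Eventually.of_forall hpt)
  rw [integral_const_mul, integral_add hYi (hRi'.const_mul _), hYz, integral_const_mul,
    integral_indicator hdo.measurableSet, integral_indicator hKm] at h1
  refine h1.trans (le_of_eq ?_)
  simp only [C]
  ring

end SplitPatch

/-! ### Coordinate changes of tangent vectors -/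

section CoordChange

variable {E : Type*} [NormedAddCommGroup E] [NormedSpace ℝ E]
  {H : Type*} [TopologicalSpace H] {I : ModelWithCorners ℝ E H}
  {X : Type*} [TopologicalSpace X] [ChartedSpace H X] [IsManifold I ∞ X]

theorem vecOfChart_self (x : X) (v : E) : vecOfChart I x x v = v :=
  tangentCoordChange_self (I := I) (x := x) (z := x) (v := v) (mem_extChartAt_source x)

theorem contMDiffOn_vecOfChart (c : X) (v : E) : ContMDiffOn I (I.prod 𝓘(ℝ, E)) ∞
    (fun x ↦ (⟨x, vecOfChart I c x v⟩ : TangentBundle I X)) (chartAt H c).source := by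
  have hb : (chartAt H c).source ⊆ (trivializationAt E (TangentSpace I) c).baseSet := by
    intro x hx; simpa using hx
  rw [Bundle.Trivialization.contMDiffOn_section_iff (trivializationAt E (TangentSpace I) c)
    (chartAt H c).open_source hb]
  refine contMDiffOn_const (c := v) |>.congr fun x hx ↦ ?_
  rw [← extChartAt_source I] at hx
  change tangentCoordChange I x c x (tangentCoordChange I c x x v) = v
  rw [tangentCoordChange_comp ⟨⟨hx, mem_extChartAt_source x⟩, hx⟩, tangentCoordChange_self hx]

end CoordChange

section SplitCoordChange

variable {m : ℕ} {S : Type*} [TopologicalSpace S]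
  [ChartedSpace (EuclideanSpace ℝ (Fin m)) S] [IsManifold (𝓡 m) ∞ S]

theorem mem_extChartAt_split_source {t : ℝ} {c : S} {p : ℝ × S} :
    p ∈ (extChartAt (splitModel m) (t, c)).source ↔ p.2 ∈ (extChartAt (𝓡 m) c).source := by
  rw [extChartAt_prod]; simp [chartAt_self_eq]

theorem extChartAt_split_apply (t : ℝ) (c : S) (p : ℝ × S) :
    extChartAt (splitModel m) (t, c) p = (p.1, extChartAt (𝓡 m) c p.2) := by
  rw [extChartAt_prod]; rfl

theorem extChartAt_split_symm_apply (t : ℝ) (c : S) (q : SplitVec m) :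
    (extChartAt (splitModel m) (t, c)).symm q = (q.1, (extChartAt (𝓡 m) c).symm q.2) := by
  rw [extChartAt_prod]; rfl

theorem hasFDerivAt_coordChange {c c' y : S} (hy : y ∈ (extChartAt (𝓡 m) c).source)
    (hy' : y ∈ (extChartAt (𝓡 m) c').source) :
    HasFDerivAt (extChartAt (𝓡 m) c' ∘ (extChartAt (𝓡 m) c).symm)
      (tangentCoordChange (𝓡 m) c c' y) (extChartAt (𝓡 m) c y) := by
  have := hasFDerivWithinAt_tangentCoordChange (I := 𝓡 m) ⟨hy, hy'⟩
  rwa [ModelWithCorners.range_eq_univ, hasFDerivWithinAt_univ] at this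

theorem tangentCoordChange_split (t t' : ℝ) {c y' : S} {p : ℝ × S}
    (hy : p.2 ∈ (extChartAt (𝓡 m) c).source) (hy' : p.2 ∈ (extChartAt (𝓡 m) y').source)
    (v : SplitVec m) : tangentCoordChange (splitModel m) (t, c) (t', y') p v =
      (v.1, tangentCoordChange (𝓡 m) c y' p.2 v.2) := by
  have h2 := hasFDerivWithinAt_tangentCoordChange (I := splitModel m) (x := (t, c)) (y := (t', y'))
    (z := p) ⟨mem_extChartAt_split_source.2 hy, mem_extChartAt_split_source.2 hy'⟩
  rw [ModelWithCorners.range_eq_univ, hasFDerivWithinAt_univ, extChartAt_split_apply] at h2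
  have h3 := (hasFDerivAt_id (𝕜 := ℝ) p.1).prodMap (p.1, extChartAt (𝓡 m) c p.2)
    (hasFDerivAt_coordChange hy hy')
  have h4 : extChartAt (splitModel m) (t', y') ∘ (extChartAt (splitModel m) (t, c)).symm =
      Prod.map id (extChartAt (𝓡 m) y' ∘ (extChartAt (𝓡 m) c).symm) := by
    ext1 q
    simp only [Function.comp, extChartAt_split_symm_apply, extChartAt_split_apply]
    rfl
  rw [h4] at h2
  exact DFunLike.congr_fun (h2.unique h3) v

theorem vecOfChart_split (t : ℝ) {c : S} {p : ℝ × S}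
    (hy : p.2 ∈ (extChartAt (𝓡 m) c).source) (v : SplitVec m) :
    vecOfChart (splitModel m) (t, c) p v = (v.1, tangentCoordChange (𝓡 m) c p.2 p.2 v.2) :=
  tangentCoordChange_split t p.1 hy (mem_extChartAt_source p.2) v

end SplitCoordChange

/-! ### Split metrics in the charts of the base -/

section Patch

variable {m : ℕ} {S : Type*} [TopologicalSpace S]
  [ChartedSpace (EuclideanSpace ℝ (Fin m)) S] [IsManifold (𝓡 m) ∞ S] (M : SplitMetric m S)

/-- The point of `ℝ × S` whose coordinates in the chart centred at `c` are `q`. -/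
def chartPt (c : S) (q : SplitVec m) : ℝ × S := (q.1, (extChartAt (𝓡 m) c).symm q.2)

/-- The spacetime vector at `chartPt c q` whose coordinates in the chart centred at `c` are `v`. -/
def chartVec (c : S) (q : SplitVec m) : SplitVec m →L[ℝ] SplitVec m :=
  (ContinuousLinearMap.id ℝ ℝ).prodMap
    (tangentCoordChange (𝓡 m) c ((extChartAt (𝓡 m) c).symm q.2) ((extChartAt (𝓡 m) c).symm q.2))

/-- The form `σ` in the chart centred at `c`. -/
def sigmaInChart (c : S) (q : SplitVec m) : SplitVec m →L[ℝ] SplitVec m →L[ℝ] ℝ :=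
  ContinuousLinearMap.bilinearComp (M.sigma (chartPt c q) : SplitVec m →L[ℝ] SplitVec m →L[ℝ] ℝ)
    (chartVec c q) (chartVec c q)

theorem sigmaInChart_apply (c : S) (q v w : SplitVec m) : sigmaInChart M c q v w =
    M.sigma (chartPt c q) (chartVec c q v) (chartVec c q w) := rfl

theorem vecOfChart_chartPt {c : S} {q : SplitVec m} (hq : q.2 ∈ (extChartAt (𝓡 m) c).target)
    (t : ℝ) (v : SplitVec m) :
    vecOfChart (splitModel m) (t, c) (chartPt c q) v = chartVec c q v :=
  vecOfChart_split t (p := chartPt c q) ((extChartAt (𝓡 m) c).map_target hq) v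

theorem chartVec_ne_zero {c : S} {q : SplitVec m} (hq : q.2 ∈ (extChartAt (𝓡 m) c).target)
    {v : SplitVec m} (hv : v.2 ≠ 0) : (chartVec c q v).2 ≠ 0 := by
  intro h
  have hs := (extChartAt (𝓡 m) c).map_target hq
  set y := (extChartAt (𝓡 m) c).symm q.2
  have h1 : tangentCoordChange (𝓡 m) y c y (tangentCoordChange (𝓡 m) c y y v.2) = v.2 := by
    rw [tangentCoordChange_comp ⟨⟨hs, mem_extChartAt_source y⟩, hs⟩, tangentCoordChange_self hs]
  have h2 : tangentCoordChange (𝓡 m) c y y v.2 = 0 := h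
  rw [h2, map_zero] at h1
  exact hv h1.symm

theorem isOpen_preimage_base (c : S) :
    IsOpen {q : SplitVec m | q.2 ∈ (extChartAt (𝓡 m) c).target} :=
  (isOpen_extChartAt_target c).preimage continuous_snd

theorem contMDiffOn_chartPt (c : S) : ContMDiffOn 𝓘(ℝ, SplitVec m) (splitModel m) ∞
    (chartPt c) {q : SplitVec m | q.2 ∈ (extChartAt (𝓡 m) c).target} := by
  have h := contMDiffOn_extChartAt_symm (I := splitModel m) (n := ∞) ((0, c) : ℝ × S)
  have h1 : (extChartAt (splitModel m) ((0, c) : ℝ × S)).target =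
      {q : SplitVec m | q.2 ∈ (extChartAt (𝓡 m) c).target} := by
    rw [extChartAt_prod]; ext q; simp [chartAt_self_eq]
  rw [h1] at h
  exact h.congr fun q _ ↦ (extChartAt_split_symm_apply 0 c q).symm

theorem contDiffOn_sigmaInChart (c : S) :
    ContDiffOn ℝ ∞ (sigmaInChart M c) {q : SplitVec m | q.2 ∈ (extChartAt (𝓡 m) c).target} := by
  rw [contDiffOn_clm_apply]
  intro v
  rw [contDiffOn_clm_apply]
  intro w
  rw [← contMDiffOn_iff_contDiffOn]
  have h1 : ∀ v : SplitVec m, ContMDiffOn (splitModel m) ((splitModel m).prod 𝓘(ℝ, SplitVec m)) ∞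
    (fun x ↦ (⟨x, vecOfChart (splitModel m) ((0, c) : ℝ × S) x v⟩ :
      TangentBundle (splitModel m) (ℝ × S))) (chartAt _ ((0, c) : ℝ × S)).source := fun v ↦
    contMDiffOn_vecOfChart _ v
  have h2 := ContMDiffOn.clm_bundle_apply₂ (b := fun p : ℝ × S ↦ p)
    (E₃ := Bundle.Trivial (ℝ × S) ℝ) (F₃ := ℝ)
    (M.sigma_smooth.contMDiffOn (s := (chartAt _ ((0, c) : ℝ × S)).source)) (h1 v) (h1 w)
  have h3 : ContMDiffOn (splitModel m) 𝓘(ℝ, ℝ) ∞ (fun p ↦ M.sigma p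
    (vecOfChart (splitModel m) ((0, c) : ℝ × S) p v)
    (vecOfChart (splitModel m) ((0, c) : ℝ × S) p w))
      (chartAt (ModelProd ℝ (EuclideanSpace ℝ (Fin m))) ((0, c) : ℝ × S)).source := by
    intro p hp
    have := h2 p hp
    rw [Bundle.contMDiffWithinAt_totalSpace] at this
    have h4 := this.2
    simpa using h4
  refine (h3.comp (contMDiffOn_chartPt c) fun q hq ↦ ?_).congr fun q hq ↦ ?_
  · change chartPt c q ∈ (chartAt (ModelProd ℝ (EuclideanSpace ℝ (Fin m))) ((0, c) : ℝ × S)).source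
    rw [← extChartAt_source (splitModel m), mem_extChartAt_split_source]
    exact (extChartAt (𝓡 m) c).map_target hq
  · simp only [sigmaInChart_apply, Function.comp, vecOfChart_chartPt hq]

theorem contDiffAt_lapse_chartPt {c : S} {q : SplitVec m}
    (hq : q.2 ∈ (extChartAt (𝓡 m) c).target) :
    ContDiffAt ℝ ∞ (fun q ↦ M.lapse (chartPt c q)) q := by
  have := M.lapse_smooth.comp_contMDiffOn (contMDiffOn_chartPt c)
  exact (contMDiffOn_iff_contDiffOn.1 this).contDiffAt ((isOpen_preimage_base c).mem_nhds hq)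

theorem sigmaInChart_ker (c : S) (q : SplitVec m) (a : ℝ) (w : SplitVec m) :
    sigmaInChart M c q (a, 0) w = 0 := by
  have h : chartVec c q (a, 0) = (a, 0) := by simp [chartVec]
  rw [sigmaInChart_apply, h]
  exact M.sigma_ker _ _ _

theorem sigmaInChart_symm (c : S) (q v w : SplitVec m) :
    sigmaInChart M c q v w = sigmaInChart M c q w v := by
  rw [sigmaInChart_apply, sigmaInChart_apply]
  exact M.sigma_symm (chartPt c q) (chartVec c q v) (chartVec c q w)

theorem sigmaInChart_pos {c : S} {q : SplitVec m} (hq : q.2 ∈ (extChartAt (𝓡 m) c).target)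
    {v : SplitVec m} (hv : v.2 ≠ 0) : 0 < sigmaInChart M c q v v := by
  rw [sigmaInChart_apply]
  exact M.sigma_pos (chartPt c q) (chartVec c q v) (chartVec_ne_zero hq hv)

/-- The metric `M` in the chart of the base centred at `c`. -/
def chartPatch (c : S) : SplitPatch (EuclideanSpace ℝ (Fin m)) where
  base := (extChartAt (𝓡 m) c).target
  isOpen_base := isOpen_extChartAt_target c
  lapse q := M.lapse (chartPt c q)
  sigma := sigmaInChart M c
  lapse_pos _ _ := M.lapse_pos _
  lapse_smooth _ hq := contDiffAt_lapse_chartPt M hq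
  sigma_smooth q hq :=
    (contDiffOn_sigmaInChart M c).contDiffAt ((isOpen_preimage_base c).mem_nhds hq)
  sigma_symm _ _ _ _ := sigmaInChart_symm M c _ _ _
  sigma_ker _ _ _ _ := sigmaInChart_ker M c _ _ _
  sigma_pos _ hq _ hv := sigmaInChart_pos M hq hv

theorem chartPatch_metric_apply (c : S) (q v w : SplitVec m) :
    (chartPatch M c).metric q v w = M.metric (chartPt c q) (chartVec c q v) (chartVec c q w) := by
  rw [SplitPatch.metric_apply]; rfl

theorem formInChart_metric (t : ℝ) {c : S} {q : SplitVec m}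
    (hq : q.2 ∈ (extChartAt (𝓡 m) c).target) (a b : SplitVec m) :
    formInChart (splitModel m) M.metric ((t, c) : ℝ × S) q a b =
      (chartPatch M c).metric q a b := by
  rw [chartPatch_metric_apply, formInChart, ← vecOfChart_chartPt hq t, ← vecOfChart_chartPt hq t]
  rw [extChartAt_split_symm_apply]; rfl

/-- The change of coordinates from the chart centred at `c` to that centred at `c'`. -/
def splitChange (c c' : S) (q : SplitVec m) : SplitVec m :=
  (q.1, extChartAt (𝓡 m) c' ((extChartAt (𝓡 m) c).symm q.2))

/-- The differential of `splitChange c c'` at a point with projection `y` in `S`. -/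
def splitChangeDeriv (c c' y : S) : SplitVec m →L[ℝ] SplitVec m :=
  (ContinuousLinearMap.id ℝ ℝ).prodMap (tangentCoordChange (𝓡 m) c c' y)

theorem hasFDerivAt_splitChange {c c' : S} {q : SplitVec m}
    (hq : q.2 ∈ (extChartAt (𝓡 m) c).target)
    (hq' : (extChartAt (𝓡 m) c).symm q.2 ∈ (extChartAt (𝓡 m) c').source) :
    HasFDerivAt (splitChange c c')
      (splitChangeDeriv c c' ((extChartAt (𝓡 m) c).symm q.2)) q := by
  have h := hasFDerivAt_coordChange ((extChartAt (𝓡 m) c).map_target hq) hq'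
  rw [(extChartAt (𝓡 m) c).right_inv hq] at h
  exact (hasFDerivAt_id (𝕜 := ℝ) q.1).prodMap q h

theorem contDiffAt_splitChange {c c' : S} {q : SplitVec m}
    (hq : q.2 ∈ (extChartAt (𝓡 m) c).target)
    (hq' : (extChartAt (𝓡 m) c).symm q.2 ∈ (extChartAt (𝓡 m) c').source) :
    ContDiffAt ℝ ∞ (splitChange c c') q := by
  have h := contDiffWithinAt_ext_coord_change (I := 𝓡 m) (n := ∞) c' c (y := q.2) (by
    simp only [PartialEquiv.trans_source, PartialEquiv.symm_source]
    exact ⟨hq, hq'⟩)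
  rw [ModelWithCorners.range_eq_univ, contDiffWithinAt_univ] at h
  exact contDiffAt_fst.prodMk (h.comp q contDiffAt_snd)

theorem eventually_splitChange {c c' : S} {q : SplitVec m}
    (hq : q.2 ∈ (extChartAt (𝓡 m) c).target)
    (hq' : (extChartAt (𝓡 m) c).symm q.2 ∈ (extChartAt (𝓡 m) c').source) :
    ∀ᶠ r in 𝓝 q, r.2 ∈ (extChartAt (𝓡 m) c).target ∧
      (extChartAt (𝓡 m) c).symm r.2 ∈ (extChartAt (𝓡 m) c').source := by
  have h1 : ∀ᶠ r : SplitVec m in 𝓝 q, r.2 ∈ (extChartAt (𝓡 m) c).target :=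
    (isOpen_preimage_base c).mem_nhds hq
  have h2 := ((continuousAt_extChartAt_symm'' hq).comp (f := Prod.snd) (x := q)
    continuous_snd.continuousAt).eventually ((isOpen_extChartAt_source c').mem_nhds hq')
  exact h1.and h2

theorem splitChange_metric {c c' : S} {q : SplitVec m}
    (hq : q.2 ∈ (extChartAt (𝓡 m) c).target)
    (hq' : (extChartAt (𝓡 m) c).symm q.2 ∈ (extChartAt (𝓡 m) c').source) (a b : SplitVec m) :
    (chartPatch M c').metric (splitChange c c' q)
      (splitChangeDeriv c c' ((extChartAt (𝓡 m) c).symm q.2) a)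
      (splitChangeDeriv c c' ((extChartAt (𝓡 m) c).symm q.2) b) =
    (chartPatch M c).metric q a b := by
  have hp : chartPt c' (splitChange c c' q) = chartPt c q :=
    Prod.ext rfl ((extChartAt (𝓡 m) c').left_inv hq')
  have hv : ∀ v, chartVec c' (splitChange c c' q)
      (splitChangeDeriv c c' ((extChartAt (𝓡 m) c).symm q.2) v) = chartVec c q v := by
    intro v
    have h1 : (extChartAt (𝓡 m) c').symm (splitChange c c' q).2 = (extChartAt (𝓡 m) c).symm q.2 :=
      (extChartAt (𝓡 m) c').left_inv hq'
    refine Prod.ext rfl ?_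
    simp only [chartVec, splitChangeDeriv, h1]
    exact tangentCoordChange_comp
      ⟨⟨(extChartAt (𝓡 m) c).map_target hq, hq'⟩, mem_extChartAt_source _⟩
  rw [chartPatch_metric_apply, chartPatch_metric_apply, hv, hv, hp]

end Patch

/-! ### Invariance of the connection under changes of coordinates -/

section Invariance

variable {E F G : Type*} [NormedAddCommGroup E] [NormedSpace ℝ E] [NormedAddCommGroup F]
  [NormedSpace ℝ F] [NormedAddCommGroup G] [NormedSpace ℝ G]

theorem fderiv_fderiv_comp {f : F → G} {g : E → F} {z : E} (hf : ContDiffAt ℝ 2 f (g z))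
    (hg : ContDiffAt ℝ 2 g z) (a b : E) :
    fderiv ℝ (fun y ↦ fderiv ℝ (f ∘ g) y b) z a =
      fderiv ℝ (fun y ↦ fderiv ℝ f y (fderiv ℝ g z b)) (g z) (fderiv ℝ g z a) +
        fderiv ℝ f (g z) (fderiv ℝ (fun y ↦ fderiv ℝ g y b) z a) := by
  have h1 : (fun y ↦ fderiv ℝ (f ∘ g) y b) =ᶠ[𝓝 z] fun y ↦ fderiv ℝ f (g y) (fderiv ℝ g y b) := by
    filter_upwards [hg.eventually (by simp), hg.continuousAt.eventually (hf.eventually (by simp))]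
      with y hy hy'
    rw [fderiv_comp y (hy'.differentiableAt (by simp)) (hy.differentiableAt (by simp))]; rfl
  have hf' : DifferentiableAt ℝ (fderiv ℝ f) (g z) :=
    (hf.fderiv_right (m := 1) (by norm_num)).differentiableAt (by simp)
  have hg' : DifferentiableAt ℝ (fderiv ℝ g) z :=
    (hg.fderiv_right (m := 1) (by norm_num)).differentiableAt (by simp)
  have hg0 := (hg.differentiableAt (by simp)).hasFDerivAt
  have h2 := ((hf'.hasFDerivAt.comp z hg0).clm_apply (hg'.hasFDerivAt.clm_apply
    (hasFDerivAt_const b z))).fderiv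
  have h3 := (hg'.hasFDerivAt.clm_apply (hasFDerivAt_const b z)).fderiv
  have h4 := (hf'.hasFDerivAt.clm_apply (hasFDerivAt_const (fderiv ℝ g z b) (g z))).fderiv
  rw [h1.fderiv_eq, h3, h4]
  refine (DFunLike.congr_fun h2 a).trans ?_
  simp [add_comm]

theorem fderiv_fderiv_symm {f : E → F} {z : E} (hf : ContDiffAt ℝ 2 f z) (a b : E) :
    fderiv ℝ (fun y ↦ fderiv ℝ f y b) z a = fderiv ℝ (fun y ↦ fderiv ℝ f y a) z b := by
  have hf' : DifferentiableAt ℝ (fderiv ℝ f) z :=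
    (hf.fderiv_right (m := 1) (by norm_num)).differentiableAt (by simp)
  have h := fun c ↦ (hf'.hasFDerivAt.clm_apply (hasFDerivAt_const c z)).fderiv
  rw [h, h]
  simpa using hf.isSymmSndFDerivAt (by simp) a b

/-- Christoffel symbols of the first kind of a pull-back metric `K^* G₂`. -/
theorem christoffel_pullback {G₂ : F → F →L[ℝ] F →L[ℝ] ℝ} {h : E → E → E → ℝ} {K : E → F} {q : E}
    (hG : DifferentiableAt ℝ G₂ (K q)) (hs : ∀ᶠ p in 𝓝 (K q), ∀ v w, G₂ p v w = G₂ p w v)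
    (hK : ContDiffAt ℝ 2 K q)
    (hh : ∀ᶠ p in 𝓝 q, ∀ a b, h p a b = G₂ (K p) (fderiv ℝ K p a) (fderiv ℝ K p b)) (a b d : E) :
    (fderiv ℝ (fun y ↦ h y b d) q a + fderiv ℝ (fun y ↦ h y a d) q b
      - fderiv ℝ (fun y ↦ h y a b) q d) / 2 =
    (fderiv ℝ G₂ (K q) (fderiv ℝ K q a) (fderiv ℝ K q b) (fderiv ℝ K q d)
      + fderiv ℝ G₂ (K q) (fderiv ℝ K q b) (fderiv ℝ K q a) (fderiv ℝ K q d)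
      - fderiv ℝ G₂ (K q) (fderiv ℝ K q d) (fderiv ℝ K q a) (fderiv ℝ K q b)) / 2
    + G₂ (K q) (fderiv ℝ (fun y ↦ fderiv ℝ K y b) q a) (fderiv ℝ K q d) := by
  have hK' : DifferentiableAt ℝ (fderiv ℝ K) q :=
    (hK.fderiv_right (m := 1) (by norm_num)).differentiableAt (by simp)
  have hK0 := (hK.differentiableAt (by simp)).hasFDerivAt
  have hv := fun c ↦ hK'.hasFDerivAt.clm_apply (hasFDerivAt_const c q)
  have key : ∀ a b d, fderiv ℝ (fun y ↦ h y b d) q a =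
      fderiv ℝ G₂ (K q) (fderiv ℝ K q a) (fderiv ℝ K q b) (fderiv ℝ K q d) +
      G₂ (K q) (fderiv ℝ (fun y ↦ fderiv ℝ K y b) q a) (fderiv ℝ K q d) +
      G₂ (K q) (fderiv ℝ K q b) (fderiv ℝ (fun y ↦ fderiv ℝ K y d) q a) := by
    intro a b d
    have h1 : (fun y ↦ h y b d) =ᶠ[𝓝 q]
        fun y ↦ G₂ (K y) (fderiv ℝ K y b) (fderiv ℝ K y d) := hh.mono fun y hy ↦ hy b d
    have h2 := (((hG.hasFDerivAt.comp q hK0).clm_apply (hv b)).clm_apply (hv d)).fderiv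
    rw [h1.fderiv_eq, (hv b).fderiv, (hv d).fderiv]
    refine (DFunLike.congr_fun h2 a).trans ?_
    simp; ring
  have hss := hs.self_of_nhds
  rw [key, key, key, fderiv_fderiv_symm hK b a, fderiv_fderiv_symm hK d a,
    fderiv_fderiv_symm hK d b,
    hss (fderiv ℝ K q b) (fderiv ℝ (fun y ↦ fderiv ℝ K y d) q a)]
  ring

/-- The normal component of the second covariant derivative of a map does not depend on the
coordinates: `z` are old coordinates of the source and `θ z` new ones, `h` and `G₂` are the metric
of the target in old and new coordinates, which are related by `K`, and the map is `f₁`, `f₂`. -/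
theorem connection_invariant {E' : Type*} [NormedAddCommGroup E'] [NormedSpace ℝ E']
    {G₂ : F → F →L[ℝ] F →L[ℝ] ℝ} {h : E → E → E → ℝ} {K : E → F} {θ : E' → G} {f₁ : E' → E}
    {f₂ : G → F} {z : E'}
    (hG : DifferentiableAt ℝ G₂ (K (f₁ z))) (hI : (G₂ (K (f₁ z))).IsInvertible)
    (hs : ∀ᶠ p in 𝓝 (K (f₁ z)), ∀ v w, G₂ p v w = G₂ p w v)
    (hK : ContDiffAt ℝ 2 K (f₁ z))
    (hh : ∀ᶠ p in 𝓝 (f₁ z), ∀ a b, h p a b = G₂ (K p) (fderiv ℝ K p a) (fderiv ℝ K p b))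
    (hf₁ : ContDiffAt ℝ 2 f₁ z) (hθ : ContDiffAt ℝ 2 θ z) (hf₂ : ContDiffAt ℝ 2 f₂ (θ z))
    (hfK : f₂ ∘ θ =ᶠ[𝓝 z] K ∘ f₁) {n : E}
    (hn : ∀ v, G₂ (K (f₁ z)) (fderiv ℝ f₂ (θ z) v) (fderiv ℝ K (f₁ z) n) = 0) (a b : E') :
    h (f₁ z) (fderiv ℝ (fun y ↦ fderiv ℝ f₁ y b) z a) n +
      (fderiv ℝ (fun y ↦ h y (fderiv ℝ f₁ z b) n) (f₁ z) (fderiv ℝ f₁ z a)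
      + fderiv ℝ (fun y ↦ h y (fderiv ℝ f₁ z a) n) (f₁ z) (fderiv ℝ f₁ z b)
      - fderiv ℝ (fun y ↦ h y (fderiv ℝ f₁ z a) (fderiv ℝ f₁ z b)) (f₁ z) n) / 2 =
    G₂ (K (f₁ z)) (fderiv ℝ (fun y ↦ fderiv ℝ f₂ y (fderiv ℝ θ z b)) (θ z) (fderiv ℝ θ z a) +
      christoffelTwo G₂ (K (f₁ z)) (fderiv ℝ f₂ (θ z) (fderiv ℝ θ z a))
        (fderiv ℝ f₂ (θ z) (fderiv ℝ θ z b))) (fderiv ℝ K (f₁ z) n) := by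
  have h1 : ∀ c, fderiv ℝ f₂ (θ z) (fderiv ℝ θ z c) = fderiv ℝ K (f₁ z) (fderiv ℝ f₁ z c) := by
    intro c
    have := hfK.fderiv_eq (𝕜 := ℝ)
    rw [fderiv_comp z (hf₂.differentiableAt (by simp)) (hθ.differentiableAt (by simp)),
      fderiv_comp z (hK.differentiableAt (by simp)) (hf₁.differentiableAt (by simp))] at this
    exact DFunLike.congr_fun this c
  have h2 : fderiv ℝ (fun y ↦ fderiv ℝ (f₂ ∘ θ) y b) z a =
      fderiv ℝ (fun y ↦ fderiv ℝ (K ∘ f₁) y b) z a := by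
    have : (fun y ↦ fderiv ℝ (f₂ ∘ θ) y b) =ᶠ[𝓝 z] fun y ↦ fderiv ℝ (K ∘ f₁) y b :=
      hfK.eventuallyEq_nhds.mono fun y hy ↦ by simp only [hy.fderiv_eq]
    rw [this.fderiv_eq]
  rw [fderiv_fderiv_comp hf₂ hθ, fderiv_fderiv_comp hK hf₁] at h2
  rw [christoffel_pullback hG hs hK hh, hh.self_of_nhds, map_add, add_apply,
    apply_christoffelTwo hI, h1, h1]
  have h3 := congrArg (fun v ↦ G₂ (K (f₁ z)) v (fderiv ℝ K (f₁ z) n)) h2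
  simp only [map_add, add_apply, hn] at h3
  linarith

end Invariance

/-! ### Traces with respect to a metric -/

section MetricTrace

variable {m : ℕ} {g : EuclideanSpace ℝ (Fin m) →L[ℝ] EuclideanSpace ℝ (Fin m) →L[ℝ] ℝ}

/-- The matrix of a bilinear form. -/
def formMatrix (g : EuclideanSpace ℝ (Fin m) →L[ℝ] EuclideanSpace ℝ (Fin m) →L[ℝ] ℝ) :
    Matrix (Fin m) (Fin m) ℝ :=
  Matrix.of fun i j ↦ g (EuclideanSpace.single i 1) (EuclideanSpace.single j 1)

theorem apply_eq_formMatrix (a b : EuclideanSpace ℝ (Fin m)) :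
    g a b = a.ofLp ⬝ᵥ (formMatrix g).mulVec b.ofLp := by
  conv_lhs => rw [← sum_apply_smul_single a, ← sum_apply_smul_single b]
  simp [dotProduct, Matrix.mulVec, formMatrix, sum_apply, Finset.mul_sum]
  rw [Finset.sum_comm]
  exact Finset.sum_congr rfl fun i _ ↦ Finset.sum_congr rfl fun j _ ↦ by ring

theorem IsInner.posDef_formMatrix (hg : IsInner g) : (formMatrix g).PosDef := by
  refine Matrix.PosDef.of_dotProduct_mulVec_pos ?_ fun v hv ↦ ?_
  · ext i j
    simp [formMatrix, hg.symm (EuclideanSpace.single j 1)]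
  · have h : WithLp.toLp 2 v ≠ 0 := by simpa using hv
    simpa [apply_eq_formMatrix] using hg.pos _ h

/-- The matrix of an operator. -/
def opMatrix (f : EuclideanSpace ℝ (Fin m) →L[ℝ] EuclideanSpace ℝ (Fin m)) :
    Matrix (Fin m) (Fin m) ℝ :=
  Matrix.of fun i j ↦ f (EuclideanSpace.single j 1) i

theorem formMatrix_mul_opMatrix (f : EuclideanSpace ℝ (Fin m) →L[ℝ] EuclideanSpace ℝ (Fin m)) :
    formMatrix g * opMatrix f = Matrix.of fun i j ↦
      g (EuclideanSpace.single i 1) (f (EuclideanSpace.single j 1)) := by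
  ext i j
  rw [Matrix.of_apply]
  conv_rhs => rw [← sum_apply_smul_single (f (EuclideanSpace.single j 1))]
  simp [Matrix.mul_apply, formMatrix, opMatrix, mul_comm]

theorem opMatrix_comp (f f' : EuclideanSpace ℝ (Fin m) →L[ℝ] EuclideanSpace ℝ (Fin m)) :
    opMatrix (f ∘L f') = opMatrix f * opMatrix f' := by
  ext i j
  simp only [opMatrix, Matrix.mul_apply, Matrix.of_apply, ContinuousLinearMap.comp_apply]
  conv_lhs => rw [← sum_apply_smul_single (f' (EuclideanSpace.single j 1))]
  simp [mul_comm]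

theorem trace_opMatrix (f : EuclideanSpace ℝ (Fin m) →L[ℝ] EuclideanSpace ℝ (Fin m)) :
    (opMatrix f).trace = traceL f := by
  rw [traceL_eq_sum]; rfl

theorem IsInner.inv_mul_eq_opMatrix (hg : IsInner g)
    {f : EuclideanSpace ℝ (Fin m) →L[ℝ] EuclideanSpace ℝ (Fin m)}
    {B : Matrix (Fin m) (Fin m) ℝ}
    (hB : ∀ i j, B i j = g (EuclideanSpace.single i 1) (f (EuclideanSpace.single j 1))) :
    (formMatrix g)⁻¹ * B = opMatrix f := by
  have h1 : B = formMatrix g * opMatrix f := by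
    rw [formMatrix_mul_opMatrix]; ext i j; exact hB i j
  have h2 : IsUnit (formMatrix g).det := (hg.posDef_formMatrix.det_pos.ne').isUnit
  rw [h1, Matrix.nonsing_inv_mul_cancel_left _ _ h2]

/-- The squared norm of a covector is its value at the vector that represents it. -/
theorem IsInner.dotProduct_inv_mulVec (hg : IsInner g) {D : EuclideanSpace ℝ (Fin m) →L[ℝ] ℝ}
    {w : EuclideanSpace ℝ (Fin m)} (hw : ∀ a, g a w = D a) {d : Fin m → ℝ}
    (hd : ∀ i, d i = D (EuclideanSpace.single i 1)) :
    d ⬝ᵥ (formMatrix g)⁻¹.mulVec d = D w := by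
  have h2 : IsUnit (formMatrix g).det := (hg.posDef_formMatrix.det_pos.ne').isUnit
  have h1 : (formMatrix g).mulVec w.ofLp = d := by
    ext i
    rw [hd, ← hw, apply_eq_formMatrix]
    simp
  have h3 : (formMatrix g)⁻¹.mulVec d = w.ofLp := by
    rw [← h1, Matrix.mulVec_mulVec, Matrix.nonsing_inv_mul _ h2, Matrix.one_mulVec]
  rw [h3, ← hw, apply_eq_formMatrix, h1, dotProduct_comm]

theorem IsInner.exists_repr (hg : IsInner g) (D : EuclideanSpace ℝ (Fin m) →L[ℝ] ℝ) :
    ∃ w, ∀ a, g a w = D a := by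
  have h2 : IsUnit (formMatrix g).det := (hg.posDef_formMatrix.det_pos.ne').isUnit
  let d : Fin m → ℝ := fun i ↦ D (EuclideanSpace.single i 1)
  refine ⟨WithLp.toLp 2 ((formMatrix g)⁻¹.mulVec d), fun a ↦ ?_⟩
  rw [apply_eq_formMatrix]
  simp only [Matrix.mulVec_mulVec, Matrix.mul_nonsing_inv _ h2, Matrix.one_mulVec]
  conv_rhs => rw [← sum_apply_smul_single a]
  simp [dotProduct, d]

end MetricTrace

/-! ### Interior points and charts -/

section Interior

variable {E : Type*} [NormedAddCommGroup E] [NormedSpace ℝ E]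
  {H : Type*} [TopologicalSpace H] {I : ModelWithCorners ℝ E H}
  {X : Type*} [TopologicalSpace X] [ChartedSpace H X] [IsManifold I ∞ X]
  {F : Type*} [NormedAddCommGroup F] [NormedSpace ℝ F] {c x : X}

theorem target_mem_nhds_of_interior (hx : x ∈ I.interior X) (hc : x ∈ (extChartAt I c).source) :
    (extChartAt I c).target ∈ 𝓝 (extChartAt I c x) := by
  rw [extChartAt_source] at hc
  have := (ModelWithCorners.isInteriorPoint_iff_of_mem_atlas (I := I) (n := ∞) (by simp)
    (chart_mem_atlas H c) hc).1 hx
  exact mem_interior_iff_mem_nhds.1 this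

theorem range_mem_nhds_of_interior (hx : x ∈ I.interior X) (hc : x ∈ (extChartAt I c).source) :
    range I ∈ 𝓝 (extChartAt I c x) :=
  mem_of_superset (target_mem_nhds_of_interior hx hc) (extChartAt_target_subset_range c)

theorem continuousAt_chart_symm (hc : x ∈ (extChartAt I c).source) :
    Tendsto (extChartAt I c).symm (𝓝 (extChartAt I c x)) (𝓝 x) := by
  have := continuousAt_extChartAt_symm'' (I := I) ((extChartAt I c).map_source hc)
  rwa [ContinuousAt, (extChartAt I c).left_inv hc] at this

theorem hasFDerivAt_comp_chart_symm_self (hx : x ∈ I.interior X) {f : X → F}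
    (hf : MDifferentiableAt I 𝓘(ℝ, F) f x) :
    HasFDerivAt (f ∘ (extChartAt I x).symm) (mfderiv I 𝓘(ℝ, F) f x : E →L[ℝ] F)
      (extChartAt I x x) := by
  have h1 : HasFDerivWithinAt (f ∘ (extChartAt I x).symm) (mfderiv I 𝓘(ℝ, F) f x : E →L[ℝ] F)
      (range I) (extChartAt I x x) := hf.hasMFDerivAt.2
  exact h1.hasFDerivAt (range_mem_nhds_of_interior hx (mem_extChartAt_source x))

/-- The differential in an arbitrary chart. -/
theorem hasFDerivAt_comp_chart_symm (hx : x ∈ I.interior X) (hc : x ∈ (extChartAt I c).source)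
    {f : X → F} (hf : MDifferentiableAt I 𝓘(ℝ, F) f x) :
    HasFDerivAt (f ∘ (extChartAt I c).symm)
      ((mfderiv I 𝓘(ℝ, F) f x : E →L[ℝ] F) ∘L tangentCoordChange I c x x) (extChartAt I c x) := by
  have h1' := hasFDerivAt_comp_chart_symm_self hx hf
  have h2 := hasFDerivWithinAt_tangentCoordChange (I := I) ⟨hc, mem_extChartAt_source x⟩
  have h2' := h2.hasFDerivAt (range_mem_nhds_of_interior hx hc)
  have h3 : (extChartAt I x ∘ (extChartAt I c).symm) (extChartAt I c x) = extChartAt I x x := by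
    rw [Function.comp_apply, (extChartAt I c).left_inv hc]
  rw [← h3] at h1'
  refine (h1'.comp _ h2').congr_of_eventuallyEq ?_
  filter_upwards [(continuousAt_chart_symm hc).eventually
    (extChartAt_source_mem_nhds (I := I) x)] with y hy
  exact congrArg f ((extChartAt I x).left_inv hy).symm

theorem contDiffAt_comp_chart_symm (hx : x ∈ I.interior X) (hc : x ∈ (extChartAt I c).source)
    {f : X → F} {n : ℕ∞ω} (hn : n ≤ ∞) (hf : ContMDiffAt I 𝓘(ℝ, F) n f x) :
    ContDiffAt ℝ n (f ∘ (extChartAt I c).symm) (extChartAt I c x) := by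
  have : IsManifold I n X := IsManifold.of_le hn
  rw [extChartAt_source] at hc
  have := ((contMDiffAt_iff_of_mem_source hc (y := f x) (by simp)).1 hf).2
  rw [← extChartAt_source I] at hc
  exact this.contDiffAt (range_mem_nhds_of_interior hx hc)

end Interior

theorem SplitMetric.metric_time_apply {m : ℕ} {S : Type*} [TopologicalSpace S]
    [ChartedSpace (EuclideanSpace ℝ (Fin m)) S] [IsManifold (𝓡 m) ∞ S] (M : SplitMetric m S)
    (p : ℝ × S) (a : ℝ) (w : SplitVec m) :
    M.metric p ((a, 0) : SplitVec m) w = -(M.lapse p ^ 2 * (a * w.1)) := by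
  exact (congrArg (fun s ↦ M.lapse p ^ 2 * (-(a * w.1) + s)) (M.sigma_ker p a w)).trans (by ring)

namespace SpacelikeHypersurface

variable {m : ℕ} [NeZero m] {S : Type*} [TopologicalSpace S]
  [ChartedSpace (EuclideanSpace ℝ (Fin m)) S] [IsManifold (𝓡 m) ∞ S] {M : SplitMetric m S}
  {N : Type*} [TopologicalSpace N] [ChartedSpace (EuclideanHalfSpace m) N]
  [IsManifold (𝓡∂ m) ∞ N] (Sg : SpacelikeHypersurface M N)

/-! ### The projection of the hypersurface to `S` -/

/-- The projection of the hypersurface to the slice `S`. -/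
def proj (x : N) : S := (Sg.emb x).2

/-- The time function of the hypersurface. -/
def time (x : N) : ℝ := (Sg.emb x).1

theorem contMDiff_proj : ContMDiff (𝓡∂ m) (𝓡 m) ∞ Sg.proj :=
  contMDiff_snd.comp Sg.smooth

theorem contMDiff_time : ContMDiff (𝓡∂ m) 𝓘(ℝ, ℝ) ∞ Sg.time :=
  contMDiff_fst.comp Sg.smooth

theorem mdifferentiable_proj : MDifferentiable (𝓡∂ m) (𝓡 m) Sg.proj :=
  Sg.contMDiff_proj.mdifferentiable (by simp)

theorem mfderiv_proj_ne_zero (x : N) (v : TangentSpace (𝓡∂ m) x) (hv : v ≠ 0) :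
    mfderiv (𝓡∂ m) (𝓡 m) Sg.proj x v ≠ 0 := by
  intro h
  have h1 := mfderiv_prodMk (Sg.contMDiff_time.mdifferentiable (by simp) x)
    (Sg.mdifferentiable_proj x)
  have h2 := Sg.spacelike x v hv
  have h3 : mfderiv (𝓡∂ m) (splitModel m) Sg.emb x v =
      ((mfderiv (𝓡∂ m) 𝓘(ℝ, ℝ) Sg.time x v, 0) : SplitVec m) :=
    (DFunLike.congr_fun h1 v).trans (Prod.ext rfl h)
  rw [h3] at h2
  have h4 : M.metric (Sg.emb x) ((mfderiv (𝓡∂ m) 𝓘(ℝ, ℝ) Sg.time x v, 0) : SplitVec m)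
      ((mfderiv (𝓡∂ m) 𝓘(ℝ, ℝ) Sg.time x v, 0) : SplitVec m) ≤ 0 := by
    refine (M.metric_time_apply _ _ _).trans_le ?_
    exact neg_nonpos.2 (mul_nonneg (sq_nonneg _) (mul_self_nonneg _))
  exact absurd h2 h4.not_gt

theorem proj_injective : Function.Injective Sg.proj := by
  intro x x' h
  set y := Sg.proj x with hy
  -- the vertical line over `y` is an inextendible timelike curve
  let γ : ℝ → ℝ × S := fun t ↦ (t, y)
  have hγ : ContMDiff 𝓘(ℝ, ℝ) (splitModel m) 1 γ := contMDiff_id.prodMk contMDiff_const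
  have hd : ∀ a b, a < b → ∀ t ∈ Icc a b,
      mfderivWithin 𝓘(ℝ, ℝ) (splitModel m) γ (Icc a b) t (1 : ℝ) = ((1, 0) : SplitVec m) := by
    intro a b hab t ht
    have hu : UniqueMDiffWithinAt 𝓘(ℝ, ℝ) (Icc a b) t :=
      (uniqueDiffOn_Icc hab t ht).uniqueMDiffWithinAt
    have h1 := mfderivWithin_prodMk (I' := 𝓘(ℝ, ℝ)) (I'' := 𝓡 m) (f := fun t : ℝ ↦ t)
      (g := fun _ : ℝ ↦ y)
      mdifferentiableWithinAt_id mdifferentiableWithinAt_const hu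
    refine (DFunLike.congr_fun h1 (1 : ℝ)).trans (Prod.ext ?_ ?_)
    · exact DFunLike.congr_fun (mfderivWithin_id (I := 𝓘(ℝ, ℝ)) hu) (1 : ℝ)
    · exact DFunLike.congr_fun (mfderivWithin_const (I := 𝓘(ℝ, ℝ)) (I' := 𝓡 m) (c := y)) (1 : ℝ)
  have hi : M.InextendibleTimelike γ := by
    refine ⟨⟨hγ.continuous.continuousOn, ∅, by simp, fun a _ b _ hab _ ↦
      ⟨hγ.contMDiffOn, fun t ht ↦ ?_⟩⟩, ?_, ?_⟩
    · rw [hd a b hab t ht]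
      have hp := M.lapse_pos (γ t)
      refine ⟨?_, ?_⟩
      · rw [M.metric_time_apply]
        simp only [mul_one, Left.neg_neg_iff]
        positivity
      · rw [SplitMetric.observer, M.metric_time_apply]
        simp only [mul_one, Left.neg_neg_iff]
        positivity
    · rintro ⟨q, hq⟩
      exact not_tendsto_nhds_of_tendsto_atTop tendsto_id q.1
        ((continuous_fst.tendsto q).comp hq)
    · rintro ⟨q, hq⟩
      exact not_tendsto_nhds_of_tendsto_atBot tendsto_id q.1
        ((continuous_fst.tendsto q).comp hq)
  have h1 : γ (Sg.time x) = Sg.emb x := rfl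
  have h2 : γ (Sg.time x') = Sg.emb x' := Prod.ext rfl h
  have h3 := Sg.achronal γ hi _ _ ⟨x, h1.symm⟩ ⟨x', h2.symm⟩
  exact Sg.injective (by rw [← h1, ← h2, h3])

end SpacelikeHypersurface

/-! ### The interior of the hypersurface as a graph over an open subset of `S` -/

namespace SpacelikeHypersurface

variable {m : ℕ} [NeZero m] {S : Type*} [TopologicalSpace S]
  [ChartedSpace (EuclideanSpace ℝ (Fin m)) S] [IsManifold (𝓡 m) ∞ S] {M : SplitMetric m S}
  {N : Type*} [TopologicalSpace N] [ChartedSpace (EuclideanHalfSpace m) N]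
  [IsManifold (𝓡∂ m) ∞ N] (Sg : SpacelikeHypersurface M N)

/-- The projection to `S`, in the chart centred at `c`. -/
def chartMap (c : S) (x : N) : EuclideanSpace ℝ (Fin m) := extChartAt (𝓡 m) c (Sg.proj x)

/-- The differential of `chartMap`. -/
def chartDeriv (c : S) (x : N) : EuclideanSpace ℝ (Fin m) →L[ℝ] EuclideanSpace ℝ (Fin m) :=
  mfderiv (𝓡∂ m) 𝓘(ℝ, EuclideanSpace ℝ (Fin m)) (Sg.chartMap c) x

section ChartMap

variable {Sg} {c : S} {x : N} (hc : Sg.proj x ∈ (extChartAt (𝓡 m) c).source)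
include hc

theorem contMDiffAt_chartMap :
    ContMDiffAt (𝓡∂ m) 𝓘(ℝ, EuclideanSpace ℝ (Fin m)) ∞ (Sg.chartMap c) x := by
  rw [extChartAt_source] at hc
  exact (contMDiffAt_extChartAt' hc).comp x (Sg.contMDiff_proj x)

theorem chartDeriv_apply (v : EuclideanSpace ℝ (Fin m)) : Sg.chartDeriv c x v =
    tangentCoordChange (𝓡 m) (Sg.proj x) c (Sg.proj x) (mfderiv (𝓡∂ m) (𝓡 m) Sg.proj x v) := by
  rw [extChartAt_source] at hc
  have h1 := mfderiv_comp x (I' := 𝓡 m) (mdifferentiableAt_extChartAt hc)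
    (Sg.mdifferentiable_proj x)
  have h2 := tangentCoordChange_def (I := 𝓡 m) (x := Sg.proj x) (y := c) (z := Sg.proj x)
  have h3 := (mdifferentiableAt_extChartAt (I := 𝓡 m) hc).mfderiv
  refine (DFunLike.congr_fun h1 v).trans ?_
  exact DFunLike.congr_fun h3 _

theorem injective_chartDeriv : Function.Injective (Sg.chartDeriv c x) := by
  refine (injective_iff_map_eq_zero _).2 fun v hv ↦ ?_
  by_contra h
  have h1 := Sg.mfderiv_proj_ne_zero x v h
  rw [chartDeriv_apply hc] at hv
  have h2 := tangentCoordChange_comp (I := 𝓡 m) (w := Sg.proj x) (x := c) (y := Sg.proj x)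
    (z := Sg.proj x) (v := mfderiv (𝓡∂ m) (𝓡 m) Sg.proj x v)
    ⟨⟨mem_extChartAt_source _, hc⟩, mem_extChartAt_source _⟩
  rw [hv, map_zero] at h2
  exact h1 ((tangentCoordChange_self (I := 𝓡 m) (E := EuclideanSpace ℝ (Fin m))
    (mem_extChartAt_source (Sg.proj x))).symm.trans h2.symm)

theorem exists_chartDeriv_equiv : ∃ e : EuclideanSpace ℝ (Fin m) ≃L[ℝ] EuclideanSpace ℝ (Fin m),
    (e : EuclideanSpace ℝ (Fin m) →L[ℝ] EuclideanSpace ℝ (Fin m)) = Sg.chartDeriv c x :=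
  ⟨(LinearEquiv.ofInjectiveEndo _ (injective_chartDeriv hc)).toContinuousLinearEquiv, by ext; rfl⟩

end ChartMap

variable [Nonempty N]

/-- The inverse of the projection to `S`. -/
def lift : S → N := Function.invFun Sg.proj

theorem lift_proj (x : N) : Sg.lift (Sg.proj x) = x :=
  Function.leftInverse_invFun Sg.proj_injective x

theorem lift_chartMap {c : S} {x : N} (hc : Sg.proj x ∈ (extChartAt (𝓡 m) c).source) :
    Sg.lift ((extChartAt (𝓡 m) c).symm (Sg.chartMap c x)) = x := by
  rw [chartMap, (extChartAt (𝓡 m) c).left_inv hc, Sg.lift_proj]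

/-- The part of the projection of the interior of the hypersurface to `S` that lies in the chart
centred at `c`, in this chart. -/
def shadow (c : S) : Set (EuclideanSpace ℝ (Fin m)) :=
  {z | ∃ x ∈ (𝓡∂ m).interior N, Sg.proj x ∈ (extChartAt (𝓡 m) c).source ∧ Sg.chartMap c x = z}

theorem shadow_subset (c : S) : Sg.shadow c ⊆ (extChartAt (𝓡 m) c).target := by
  rintro z ⟨x, -, hc, rfl⟩
  exact (extChartAt (𝓡 m) c).map_source hc

/-- A function on the hypersurface, in the chart of `S` centred at `c`. -/
def inChart {F : Type*} (f : N → F) (c : S) (z : EuclideanSpace ℝ (Fin m)) : F :=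
  f (Sg.lift ((extChartAt (𝓡 m) c).symm z))

section Inverse

variable {Sg} {c : S} {x : N} (hx : x ∈ (𝓡∂ m).interior N)
  (hc : Sg.proj x ∈ (extChartAt (𝓡 m) c).source)

include hc in
theorem inChart_chartMap {F : Type*} (f : N → F) : Sg.inChart f c (Sg.chartMap c x) = f x := by
  rw [inChart, Sg.lift_chartMap hc]

include hx hc

theorem eventually_chart : ∀ᶠ z in 𝓝 (extChartAt (𝓡∂ m) x x),
    (extChartAt (𝓡∂ m) x).symm z ∈ (𝓡∂ m).interior N ∧
      Sg.proj ((extChartAt (𝓡∂ m) x).symm z) ∈ (extChartAt (𝓡 m) c).source := by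
  have h := continuousAt_chart_symm (I := 𝓡∂ m) (mem_extChartAt_source x)
  have h1 := ModelWithCorners.isOpen_interior (I := 𝓡∂ m) (M := N) (n := ∞) (by simp)
  have h2 := (Sg.contMDiff_proj.continuous.tendsto x).eventually
    ((isOpen_extChartAt_source c).mem_nhds hc)
  have h3 : ∀ᶠ p in 𝓝 x, p ∈ (𝓡∂ m).interior N := h1.mem_nhds hx
  exact h.eventually (h3.and h2)

theorem hasFDerivAt_chartMap : HasFDerivAt (Sg.chartMap c ∘ (extChartAt (𝓡∂ m) x).symm)
    (Sg.chartDeriv c x) (extChartAt (𝓡∂ m) x x) :=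
  hasFDerivAt_comp_chart_symm_self hx ((contMDiffAt_chartMap hc).mdifferentiableAt (by simp))

/-- The inverse function theorem for the projection to `S`. -/
theorem exists_local_inverse : ∃ g : EuclideanSpace ℝ (Fin m) → EuclideanSpace ℝ (Fin m),
    ContDiffAt ℝ ∞ g (Sg.chartMap c x) ∧ g (Sg.chartMap c x) = extChartAt (𝓡∂ m) x x ∧
    ∀ᶠ w in 𝓝 (Sg.chartMap c x), w ∈ Sg.shadow c ∧
      Sg.lift ((extChartAt (𝓡 m) c).symm w) = (extChartAt (𝓡∂ m) x).symm (g w) := by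
  obtain ⟨e, he⟩ := exists_chartDeriv_equiv hc
  have h1 := contDiffAt_comp_chart_symm hx (mem_extChartAt_source x) le_rfl
    (contMDiffAt_chartMap hc)
  have h2 := hasFDerivAt_chartMap hx hc
  rw [← he] at h2
  have hz : (Sg.chartMap c ∘ (extChartAt (𝓡∂ m) x).symm) (extChartAt (𝓡∂ m) x x) =
      Sg.chartMap c x := congrArg (Sg.chartMap c) (extChartAt_to_inv x)
  have h3 := h1.to_localInverse h2 (by simp)
  have h4 := h1.localInverse_apply_image h2 (by simp)
  have h5 : ∀ᶠ w in 𝓝 ((Sg.chartMap c ∘ (extChartAt (𝓡∂ m) x).symm) (extChartAt (𝓡∂ m) x x)),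
    (Sg.chartMap c ∘ (extChartAt (𝓡∂ m) x).symm) (h1.localInverse h2 (by simp) w) = w :=
    (h1.hasStrictFDerivAt' h2 (by simp)).eventually_right_inverse
  rw [hz] at h3 h4 h5
  refine ⟨h1.localInverse h2 (by simp), h3, h4, ?_⟩
  have h6 := h3.continuousAt
  rw [ContinuousAt, h4] at h6
  filter_upwards [h5, h6.eventually (eventually_chart hx hc)] with w hw hw'
  refine ⟨⟨_, hw'.1, hw'.2, hw⟩, ?_⟩
  conv_lhs => rw [← hw]
  exact Sg.lift_chartMap hw'.2

theorem eventually_mem_shadow : ∀ᶠ w in 𝓝 (Sg.chartMap c x), w ∈ Sg.shadow c := by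
  obtain ⟨g, -, -, h⟩ := exists_local_inverse hx hc
  exact h.mono fun w hw ↦ hw.1

theorem tendsto_lift : Tendsto (fun w ↦ Sg.lift ((extChartAt (𝓡 m) c).symm w))
    (𝓝 (Sg.chartMap c x)) (𝓝 x) := by
  obtain ⟨g, hg, hg', h⟩ := exists_local_inverse hx hc
  have h1 := hg.continuousAt
  rw [ContinuousAt, hg'] at h1
  exact ((continuousAt_chart_symm (mem_extChartAt_source x)).comp h1).congr'
    (h.mono fun w hw ↦ hw.2.symm)

theorem contDiffAt_inChart {F : Type*} [NormedAddCommGroup F] [NormedSpace ℝ F] {f : N → F}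
    {n : ℕ∞ω} (hn : n ≤ ∞) (hf : ContMDiffAt (𝓡∂ m) 𝓘(ℝ, F) n f x) :
    ContDiffAt ℝ n (Sg.inChart f c) (Sg.chartMap c x) := by
  obtain ⟨g, hg, hg', h⟩ := exists_local_inverse hx hc
  have h1 := contDiffAt_comp_chart_symm hx (mem_extChartAt_source x) hn hf
  rw [← hg'] at h1
  exact (h1.comp _ (hg.of_le hn)).congr_of_eventuallyEq (h.mono fun w hw ↦ congrArg f hw.2)

theorem fderiv_inChart {F : Type*} [NormedAddCommGroup F] [NormedSpace ℝ F] {f : N → F}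
    (hf : ContMDiffAt (𝓡∂ m) 𝓘(ℝ, F) 1 f x) (v : EuclideanSpace ℝ (Fin m)) :
    fderiv ℝ (Sg.inChart f c) (Sg.chartMap c x) (Sg.chartDeriv c x v) =
      mfderiv (𝓡∂ m) 𝓘(ℝ, F) f x v := by
  have h1 := ((contDiffAt_inChart hx hc (by simp) hf).differentiableAt
    (by simp)).hasFDerivAt
  have h2 := hasFDerivAt_chartMap hx hc
  have h3 := hasFDerivAt_comp_chart_symm_self hx (hf.mdifferentiableAt (by simp))
  have hz : (Sg.chartMap c ∘ (extChartAt (𝓡∂ m) x).symm) (extChartAt (𝓡∂ m) x x) =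
      Sg.chartMap c x := congrArg (Sg.chartMap c) (extChartAt_to_inv x)
  rw [← hz] at h1
  have h5 := h1.comp _ h2
  rw [hz] at h5
  have h6 : Sg.inChart f c ∘ Sg.chartMap c ∘ (extChartAt (𝓡∂ m) x).symm =ᶠ[
      𝓝 (extChartAt (𝓡∂ m) x x)] f ∘ (extChartAt (𝓡∂ m) x).symm :=
    (eventually_chart hx hc).mono fun z hz ↦ inChart_chartMap hz.2 f
  exact DFunLike.congr_fun (h5.unique (h3.congr_of_eventuallyEq h6)) v

end Inverse

theorem isOpen_shadow (c : S) : IsOpen (Sg.shadow c) := by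
  rw [isOpen_iff_mem_nhds]
  rintro z ⟨x, hx, hc, rfl⟩
  exact eventually_mem_shadow hx hc

end SpacelikeHypersurface

/-! ### Spacelike graphs in the charts of `S` -/

section Gradient

variable {m : ℕ} [NeZero m] {N : Type*} [TopologicalSpace N]
  [ChartedSpace (EuclideanHalfSpace m) N] [IsManifold (𝓡∂ m) ∞ N]
  {h : ∀ x : N, TangentSpace (𝓡∂ m) x → TangentSpace (𝓡∂ m) x → ℝ} {x : N}
  {g : EuclideanSpace ℝ (Fin m) →L[ℝ] EuclideanSpace ℝ (Fin m) →L[ℝ] ℝ}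

/-- The differential of a function, as a covector on the model space. -/
def differential (f : N → ℝ) (x : N) : EuclideanSpace ℝ (Fin m) →L[ℝ] ℝ :=
  mfderiv (𝓡∂ m) 𝓘(ℝ, ℝ) f x

theorem gram_self_eq (hh : ∀ a b : EuclideanSpace ℝ (Fin m), h x a b = g a b) :
    gram h x x = formMatrix g := by
  ext i j
  simp only [gram, formMatrix, Matrix.of_apply, vecOfChart_self]
  exact hh _ _

theorem gradSq_eq (hg : IsInner g) (hh : ∀ a b : EuclideanSpace ℝ (Fin m), h x a b = g a b)
    {f : N → ℝ} {w : EuclideanSpace ℝ (Fin m)}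
    (hw : ∀ a : EuclideanSpace ℝ (Fin m), g a w = differential f x a) :
    gradSq h f x = differential f x w := by
  rw [gradSq, gram_self_eq hh]
  refine hg.dotProduct_inv_mulVec (D := differential f x) hw fun i ↦ ?_
  rw [diffVec, vecOfChart_self]; rfl

theorem exists_gradSq_repr (hg : IsInner g)
    (hh : ∀ a b : EuclideanSpace ℝ (Fin m), h x a b = g a b) (f : N → ℝ) :
    ∃ w : EuclideanSpace ℝ (Fin m),
      (∀ a : EuclideanSpace ℝ (Fin m), g a w = differential f x a) ∧
      gradSq h f x = g w w := by
  obtain ⟨w, hw⟩ := hg.exists_repr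
    (differential f x)
  exact ⟨w, hw, (gradSq_eq hg hh hw).trans (hw w).symm⟩

theorem gradSq_nonneg (hg : IsInner g) (hh : ∀ a b : EuclideanSpace ℝ (Fin m), h x a b = g a b)
    (f : N → ℝ) : 0 ≤ gradSq h f x := by
  obtain ⟨w, -, h2⟩ := exists_gradSq_repr hg hh f
  exact h2 ▸ hg.nonneg w

theorem sq_mfderiv_le_gradSq (hg : IsInner g)
    (hh : ∀ a b : EuclideanSpace ℝ (Fin m), h x a b = g a b) (f : N → ℝ)
    (a : EuclideanSpace ℝ (Fin m)) :
    (differential f x a) ^ 2 ≤ gradSq h f x * g a a := by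
  obtain ⟨w, h1, h2⟩ := exists_gradSq_repr hg hh f
  rw [h2]
  have h3 := hg.cauchy_schwarz a w
  rw [h1 a, mul_comm] at h3
  exact h3

end Gradient

theorem SplitPatch.isInner_sigma {E E' : Type*} [NormedAddCommGroup E] [NormedSpace ℝ E]
    [NormedAddCommGroup E'] [NormedSpace ℝ E'] (A : SplitPatch E) {p : ℝ × E} (hp : p.2 ∈ A.base)
    {f : E' →L[ℝ] E} (hf : Function.Injective f) :
    IsInner ((A.sigma p).bilinearComp (ContinuousLinearMap.inr ℝ ℝ E ∘L f)
      (ContinuousLinearMap.inr ℝ ℝ E ∘L f)) :=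
  ⟨fun _ _ ↦ A.sigma_symm _ hp _ _,
    fun _ ha ↦ A.sigma_pos _ hp _ ((map_ne_zero_iff _ hf).2 ha)⟩

/-- The future unit normal is characterized by its products. -/
theorem SplitPatch.Graph.eq_normal_iff {E : Type*} [NormedAddCommGroup E] [NormedSpace ℝ E]
    [FiniteDimensional ℝ E] {A : SplitPatch E} {u : A.Graph} {x : E} (hx : x ∈ u.dom)
    {n : ℝ × E} : n = u.normal x ↔ A.metric (u.pt x) n n = -1 ∧
      (∀ b, A.metric (u.pt x) (u.dPt x b) n = 0) ∧ A.metric (u.pt x) (1, 0) n < 0 := by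
  constructor
  · rintro rfl
    exact ⟨metric_normal_normal hx, metric_dPt_normal hx,
      by rw [metric_time_normal hx]; exact neg_neg_of_pos (coordTilt_pos hx)⟩
  · rintro ⟨h1, h2, h3⟩
    set k := -A.metric (u.pt x) n (u.normal x) with hk
    have h4 : A.metric (u.pt x) (n - k • u.normal x) (u.normal x) = 0 := by
      simp [metric_normal_normal hx, hk]
    have h5 := eq_dPt_of_metric hx h4
    set b := (n - k • u.normal x).2
    have h6 : u.ind x b b = 0 := by
      rw [ind_apply]
      nth_rw 2 [← h5]
      simp [h2, metric_dPt_normal hx]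
    have h7 : b = 0 := by
      by_contra hb
      exact (ind_pos hx hb).ne' h6
    rw [h7, map_zero, sub_eq_zero] at h5
    rw [h5] at h1 h3
    simp only [map_smul, smul_apply, smul_eq_mul, metric_normal_normal hx,
      metric_time_normal hx] at h1 h3
    have h8 : 0 < k := by
      have := coordTilt_pos hx
      by_contra hk
      nlinarith
    have h9 : k = 1 := by nlinarith
    rw [h5, h9, one_smul]

section Frames

variable {m : ℕ} {S : Type*} [TopologicalSpace S]
  [ChartedSpace (EuclideanSpace ℝ (Fin m)) S] [IsManifold (𝓡 m) ∞ S] (M : SplitMetric m S)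
  {c : S} {p : ℝ × S} (hc : p.2 ∈ (extChartAt (𝓡 m) c).source)

theorem SplitMetric.metric_congr {p p' : ℝ × S} (h : p = p') (v w : SplitVec m) :
    M.metric p v w = M.metric p' v w := by
  subst h; rfl

theorem SplitMetric.sigma_congr {p p' : ℝ × S} (h : p = p') (v w : SplitVec m) :
    M.sigma p v w = M.sigma p' v w := by
  subst h; rfl

/-- The coordinates in the chart centred at `c` of a spacetime vector at a point over `y`. -/
abbrev coordVec (c y : S) : SplitVec m →L[ℝ] SplitVec m := splitChangeDeriv y c y

include hc

theorem chartPt_coord : chartPt c (p.1, extChartAt (𝓡 m) c p.2) = p :=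
  Prod.ext rfl ((extChartAt (𝓡 m) c).left_inv hc)

theorem chartVec_coordVec (v : SplitVec m) :
    chartVec c (p.1, extChartAt (𝓡 m) c p.2) (coordVec c p.2 v) = v := by
  have h1 : (extChartAt (𝓡 m) c).symm (extChartAt (𝓡 m) c p.2) = p.2 :=
    (extChartAt (𝓡 m) c).left_inv hc
  refine Prod.ext rfl ?_
  simp only [chartVec, coordVec, splitChangeDeriv, h1]
  refine (tangentCoordChange_comp (I := 𝓡 m) (E := EuclideanSpace ℝ (Fin m))
    ⟨⟨mem_extChartAt_source _, hc⟩, mem_extChartAt_source _⟩).trans ?_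
  exact tangentCoordChange_self (I := 𝓡 m) (E := EuclideanSpace ℝ (Fin m))
    (mem_extChartAt_source _)

theorem coordVec_chartVec (v : SplitVec m) :
    coordVec c p.2 (chartVec c (p.1, extChartAt (𝓡 m) c p.2) v) = v := by
  have h1 : (extChartAt (𝓡 m) c).symm (extChartAt (𝓡 m) c p.2) = p.2 :=
    (extChartAt (𝓡 m) c).left_inv hc
  refine Prod.ext rfl ?_
  simp only [chartVec, coordVec, splitChangeDeriv, h1]
  refine (tangentCoordChange_comp (I := 𝓡 m) (E := EuclideanSpace ℝ (Fin m))
    ⟨⟨hc, mem_extChartAt_source _⟩, hc⟩).trans ?_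
  exact tangentCoordChange_self (I := 𝓡 m) (E := EuclideanSpace ℝ (Fin m)) hc

theorem metric_eq_coord (v w : SplitVec m) : M.metric p v w =
    (chartPatch M c).metric (p.1, extChartAt (𝓡 m) c p.2) (coordVec c p.2 v)
      (coordVec c p.2 w) := by
  rw [chartPatch_metric_apply, chartVec_coordVec hc, chartVec_coordVec hc]
  exact M.metric_congr (chartPt_coord hc).symm v w

theorem sigma_eq_coord (v w : SplitVec m) : M.sigma p v w =
    (chartPatch M c).sigma (p.1, extChartAt (𝓡 m) c p.2) (coordVec c p.2 v)
      (coordVec c p.2 w) := by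
  change _ = sigmaInChart M c _ _ _
  rw [sigmaInChart_apply, chartVec_coordVec hc, chartVec_coordVec hc]
  exact M.sigma_congr (chartPt_coord hc).symm v w

end Frames

namespace SpacelikeHypersurface

variable {m : ℕ} [NeZero m] {S : Type*} [TopologicalSpace S]
  [ChartedSpace (EuclideanSpace ℝ (Fin m)) S] [IsManifold (𝓡 m) ∞ S] {M : SplitMetric m S}
  {N : Type*} [TopologicalSpace N] [ChartedSpace (EuclideanHalfSpace m) N]
  [IsManifold (𝓡∂ m) ∞ N] {Sg : SpacelikeHypersurface M N} {u : N → ℝ}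
  (hu : Sg.IsSpacelikeHeight u) {c : S} {x : N}

include hu

theorem IsSpacelikeHeight.contMDiff_graphMap :
    ContMDiff (𝓡∂ m) (splitModel m) ∞ (Sg.graphMap u) :=
  hu.smooth.prodMk Sg.contMDiff_proj

omit hu in
theorem fderiv_inChart_eq_differential [Nonempty N] (hx : x ∈ (𝓡∂ m).interior N)
    (hc : Sg.proj x ∈ (extChartAt (𝓡 m) c).source) {f : N → ℝ}
    (hf : ContMDiffAt (𝓡∂ m) 𝓘(ℝ, ℝ) 1 f x) (v : EuclideanSpace ℝ (Fin m)) :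
    fderiv ℝ (Sg.inChart f c) (Sg.chartMap c x) (Sg.chartDeriv c x v) = differential f x v :=
  fderiv_inChart hx hc hf v

theorem dGraph_apply (v : EuclideanSpace ℝ (Fin m)) : Sg.dGraph u x v =
    ((differential u x v, mfderiv (𝓡∂ m) (𝓡 m) Sg.proj x v) : SplitVec m) :=
  DFunLike.congr_fun (mfderiv_prodMk (hu.smooth.mdifferentiable (by simp) x)
    (Sg.mdifferentiable_proj x)) v

theorem coordVec_dGraph (hc : Sg.proj x ∈ (extChartAt (𝓡 m) c).source)
    (v : EuclideanSpace ℝ (Fin m)) : coordVec c (Sg.proj x) (Sg.dGraph u x v) =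
      ((differential u x v, Sg.chartDeriv c x v) : SplitVec m) := by
  rw [dGraph_apply hu, chartDeriv_apply hc]; rfl

theorem sigmaPull_eq (hc : Sg.proj x ∈ (extChartAt (𝓡 m) c).source)
    (a b : EuclideanSpace ℝ (Fin m)) : Sg.sigmaPull u x a b =
      (chartPatch M c).sigma (u x, Sg.chartMap c x) (0, Sg.chartDeriv c x a)
        (0, Sg.chartDeriv c x b) := by
  have hb : Sg.chartMap c x ∈ (chartPatch M c).base := (extChartAt (𝓡 m) c).map_source hc
  refine (sigma_eq_coord M (p := Sg.graphMap u x) hc _ _).trans ?_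
  refine ((chartPatch M c).sigma_eq (p := (u x, Sg.chartMap c x)) hb _ _).trans ?_
  change (chartPatch M c).sigma _ (0, (coordVec c (Sg.proj x) (Sg.dGraph u x a)).2)
    (0, (coordVec c (Sg.proj x) (Sg.dGraph u x b)).2) = _
  rw [coordVec_dGraph hu hc, coordVec_dGraph hu hc]

theorem sq_mfderiv_lt_sigmaPull (hc : Sg.proj x ∈ (extChartAt (𝓡 m) c).source)
    {a : EuclideanSpace ℝ (Fin m)} (ha : a ≠ 0) :
    (differential u x a) ^ 2 < Sg.sigmaPull u x a a := by
  have hb : Sg.chartMap c x ∈ (chartPatch M c).base := (extChartAt (𝓡 m) c).map_source hc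
  have hg := (chartPatch M c).isInner_sigma (p := (u x, Sg.chartMap c x)) hb
    (injective_chartDeriv hc)
  have hh : ∀ a b : EuclideanSpace ℝ (Fin m), Sg.sigmaPull u x a b = _ :=
    fun a b ↦ sigmaPull_eq hu hc a b
  have h1 := sq_mfderiv_le_gradSq hg hh u a
  have h2 := hu.spacelike x
  exact h1.trans_lt ((mul_lt_of_lt_one_left (hg.pos a ha) h2).trans_eq (hh a a).symm)

end SpacelikeHypersurface

namespace SpacelikeHypersurface

variable {m : ℕ} [NeZero m] {S : Type*} [TopologicalSpace S]
  [ChartedSpace (EuclideanSpace ℝ (Fin m)) S] [IsManifold (𝓡 m) ∞ S] {M : SplitMetric m S}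
  {N : Type*} [TopologicalSpace N] [ChartedSpace (EuclideanHalfSpace m) N]
  [IsManifold (𝓡∂ m) ∞ N] [Nonempty N] {Sg : SpacelikeHypersurface M N} {u : N → ℝ}

/-- The graph of an admissible height function in the chart of `S` centred at `c`. -/
def localGraph (hu : Sg.IsSpacelikeHeight u) (c : S) : (chartPatch M c).Graph where
  dom := Sg.shadow c
  isOpen_dom := Sg.isOpen_shadow c
  dom_subset := Sg.shadow_subset c
  height := Sg.inChart u c
  smooth := by
    rintro _ ⟨x, hx, hc, rfl⟩
    exact contDiffAt_inChart hx hc le_rfl (hu.smooth x)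
  spacelike := by
    rintro _ ⟨x, hx, hc, rfl⟩ a ha
    obtain ⟨e, he⟩ := exists_chartDeriv_equiv hc
    obtain ⟨v, rfl⟩ : ∃ v, Sg.chartDeriv c x v = a := ⟨e.symm a, by simp [← he]⟩
    have hv : v ≠ 0 := by rintro rfl; simp at ha
    rw [fderiv_inChart_eq_differential hx hc ((hu.smooth x).of_le (by simp)), inChart_chartMap hc]
    have := sq_mfderiv_lt_sigmaPull hu hc hv
    rwa [sigmaPull_eq hu hc] at this

section LocalGraph

variable (hu : Sg.IsSpacelikeHeight u) {c : S} {x : N}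
  (hx : x ∈ (𝓡∂ m).interior N) (hc : Sg.proj x ∈ (extChartAt (𝓡 m) c).source)
include hx hc

theorem chartMap_mem_dom : Sg.chartMap c x ∈ (localGraph hu c).dom := ⟨x, hx, hc, rfl⟩

omit hx in
theorem localGraph_pt : (localGraph hu c).pt (Sg.chartMap c x) = (u x, Sg.chartMap c x) :=
  Prod.ext (inChart_chartMap hc u) rfl

theorem localGraph_dPt (v : EuclideanSpace ℝ (Fin m)) :
    (localGraph hu c).dPt (Sg.chartMap c x) (Sg.chartDeriv c x v) =
      coordVec c (Sg.proj x) (Sg.dGraph u x v) := by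
  rw [coordVec_dGraph hu hc, SplitPatch.Graph.dPt_apply]
  exact Prod.ext (fderiv_inChart_eq_differential hx hc ((hu.smooth x).of_le (by simp)) v) rfl

omit hx in
theorem metric_eq_localGraph (v w : SplitVec m) : M.metric (Sg.graphMap u x) v w =
    (chartPatch M c).metric ((localGraph hu c).pt (Sg.chartMap c x)) (coordVec c (Sg.proj x) v)
      (coordVec c (Sg.proj x) w) := by
  rw [localGraph_pt hu hc]
  exact metric_eq_coord M (p := Sg.graphMap u x) hc v w

theorem inducedMetric_eq (a b : EuclideanSpace ℝ (Fin m)) : Sg.inducedMetric u x a b =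
    (localGraph hu c).ind (Sg.chartMap c x) (Sg.chartDeriv c x a) (Sg.chartDeriv c x b) := by
  rw [SplitPatch.Graph.ind_apply, localGraph_dPt hu hx hc, localGraph_dPt hu hx hc]
  exact metric_eq_localGraph hu hc _ _

omit hx in
theorem observer_eq_localGraph (v : SplitVec m) :
    M.metric (Sg.graphMap u x) (M.observer (Sg.graphMap u x)) v =
      (M.lapse (Sg.graphMap u x))⁻¹ * (chartPatch M c).metric
        ((localGraph hu c).pt (Sg.chartMap c x)) (1, 0) (coordVec c (Sg.proj x) v) := by
  refine (metric_eq_localGraph hu hc _ _).trans ?_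
  have h : coordVec c (Sg.proj x) (M.observer (Sg.graphMap u x)) =
      (M.lapse (Sg.graphMap u x))⁻¹ • ((1, 0) : SplitVec m) := by
    refine Prod.ext ?_ ?_
    · simp [splitChangeDeriv, SplitMetric.observer]
    · simp [splitChangeDeriv, SplitMetric.observer]
  rw [h, map_smul, smul_apply, smul_eq_mul]

theorem isFutureUnitNormal_iff (n : SplitVec m) : Sg.IsFutureUnitNormal u x n ↔
    coordVec c (Sg.proj x) n = (localGraph hu c).normal (Sg.chartMap c x) := by
  have hd := chartMap_mem_dom hu hx hc
  have hobs := observer_eq_localGraph hu hc n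
  have hpos := inv_pos.2 (M.lapse_pos (Sg.graphMap u x))
  have hn := metric_eq_localGraph hu hc n n
  have hv := fun v ↦ metric_eq_localGraph hu hc (Sg.dGraph u x v) n
  obtain ⟨e, he⟩ := exists_chartDeriv_equiv hc
  have hv' : (∀ v, M.metric _ (Sg.dGraph u x v) n = 0) ↔ ∀ b, (chartPatch M c).metric
      ((localGraph hu c).pt (Sg.chartMap c x)) ((localGraph hu c).dPt (Sg.chartMap c x) b)
      (coordVec c (Sg.proj x) n) = 0 := by
    constructor
    · intro h b
      obtain ⟨v, rfl⟩ : ∃ v, Sg.chartDeriv c x v = b := ⟨e.symm b, by simp [← he]⟩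
      rw [localGraph_dPt hu hx hc]
      exact (hv v).symm.trans (h v)
    · intro h v
      refine (hv v).trans (Eq.trans ?_ (h (Sg.chartDeriv c x v)))
      exact congrArg (fun w ↦ (chartPatch M c).metric _ w _) (localGraph_dPt hu hx hc v).symm
  have ho : M.metric (Sg.graphMap u x) (M.observer (Sg.graphMap u x)) n < 0 ↔
      (chartPatch M c).metric
      ((localGraph hu c).pt (Sg.chartMap c x)) (1, 0) (coordVec c (Sg.proj x) n) < 0 := by
    rw [hobs]
    exact smul_neg_iff_of_pos_left hpos
  refine Iff.trans ?_ (SplitPatch.Graph.eq_normal_iff hd (n := coordVec c (Sg.proj x) n)).symm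
  exact and_congr (Eq.congr_left hn) (and_congr hv' ho)

theorem coordVec_unitNormal : coordVec c (Sg.proj x) (Sg.unitNormal u x) =
    (localGraph hu c).normal (Sg.chartMap c x) := by
  refine (isFutureUnitNormal_iff hu hx hc _).1
    (Classical.epsilon_spec (p := Sg.IsFutureUnitNormal u x)
    ⟨(chartVec c (u x, Sg.chartMap c x) ((localGraph hu c).normal (Sg.chartMap c x)) : SplitVec m),
      (isFutureUnitNormal_iff hu hx hc _).2 ?_⟩)
  exact coordVec_chartVec (p := Sg.graphMap u x) hc _

theorem tilt_eq : Sg.tilt u x =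
    (M.lapse (Sg.graphMap u x))⁻¹ * (localGraph hu c).coordTilt (Sg.chartMap c x) := by
  have hd := chartMap_mem_dom hu hx hc
  refine (congrArg Neg.neg (observer_eq_localGraph hu hc (Sg.unitNormal u x))).trans ?_
  rw [coordVec_unitNormal hu hx hc, SplitPatch.Graph.metric_time_normal hd]
  ring

end LocalGraph

end SpacelikeHypersurface

/-! ### The second fundamental form in the charts of `S` -/

namespace SpacelikeHypersurface

variable {m : ℕ} [NeZero m] {S : Type*} [TopologicalSpace S]
  [ChartedSpace (EuclideanSpace ℝ (Fin m)) S] [IsManifold (𝓡 m) ∞ S] {M : SplitMetric m S}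
  {N : Type*} [TopologicalSpace N] [ChartedSpace (EuclideanHalfSpace m) N]
  [IsManifold (𝓡∂ m) ∞ N] [Nonempty N] {Sg : SpacelikeHypersurface M N} {u : N → ℝ}

section GraphMap

variable (hu : Sg.IsSpacelikeHeight u) {x : N} (hx : x ∈ (𝓡∂ m).interior N)

theorem writtenInExtChartAt_graphMap (u : N → ℝ) (x : N) (z : EuclideanSpace ℝ (Fin m)) :
    writtenInExtChartAt (𝓡∂ m) (splitModel m) x (Sg.graphMap u) z =
      (u ((extChartAt (𝓡∂ m) x).symm z),
        extChartAt (𝓡 m) (Sg.proj x) (Sg.proj ((extChartAt (𝓡∂ m) x).symm z))) :=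
  extChartAt_split_apply (u x) (Sg.proj x) (Sg.graphMap u ((extChartAt (𝓡∂ m) x).symm z))

include hx in
theorem fderivWithin_range_eq {F : Type*} [NormedAddCommGroup F] [NormedSpace ℝ F]
    (f : EuclideanSpace ℝ (Fin m) → F) : fderivWithin ℝ f (range (𝓡∂ m)) =ᶠ[
      𝓝 (extChartAt (𝓡∂ m) x x)] fderiv ℝ f := by
  have h := range_mem_nhds_of_interior (I := 𝓡∂ m) hx (mem_extChartAt_source x)
  filter_upwards [eventually_mem_nhds_iff.2 h] with y hy
  exact fderivWithin_of_mem_nhds hy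

include hu hx

theorem contDiffAt_writtenInExtChartAt_graphMap :
    ContDiffAt ℝ 2 (writtenInExtChartAt (𝓡∂ m) (splitModel m) x (Sg.graphMap u))
      (extChartAt (𝓡∂ m) x x) := by
  have h1 := contDiffAt_comp_chart_symm (n := 2) hx (mem_extChartAt_source x)
    (by simpa using ENat.LEInfty.out) ((hu.smooth x).of_le (by simpa using ENat.LEInfty.out))
  have h2 := contDiffAt_comp_chart_symm (n := 2) hx (mem_extChartAt_source x)
    (by simpa using ENat.LEInfty.out) ((contMDiffAt_chartMap (Sg := Sg) (c := Sg.proj x) (x := x)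
      (mem_extChartAt_source _)).of_le (by simpa using ENat.LEInfty.out))
  refine (h1.prodMk h2).congr_of_eventuallyEq (Eventually.of_forall fun z ↦ ?_)
  exact writtenInExtChartAt_graphMap u x z

/-- The normal component of the connection, which is defined in the charts centred at the point, can
be computed in every chart of `S` around the point. -/
theorem connNormal_eq_cov {c : S} (hc : Sg.proj x ∈ (extChartAt (𝓡 m) c).source)
    (a b : EuclideanSpace ℝ (Fin m)) : Sg.connNormal u x a b =
      (chartPatch M c).metric ((localGraph hu c).pt (Sg.chartMap c x))
        ((localGraph hu c).cov (fun y ↦ (localGraph hu c).dPt y (Sg.chartDeriv c x b))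
          (Sg.chartMap c x) (Sg.chartDeriv c x a))
        ((localGraph hu c).normal (Sg.chartMap c x)) := by
  have hd := chartMap_mem_dom hu hx hc
  have hbase := SplitPatch.Graph.mem_base hd
  set A := chartPatch M c
  set w := localGraph hu c
  set z := extChartAt (𝓡∂ m) x x with hz
  set f₁ := writtenInExtChartAt (𝓡∂ m) (splitModel m) x (Sg.graphMap u) with hf₁
  set y := Sg.proj x with hy
  set K : SplitVec m → SplitVec m := splitChange y c with hK
  set θ := Sg.chartMap c ∘ (extChartAt (𝓡∂ m) x).symm with hθ
  have hθz : θ z = Sg.chartMap c x := congrArg (Sg.chartMap c) (extChartAt_to_inv x)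
  have hf₁z : f₁ z = (u x, extChartAt (𝓡 m) y y) := by
    rw [hf₁, writtenInExtChartAt_graphMap, extChartAt_to_inv]
  have hq : (f₁ z).2 ∈ (extChartAt (𝓡 m) y).target := by
    rw [hf₁z]; exact mem_extChartAt_target y
  have hqs : (extChartAt (𝓡 m) y).symm (f₁ z).2 = y := by
    rw [hf₁z]; exact extChartAt_to_inv y
  have hq' : (extChartAt (𝓡 m) y).symm (f₁ z).2 ∈ (extChartAt (𝓡 m) c).source := by
    rw [hqs]; exact hc
  have hKz : K (f₁ z) = w.pt (Sg.chartMap c x) := by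
    rw [localGraph_pt hu hc, hK, splitChange, hqs, hf₁z]; rfl
  have hK' : fderiv ℝ K (f₁ z) = coordVec c y := by
    rw [(hasFDerivAt_splitChange hq hq').fderiv, hqs]
  have hθ' : fderiv ℝ θ z = Sg.chartDeriv c x := (hasFDerivAt_chartMap hx hc).fderiv
  have hpt' : fderiv ℝ w.pt =ᶠ[𝓝 (θ z)] w.dPt := by
    rw [hθz]
    exact (SplitPatch.Graph.eventually_mem_dom hd).mono fun p hp ↦
      (SplitPatch.Graph.hasFDerivAt_pt hp).fderiv
  have hh : ∀ᶠ p in 𝓝 (f₁ z), ∀ a b,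
      formInChart (splitModel m) M.metric (Sg.graphMap u x) p a b =
        A.metric (K p) (fderiv ℝ K p a) (fderiv ℝ K p b) := by
    filter_upwards [eventually_splitChange hq hq'] with p hp a b
    rw [(hasFDerivAt_splitChange hp.1 hp.2).fderiv, splitChange_metric M hp.1 hp.2]
    exact formInChart_metric M (u x) hp.1 a b
  have hfK : w.pt ∘ θ =ᶠ[𝓝 z] K ∘ f₁ := by
    filter_upwards [eventually_chart hx hc,
      eventually_chart (c := y) hx (mem_extChartAt_source y)] with p hp hp'
    rw [Function.comp_apply, Function.comp_apply, hθ, Function.comp_apply, localGraph_pt hu hp.2,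
      hf₁, writtenInExtChartAt_graphMap, hK, splitChange, (extChartAt (𝓡 m) y).left_inv hp'.2]
    rfl
  have hN := coordVec_unitNormal hu hx hc
  have key := connection_invariant (G₂ := A.metric) (K := K) (θ := θ) (f₁ := f₁) (f₂ := w.pt)
    (z := z) (h := formInChart (splitModel m) M.metric (Sg.graphMap u x))
    (n := Sg.unitNormal u x)
    (by rw [hKz]; exact (SplitPatch.contDiffAt_metric hbase).differentiableAt (by simp))
    (by rw [hKz]; exact SplitPatch.isInvertible_metric hbase)
    (by rw [hKz]; exact SplitPatch.eventually_metric_symm hbase)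
    ((contDiffAt_splitChange hq hq').of_le (by simpa using ENat.LEInfty.out)) hh
    (contDiffAt_writtenInExtChartAt_graphMap hu hx)
    ((contDiffAt_comp_chart_symm hx (mem_extChartAt_source x) le_rfl
      (contMDiffAt_chartMap hc)).of_le (by simpa using ENat.LEInfty.out))
    (by rw [hθz]; exact (SplitPatch.Graph.contDiffAt_pt hd).of_le
          (by simpa using ENat.LEInfty.out)) hfK
    (by
      intro v
      rw [hKz, hK', hpt'.self_of_nhds, hθz]
      exact (congrArg _ hN).trans (SplitPatch.Graph.metric_dPt_normal hd v)) a b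
  have e1 : fderivWithin ℝ f₁ (range (𝓡∂ m)) z = fderiv ℝ f₁ z :=
    (fderivWithin_range_eq hx f₁).self_of_nhds
  have e2 : fderivWithin ℝ (fun y ↦ fderivWithin ℝ f₁ (range (𝓡∂ m)) y b) (range (𝓡∂ m)) z =
      fderiv ℝ (fun y ↦ fderiv ℝ f₁ y b) z := by
    rw [(fderivWithin_range_eq hx _).self_of_nhds]
    refine Filter.EventuallyEq.fderiv_eq ?_
    exact (fderivWithin_range_eq hx f₁).mono fun p hp ↦ congrArg (fun l ↦ l b) hp
  have e3 : ∀ v : SplitVec m, M.metric (Sg.graphMap u x) v (Sg.unitNormal u x) =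
      formInChart (splitModel m) M.metric (Sg.graphMap u x) (f₁ z) v (Sg.unitNormal u x) := by
    intro v
    refine (metric_eq_localGraph hu hc v _).trans ?_
    have e5 := hh.self_of_nhds v (Sg.unitNormal u x)
    rw [hKz, hK'] at e5
    exact e5.symm
  have e4 : fderiv ℝ (fun y ↦ fderiv ℝ w.pt y (fderiv ℝ θ z b)) (θ z) =
      fderiv ℝ (fun y ↦ w.dPt y (Sg.chartDeriv c x b)) (Sg.chartMap c x) := by
    rw [hθ', ← hθz]
    refine Filter.EventuallyEq.fderiv_eq ?_
    exact hpt'.mono fun p hp ↦ congrArg (fun l ↦ l (Sg.chartDeriv c x b)) hp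
  rw [e4, hKz, hK', hpt'.self_of_nhds, hθz, hθ'] at key
  refine Eq.trans ?_ (key.trans ?_)
  · change M.metric (Sg.graphMap u x) (fderivWithin ℝ
      (fun y ↦ fderivWithin ℝ f₁ (range (𝓡∂ m)) y b) (range (𝓡∂ m)) z a) (Sg.unitNormal u x) +
      christoffel (splitModel m) M.metric (Sg.graphMap u x) (f₁ z)
        (fderivWithin ℝ f₁ (range (𝓡∂ m)) z a) (fderivWithin ℝ f₁ (range (𝓡∂ m)) z b)
        (Sg.unitNormal u x) = _
    rw [e1, e2]
    exact congrArg (· + _) (e3 _)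
  · rw [SplitPatch.Graph.cov_apply]
    exact congrArg _ hN

theorem secondFF_eq {c : S} (hc : Sg.proj x ∈ (extChartAt (𝓡 m) c).source)
    (a b : EuclideanSpace ℝ (Fin m)) : Sg.secondFF u x a b = (localGraph hu c).ind (Sg.chartMap c x)
      ((localGraph hu c).shape (Sg.chartMap c x) (Sg.chartDeriv c x a)) (Sg.chartDeriv c x b) := by
  rw [secondFF, connNormal_eq_cov hu hx hc,
    SplitPatch.Graph.ind_shape_eq (chartMap_mem_dom hu hx hc)]

theorem exists_isInner {c : S} (hc : Sg.proj x ∈ (extChartAt (𝓡 m) c).source) :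
    ∃ g : EuclideanSpace ℝ (Fin m) →L[ℝ] EuclideanSpace ℝ (Fin m) →L[ℝ] ℝ, IsInner g ∧
      ∀ a b, g a b = (localGraph hu c).ind (Sg.chartMap c x) (Sg.chartDeriv c x a)
        (Sg.chartDeriv c x b) :=
  ⟨((localGraph hu c).ind (Sg.chartMap c x)).bilinearComp (Sg.chartDeriv c x)
    (Sg.chartDeriv c x), ⟨fun _ _ ↦ SplitPatch.Graph.ind_symm (chartMap_mem_dom hu hx hc) _ _,
      fun _ ha ↦ SplitPatch.Graph.ind_pos (chartMap_mem_dom hu hx hc)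
        ((map_ne_zero_iff _ (injective_chartDeriv hc)).2 ha)⟩, fun _ _ ↦ rfl⟩

/-- The second fundamental form is `g (S' ·, ·)`, where `S'` is conjugate to the shape operator of
the graph in the chart of `S`. -/
theorem exists_conj_shape {c : S} (hc : Sg.proj x ∈ (extChartAt (𝓡 m) c).source) :
    ∃ e : EuclideanSpace ℝ (Fin m) ≃L[ℝ] EuclideanSpace ℝ (Fin m),
      (gram (Sg.inducedMetric u) x x)⁻¹ * Sg.secondFFMatrix u x =
        opMatrix ((e.symm : EuclideanSpace ℝ (Fin m) →L[ℝ] EuclideanSpace ℝ (Fin m)) ∘L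
          (localGraph hu c).shape (Sg.chartMap c x) ∘L e) ∧
      (Sg.secondFFMatrix u x).transpose = Sg.secondFFMatrix u x := by
  obtain ⟨e, he⟩ := exists_chartDeriv_equiv hc
  have hd := chartMap_mem_dom hu hx hc
  refine ⟨e, ?_, ?_⟩
  · obtain ⟨g, hg, hgi⟩ := exists_isInner hu hx hc
    rw [gram_self_eq (g := g) fun a b ↦ (inducedMetric_eq hu hx hc a b).trans (hgi a b).symm]
    refine hg.inv_mul_eq_opMatrix fun i j ↦ ?_
    have h1 : ∀ v, Sg.chartDeriv c x (e.symm v) = v := fun v ↦ by simp [← he]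
    have h2 : ∀ v, e v = Sg.chartDeriv c x v := fun v ↦ by simp [← he]
    rw [secondFFMatrix, Matrix.of_apply, secondFF_eq hu hx hc, hgi,
      SplitPatch.Graph.ind_shape_symm hd, SplitPatch.Graph.ind_symm hd]
    simp only [ContinuousLinearMap.comp_apply, ContinuousLinearEquiv.coe_coe, h1, h2]
  · ext i j
    rw [Matrix.transpose_apply, secondFFMatrix, Matrix.of_apply, Matrix.of_apply,
      secondFF_eq hu hx hc, secondFF_eq hu hx hc, SplitPatch.Graph.ind_shape_symm hd]

theorem meanCurvature_eq {c : S} (hc : Sg.proj x ∈ (extChartAt (𝓡 m) c).source) :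
    Sg.meanCurvature u x = (localGraph hu c).meanCurv (Sg.chartMap c x) := by
  obtain ⟨e, h1, -⟩ := exists_conj_shape hu hx hc
  rw [meanCurvature, h1, trace_opMatrix, traceL_comp_comm, ContinuousLinearMap.comp_assoc]
  simp [SplitPatch.Graph.meanCurv]

theorem secondFFSq_eq {c : S} (hc : Sg.proj x ∈ (extChartAt (𝓡 m) c).source) :
    Sg.secondFFSq u x = (localGraph hu c).shapeSq (Sg.chartMap c x) := by
  obtain ⟨e, h1, h2⟩ := exists_conj_shape hu hx hc
  rw [secondFFSq, h2, Matrix.mul_assoc, h1, ← opMatrix_comp, trace_opMatrix,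
    SplitPatch.Graph.shapeSq]
  set Sh := (localGraph hu c).shape (Sg.chartMap c x)
  have h3 : ((e.symm : EuclideanSpace ℝ (Fin m) →L[ℝ] EuclideanSpace ℝ (Fin m)) ∘L Sh ∘L e) ∘L
      ((e.symm : EuclideanSpace ℝ (Fin m) →L[ℝ] EuclideanSpace ℝ (Fin m)) ∘L Sh ∘L e) =
      (e.symm : EuclideanSpace ℝ (Fin m) →L[ℝ] EuclideanSpace ℝ (Fin m)) ∘L
        (Sh ∘L Sh ∘L (e : EuclideanSpace ℝ (Fin m) →L[ℝ] EuclideanSpace ℝ (Fin m))) := by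
    ext v; simp
  rw [h3, traceL_comp_comm]
  congr 1
  ext v; simp

end GraphMap

end SpacelikeHypersurface

/-! ### The Riemannian volume in the charts of `S` -/

theorem measurableSet_inter_preimage {X Y : Type*} [TopologicalSpace X] [MeasurableSpace X]
    [BorelSpace X] [TopologicalSpace Y] [MeasurableSpace Y] [BorelSpace Y] {f : X → Y} {s : Set X}
    (hf : ContinuousOn f s) (hs : MeasurableSet s) {A : Set Y} (hA : MeasurableSet A) :
    MeasurableSet (s ∩ f ⁻¹' A) := by
  have h : s ∩ f ⁻¹' A = Subtype.val '' (s.domRestrict f ⁻¹' A) := by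
    ext x; simp [and_comm]
  rw [h]
  exact hs.subtype_image ((continuousOn_iff_continuous_domRestrict.1 hf).measurable hA)

section Determinants

variable {m : ℕ}

theorem det_opMatrix (f : EuclideanSpace ℝ (Fin m) →L[ℝ] EuclideanSpace ℝ (Fin m)) :
    (opMatrix f).det = f.det := by
  have h : opMatrix f = LinearMap.toMatrix (EuclideanSpace.basisFun (Fin m) ℝ).toBasis
      (EuclideanSpace.basisFun (Fin m) ℝ).toBasis (f : EuclideanSpace ℝ (Fin m) →ₗ[ℝ] _) := by
    ext i j
    rw [LinearMap.toMatrix_apply]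
    simp [opMatrix]
  rw [h, LinearMap.det_toMatrix]

theorem formMatrix_bilinearComp
    (g : EuclideanSpace ℝ (Fin m) →L[ℝ] EuclideanSpace ℝ (Fin m) →L[ℝ] ℝ)
    (f : EuclideanSpace ℝ (Fin m) →L[ℝ] EuclideanSpace ℝ (Fin m)) :
    (Matrix.of fun i j ↦ g (f (EuclideanSpace.single i 1)) (f (EuclideanSpace.single j 1))) =
      (opMatrix f).transpose * (formMatrix g * opMatrix f) := by
  rw [formMatrix_mul_opMatrix]
  ext i j
  rw [Matrix.of_apply]
  conv_lhs => rw [← sum_apply_smul_single (f (EuclideanSpace.single i 1))]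
  simp [Matrix.mul_apply, opMatrix]

theorem sqrt_det_bilinearComp
    (g : EuclideanSpace ℝ (Fin m) →L[ℝ] EuclideanSpace ℝ (Fin m) →L[ℝ] ℝ)
    (f : EuclideanSpace ℝ (Fin m) →L[ℝ] EuclideanSpace ℝ (Fin m)) :
    √(Matrix.of fun i j ↦ g (f (EuclideanSpace.single i 1)) (f (EuclideanSpace.single j 1))).det =
      |f.det| * √(formMatrix g).det := by
  rw [formMatrix_bilinearComp, Matrix.det_mul, Matrix.det_mul, Matrix.det_transpose, det_opMatrix,
    show f.det * ((formMatrix g).det * f.det) = f.det ^ 2 * (formMatrix g).det by ring,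
    Real.sqrt_mul (sq_nonneg _), Real.sqrt_sq_eq_abs]

end Determinants

section ChartVolume

variable {m : ℕ} [NeZero m] {N : Type*} [TopologicalSpace N]
  [ChartedSpace (EuclideanHalfSpace m) N] [IsManifold (𝓡∂ m) ∞ N] [MeasurableSpace N] [BorelSpace N]
  (h : ∀ x : N, TangentSpace (𝓡∂ m) x → TangentSpace (𝓡∂ m) x → ℝ)

/-- The contribution of the chart centred at `d` to the volume measure. -/
def chartVolume (d : N) : Measure N :=
  (((volume : Measure (EuclideanSpace ℝ (Fin m))).restrict
    (extChartAt (𝓡∂ m) d).target).withDensity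
      (fun z ↦ ENNReal.ofReal (√ (gram h d ((extChartAt (𝓡∂ m) d).symm z)).det))).map
        (extChartAt (𝓡∂ m) d).symm

theorem volumeMeasure_eq : volumeMeasure h = ⨆ d, chartVolume h d := rfl

omit [MeasurableSpace N] [BorelSpace N] in
theorem measurableSet_extChartAt_target (d : N) :
    MeasurableSet (extChartAt (𝓡∂ m) d).target := by
  rw [extChartAt_target]
  exact (((chartAt _ d).open_target.preimage (𝓡∂ m).continuous_symm).measurableSet).inter
    (𝓡∂ m).isClosed_range.measurableSet

theorem chartVolume_apply (d : N) {A : Set N} (hA : MeasurableSet A) : chartVolume h d A =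
    ∫⁻ z in (extChartAt (𝓡∂ m) d).target ∩ (extChartAt (𝓡∂ m) d).symm ⁻¹' A,
      ENNReal.ofReal (√ (gram h d ((extChartAt (𝓡∂ m) d).symm z)).det) := by
  have ht := measurableSet_extChartAt_target (m := m) d
  have hm : AEMeasurable (extChartAt (𝓡∂ m) d).symm
      ((volume : Measure (EuclideanSpace ℝ (Fin m))).restrict (extChartAt (𝓡∂ m) d).target) :=
    (continuousOn_extChartAt_symm d).aemeasurable ht
  rw [chartVolume, Measure.map_apply_of_aemeasurable
    (hm.mono_ac (withDensity_absolutelyContinuous _ _)) hA, withDensity_apply',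
    Measure.restrict_restrict' ht, inter_comm]

end ChartVolume

namespace SpacelikeHypersurface

variable {m : ℕ} [NeZero m] {S : Type*} [TopologicalSpace S]
  [ChartedSpace (EuclideanSpace ℝ (Fin m)) S] [IsManifold (𝓡 m) ∞ S] {M : SplitMetric m S}
  {N : Type*} [TopologicalSpace N] [ChartedSpace (EuclideanHalfSpace m) N]
  [IsManifold (𝓡∂ m) ∞ N] [Nonempty N] [MeasurableSpace N] [BorelSpace N]
  (Sg : SpacelikeHypersurface M N) {u : N → ℝ} (hu : Sg.IsSpacelikeHeight u) (c : S)

/-- The interior points of the hypersurface whose projection lies in the chart centred at `c`. -/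
def tile (c : S) : Set N := (𝓡∂ m).interior N ∩ Sg.proj ⁻¹' (extChartAt (𝓡 m) c).source

omit [Nonempty N] [MeasurableSpace N] [BorelSpace N] in
theorem isOpen_tile : IsOpen (Sg.tile c) :=
  (ModelWithCorners.isOpen_interior (I := 𝓡∂ m) (M := N) (n := ∞) (by simp)).inter
    ((isOpen_extChartAt_source c).preimage Sg.contMDiff_proj.continuous)

variable {Sg}

omit [MeasurableSpace N] [BorelSpace N] in
theorem continuousOn_lift :
    ContinuousOn (fun z ↦ Sg.lift ((extChartAt (𝓡 m) c).symm z)) (Sg.shadow c) := by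
  rintro _ ⟨x, hx, hc, rfl⟩
  have h := tendsto_lift hx hc
  rw [ContinuousWithinAt, Sg.lift_chartMap hc]
  exact h.mono_left nhdsWithin_le_nhds

omit [MeasurableSpace N] [BorelSpace N] in
theorem lift_mem_tile {z : EuclideanSpace ℝ (Fin m)} (hz : z ∈ Sg.shadow c) :
    Sg.lift ((extChartAt (𝓡 m) c).symm z) ∈ Sg.tile c ∧
      Sg.chartMap c (Sg.lift ((extChartAt (𝓡 m) c).symm z)) = z := by
  obtain ⟨x, hx, hc, rfl⟩ := hz
  rw [Sg.lift_chartMap hc]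
  exact ⟨⟨hx, hc⟩, rfl⟩

/-- The Riemannian volume of the graph over the chart centred at `c`, computed in this chart. -/
def graphVolume : Measure N :=
  (((volume : Measure (EuclideanSpace ℝ (Fin m))).restrict (Sg.shadow c)).withDensity
    (fun z ↦ ENNReal.ofReal ((localGraph hu c).dens z))).map
      (fun z ↦ Sg.lift ((extChartAt (𝓡 m) c).symm z))

theorem aemeasurable_lift : AEMeasurable (fun z ↦ Sg.lift ((extChartAt (𝓡 m) c).symm z))
    (((volume : Measure (EuclideanSpace ℝ (Fin m))).restrict (Sg.shadow c)).withDensity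
      (fun z ↦ ENNReal.ofReal ((localGraph hu c).dens z))) :=
  ((continuousOn_lift c).aemeasurable (Sg.isOpen_shadow c).measurableSet).mono_ac
    (withDensity_absolutelyContinuous _ _)

theorem graphVolume_apply {A : Set N} (hA : MeasurableSet A) : graphVolume hu c A =
    ∫⁻ z in Sg.shadow c ∩ (fun z ↦ Sg.lift ((extChartAt (𝓡 m) c).symm z)) ⁻¹' A,
      ENNReal.ofReal ((localGraph hu c).dens z) := by
  rw [graphVolume, Measure.map_apply_of_aemeasurable (aemeasurable_lift hu c) hA,
    withDensity_apply', Measure.restrict_restrict' (Sg.isOpen_shadow c).measurableSet, inter_comm]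

omit [MeasurableSpace N] [BorelSpace N] in
theorem gram_inducedMetric_eq {c : S} {x d : N} (hx : x ∈ Sg.tile c) :
    √ (gram (Sg.inducedMetric u) d x).det =
      |(Sg.chartDeriv c x ∘L tangentCoordChange (𝓡∂ m) d x x).det| *
        (localGraph hu c).dens (Sg.chartMap c x) := by
  refine Eq.trans ?_ (sqrt_det_bilinearComp _ _)
  congr 2
  ext i j
  exact inducedMetric_eq hu hx.1 hx.2 _ _

/-- The volume in a chart of the hypersurface agrees with that in a chart of `S`. -/
theorem chartVolume_eq_graphVolume (d : N) {A : Set N} (hA : MeasurableSet A)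
    (hAc : A ⊆ Sg.tile c) (hAd : A ⊆ (extChartAt (𝓡∂ m) d).source) :
    chartVolume (Sg.inducedMetric u) d A = graphVolume hu c A := by
  rw [chartVolume_apply _ d hA, graphVolume_apply hu c hA]
  set B := (extChartAt (𝓡∂ m) d).target ∩ (extChartAt (𝓡∂ m) d).symm ⁻¹' A with hBdef
  set θ := Sg.chartMap c ∘ (extChartAt (𝓡∂ m) d).symm with hθ
  let θ' : EuclideanSpace ℝ (Fin m) → EuclideanSpace ℝ (Fin m) →L[ℝ] EuclideanSpace ℝ (Fin m) :=
    fun z ↦ Sg.chartDeriv c ((extChartAt (𝓡∂ m) d).symm z) ∘L tangentCoordChange (𝓡∂ m) d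
      ((extChartAt (𝓡∂ m) d).symm z) ((extChartAt (𝓡∂ m) d).symm z)
  have hB : MeasurableSet B := measurableSet_inter_preimage (continuousOn_extChartAt_symm d)
    (measurableSet_extChartAt_target d) hA
  have himg : Sg.shadow c ∩ (fun z ↦ Sg.lift ((extChartAt (𝓡 m) c).symm z)) ⁻¹' A = θ '' B := by
    ext z
    constructor
    · rintro ⟨hz, hzA⟩
      have h1 := (lift_mem_tile c hz).2
      set x := Sg.lift ((extChartAt (𝓡 m) c).symm z)
      have h2 := (extChartAt (𝓡∂ m) d).left_inv (hAd hzA)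
      refine ⟨extChartAt (𝓡∂ m) d x, ⟨(extChartAt (𝓡∂ m) d).map_source (hAd hzA), ?_⟩, ?_⟩
      · rw [mem_preimage, h2]; exact hzA
      · rw [hθ, Function.comp_apply, h2, h1]
    · rintro ⟨w, ⟨hw, hwA⟩, rfl⟩
      have h1 := hAc hwA
      refine ⟨⟨_, h1.1, h1.2, rfl⟩, ?_⟩
      simp only [mem_preimage, hθ, Function.comp_apply, Sg.lift_chartMap h1.2]
      exact hwA
  have hderiv : ∀ z ∈ B, HasFDerivWithinAt θ (θ' z) B z := by
    rintro z ⟨hz, hzA⟩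
    have h1 := hAc hzA
    have h2 := hasFDerivAt_comp_chart_symm h1.1 ((extChartAt (𝓡∂ m) d).map_target hz)
      ((contMDiffAt_chartMap h1.2).mdifferentiableAt (by simp))
    rw [(extChartAt (𝓡∂ m) d).right_inv hz] at h2
    exact h2.hasFDerivWithinAt
  have hinj : InjOn θ B := by
    rintro z ⟨hz, hzA⟩ w ⟨hw, hwA⟩ hzw
    have h1 := hAc hzA
    have h2 := hAc hwA
    simp only [hθ, Function.comp_apply] at hzw
    have h3 := Sg.lift_chartMap h1.2
    rw [hzw, Sg.lift_chartMap h2.2] at h3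
    exact (extChartAt (𝓡∂ m) d).symm.injOn hz hw h3.symm
  rw [himg, lintegral_image_eq_lintegral_abs_det_fderiv_mul volume hB hderiv hinj]
  refine setLIntegral_congr_fun hB fun z hz ↦ ?_
  rw [gram_inducedMetric_eq hu (hAc hz.2), ENNReal.ofReal_mul (abs_nonneg _)]
  rfl

theorem chartVolume_le_graphVolume (d : N) {A : Set N} (hA : MeasurableSet A)
    (hAc : A ⊆ Sg.tile c) : chartVolume (Sg.inducedMetric u) d A ≤ graphVolume hu c A := by
  have hs : MeasurableSet (extChartAt (𝓡∂ m) d).source := (isOpen_extChartAt_source d).measurableSet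
  have h1 : chartVolume (Sg.inducedMetric u) d A =
      chartVolume (Sg.inducedMetric u) d (A ∩ (extChartAt (𝓡∂ m) d).source) := by
    rw [chartVolume_apply _ d hA, chartVolume_apply _ d (hA.inter hs)]
    congr 2
    ext z
    exact ⟨fun h ↦ ⟨h.1, h.2, (extChartAt (𝓡∂ m) d).map_target h.1⟩, fun h ↦ ⟨h.1, h.2.1⟩⟩
  rw [h1, chartVolume_eq_graphVolume hu c d (hA.inter hs) (inter_subset_left.trans hAc)
    inter_subset_right]
  exact measure_mono inter_subset_left

theorem volumeMeasure_eq_graphVolume (d : N) {A : Set N} (hA : MeasurableSet A)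
    (hAc : A ⊆ Sg.tile c) (hAd : A ⊆ (extChartAt (𝓡∂ m) d).source) :
    volumeMeasure (Sg.inducedMetric u) A = graphVolume hu c A := by
  refine le_antisymm ?_ ?_
  · have ht := (Sg.isOpen_tile c).measurableSet
    -- a measure that dominates every chart volume and equals the graph volume on the tile
    let κ : Measure N := graphVolume hu c + (⊤ : Measure N).restrict (Sg.tile c)ᶜ
    have hκ : volumeMeasure (Sg.inducedMetric u) ≤ κ := by
      rw [volumeMeasure_eq]
      refine iSup_le fun d ↦ Measure.le_iff.2 fun B hB ↦ ?_
      rw [← measure_inter_add_sdiff B ht]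
      refine add_le_add ((chartVolume_le_graphVolume hu c d (hB.inter ht) inter_subset_right).trans
        (measure_mono inter_subset_left)) ?_
      refine ((le_top : chartVolume (Sg.inducedMetric u) d ≤ ⊤) _).trans_eq ?_
      exact (Measure.restrict_apply hB).symm
    refine (hκ A).trans_eq ?_
    have : A ∩ (Sg.tile c)ᶜ = ∅ := by
      rw [← sdiff_eq, sdiff_eq_empty]; exact hAc
    simp [κ, Measure.restrict_apply hA, this]
  · rw [← chartVolume_eq_graphVolume hu c d hA hAc hAd, volumeMeasure_eq]
    exact (le_iSup (chartVolume (Sg.inducedMetric u)) d) A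

/-- On the part of the hypersurface over a chart of `S`, the Riemannian volume of the graph is
given by the density of the graph in this chart. -/
theorem volumeMeasure_restrict_tile [CompactSpace N] :
    (volumeMeasure (Sg.inducedMetric u)).restrict (Sg.tile c) = graphVolume hu c := by
  have ht := (Sg.isOpen_tile c).measurableSet
  have h0 : graphVolume hu c = (graphVolume hu c).restrict (Sg.tile c) := by
    refine (Measure.restrict_eq_self_of_ae_mem ?_).symm
    rw [ae_iff, show {x | ¬x ∈ Sg.tile c} = (Sg.tile c)ᶜ from rfl, graphVolume_apply hu c ht.compl]
    have : Sg.shadow c ∩ (fun z ↦ Sg.lift ((extChartAt (𝓡 m) c).symm z)) ⁻¹' (Sg.tile c)ᶜ = ∅ := by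
      ext z
      simp only [mem_inter_iff, mem_preimage, mem_compl_iff, mem_empty_iff_false, iff_false,
        not_and, not_not]
      exact fun hz ↦ (lift_mem_tile c hz).1
    rw [this, Measure.restrict_empty, lintegral_zero_measure]
  rw [h0]
  obtain ⟨t, ht'⟩ := isCompact_univ.elim_finite_subcover
    (fun d : N ↦ (extChartAt (𝓡∂ m) d).source) (fun d ↦ isOpen_extChartAt_source d)
    (fun x _ ↦ mem_iUnion.2 ⟨x, mem_extChartAt_source x⟩)
  have hcover : Sg.tile c = ⋃ d ∈ t, Sg.tile c ∩ (extChartAt (𝓡∂ m) d).source := by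
    rw [← inter_iUnion₂, inter_eq_left.2 ((subset_univ _).trans ht')]
  rw [hcover, Measure.restrict_biUnion_finset_congr]
  intro d _
  have hs : MeasurableSet (Sg.tile c ∩ (extChartAt (𝓡∂ m) d).source) :=
    ht.inter (isOpen_extChartAt_source d).measurableSet
  refine Measure.ext fun B hB ↦ ?_
  rw [Measure.restrict_apply hB, Measure.restrict_apply hB]
  exact volumeMeasure_eq_graphVolume hu c d (hB.inter hs) (fun x hx ↦ hx.2.1) fun x hx ↦ hx.2.2

end SpacelikeHypersurface

/-! ### Integrals over the hypersurface in the charts of `S` -/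

/-- On a finite-dimensional space an inner product is invertible as a map to the dual. -/
theorem IsInner.isInvertible {E : Type*} [NormedAddCommGroup E] [NormedSpace ℝ E]
    [FiniteDimensional ℝ E] {g : E →L[ℝ] E →L[ℝ] ℝ} (hg : IsInner g) : g.IsInvertible := by
  have hinj : Function.Injective g := (injective_iff_map_eq_zero _).2 fun a ha ↦ by
    by_contra h
    exact (hg.pos a h).ne' (by rw [ha]; rfl)
  have hdim : Module.finrank ℝ E = Module.finrank ℝ (E →L[ℝ] ℝ) := by
    rw [← (LinearMap.toContinuousLinearMap : (E →ₗ[ℝ] ℝ) ≃ₗ[ℝ] E →L[ℝ] ℝ).finrank_eq]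
    exact (Subspace.dual_finrank_eq).symm
  exact ⟨(LinearEquiv.ofInjectiveOfFinrankEq (g : E →ₗ[ℝ] _) hinj hdim).toContinuousLinearEquiv,
    by ext; rfl⟩

namespace SpacelikeHypersurface

variable {m : ℕ} [NeZero m] {S : Type*} [TopologicalSpace S]
  [ChartedSpace (EuclideanSpace ℝ (Fin m)) S] [IsManifold (𝓡 m) ∞ S] {M : SplitMetric m S}
  {N : Type*} [TopologicalSpace N] [ChartedSpace (EuclideanHalfSpace m) N]
  [IsManifold (𝓡∂ m) ∞ N] [Nonempty N] {Sg : SpacelikeHypersurface M N} {u : N → ℝ}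

section Continuity

variable (hu : Sg.IsSpacelikeHeight u) {x : N} (hx : x ∈ (𝓡∂ m).interior N) {c : S}

omit [Nonempty N] in
/-- Continuity is checked in a chart of `S`. -/
theorem continuousAt_of_tile {f : N → ℝ} {F : EuclideanSpace ℝ (Fin m) → ℝ} (hx : x ∈ Sg.tile c)
    (hf : ∀ y ∈ Sg.tile c, f y = F (Sg.chartMap c y)) (hF : ContinuousAt F (Sg.chartMap c x)) :
    ContinuousAt f x :=
  (hF.comp (contMDiffAt_chartMap hx.2).continuousAt).congr
    (mem_of_superset ((Sg.isOpen_tile c).mem_nhds hx) fun y hy ↦ (hf y hy).symm)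

omit [Nonempty N] in
include hx in
theorem mem_tile_self : x ∈ Sg.tile (Sg.proj x) := ⟨hx, mem_extChartAt_source _⟩

/-- The squared norm of the gradient of `η` in a chart of `S`. -/
def chartGradSq (hu : Sg.IsSpacelikeHeight u) (c : S) (η : N → ℝ) (z : EuclideanSpace ℝ (Fin m)) :
    ℝ :=
  fderiv ℝ (Sg.inChart η c) z (((localGraph hu c).ind z).inverse (fderiv ℝ (Sg.inChart η c) z))

theorem gradSq_eq_chart (hc : x ∈ Sg.tile c) {η : N → ℝ}
    (hη : ContMDiffAt (𝓡∂ m) 𝓘(ℝ, ℝ) 1 η x) :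
    gradSq (Sg.inducedMetric u) η x = chartGradSq hu c η (Sg.chartMap c x) := by
  have hd := chartMap_mem_dom hu hc.1 hc.2
  obtain ⟨e, he⟩ := exists_chartDeriv_equiv hc.2
  obtain ⟨g, hg, hgi⟩ := exists_isInner hu hc.1 hc.2
  set D := fderiv ℝ (Sg.inChart η c) (Sg.chartMap c x)
  set w := ((localGraph hu c).ind (Sg.chartMap c x)).inverse D with hw
  have hDw : (localGraph hu c).ind (Sg.chartMap c x) w = D :=
    (SplitPatch.Graph.isInner_ind hd).isInvertible.self_apply_inverse D
  have hew : Sg.chartDeriv c x (e.symm w) = w := by simp [← he]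
  have hD : ∀ a, D (Sg.chartDeriv c x a) = differential η x a :=
    fderiv_inChart_eq_differential hc.1 hc.2 hη
  refine (gradSq_eq hg (fun a b ↦ (inducedMetric_eq hu hc.1 hc.2 a b).trans (hgi a b).symm)
    (w := e.symm w) fun a ↦ ?_).trans ?_
  · rw [hgi, hew, SplitPatch.Graph.ind_symm hd, hDw, hD]
  · rw [← hD, hew]; rfl

include hu hx

theorem continuousAt_secondFFSq : ContinuousAt (Sg.secondFFSq u) x :=
  continuousAt_of_tile (mem_tile_self hx) (fun _ hy ↦ secondFFSq_eq hu hy.1 hy.2)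
    (SplitPatch.Graph.contDiffAt_shapeSq
      (chartMap_mem_dom hu hx (mem_tile_self hx).2)).continuousAt

theorem continuousAt_meanCurvature : ContinuousAt (Sg.meanCurvature u) x :=
  continuousAt_of_tile (mem_tile_self hx) (fun _ hy ↦ meanCurvature_eq hu hy.1 hy.2)
    (SplitPatch.Graph.contDiffAt_meanCurv
      (chartMap_mem_dom hu hx (mem_tile_self hx).2)).continuousAt

theorem continuousAt_tilt : ContinuousAt (Sg.tilt u) x := by
  have h1 : ContinuousAt (fun y ↦ M.lapse (Sg.graphMap u y) * Sg.tilt u y) x := by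
    refine continuousAt_of_tile (mem_tile_self hx) (fun y hy ↦ ?_)
      (SplitPatch.Graph.contDiffAt_coordTilt
        (chartMap_mem_dom hu hx (mem_tile_self hx).2)).continuousAt
    rw [tilt_eq hu hy.1 hy.2, mul_inv_cancel_left₀ (M.lapse_pos _).ne']
  have h2 : ContinuousAt (fun y ↦ M.lapse (Sg.graphMap u y)) x :=
    (M.lapse_smooth.continuous.comp hu.contMDiff_graphMap.continuous).continuousAt
  refine ((h2.inv₀ (M.lapse_pos _).ne').mul h1).congr (Eventually.of_forall fun y ↦ ?_)
  exact inv_mul_cancel_left₀ (M.lapse_pos _).ne' _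

theorem continuousAt_gradSq {η : N → ℝ} (hη : ContMDiff (𝓡∂ m) 𝓘(ℝ, ℝ) 1 η) :
    ContinuousAt (gradSq (Sg.inducedMetric u) η) x := by
  have hc := mem_tile_self (Sg := Sg) hx
  have hd := chartMap_mem_dom hu hx hc.2
  have h1 : ContDiffAt ℝ 1 (Sg.inChart η (Sg.proj x)) (Sg.chartMap (Sg.proj x) x) :=
    contDiffAt_inChart hx hc.2 (by simp) (hη x)
  have h2 : ContinuousAt (fderiv ℝ (Sg.inChart η (Sg.proj x))) (Sg.chartMap (Sg.proj x) x) :=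
    (h1.fderiv_right (m := 0) (by simp)).continuousAt
  have h3 : ContinuousAt (fun z ↦ ((localGraph hu (Sg.proj x)).ind z).inverse)
      (Sg.chartMap (Sg.proj x) x) :=
    ContinuousAt.comp (g := ContinuousLinearMap.inverse) (f := (localGraph hu (Sg.proj x)).ind)
      ((SplitPatch.Graph.isInner_ind hd).isInvertible.contDiffAt_map_inverse (n := 1)).continuousAt
      (SplitPatch.Graph.contDiffAt_ind hd).continuousAt
  exact continuousAt_of_tile hc (fun y hy ↦ gradSq_eq_chart hu hy (hη y))
    (h2.clm_apply (h3.clm_apply h2))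

omit hu hx [Nonempty N] in
theorem gradSq_eq_zero (h : ∀ x : N, TangentSpace (𝓡∂ m) x → TangentSpace (𝓡∂ m) x → ℝ)
    {η : N → ℝ} (hη : x ∉ tsupport η) : gradSq h η x = 0 := by
  have h1 : mfderiv (𝓡∂ m) 𝓘(ℝ, ℝ) η x = 0 := by
    have h2 : η =ᶠ[𝓝 x] fun _ ↦ 0 := notMem_tsupport_iff_eventuallyEq.1 hη
    exact h2.mfderiv_eq.trans mfderiv_const
  have h3 : diffVec (m := m) η x = 0 := by
    ext i; rw [diffVec, h1]; rfl
  rw [gradSq, h3, zero_dotProduct]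

end Continuity

section Integrals

variable [CompactSpace N] [MeasurableSpace N] [BorelSpace N] (hu : Sg.IsSpacelikeHeight u) (c : S)

theorem aemeasurable_dens : AEMeasurable (fun z ↦ ENNReal.ofReal ((localGraph hu c).dens z))
    ((volume : Measure (EuclideanSpace ℝ (Fin m))).restrict (Sg.shadow c)) := by
  refine ENNReal.measurable_ofReal.comp_aemeasurable (ContinuousOn.aemeasurable ?_
    (Sg.isOpen_shadow c).measurableSet)
  exact fun z hz ↦ (SplitPatch.Graph.contDiffAt_dens hz).continuousAt.continuousWithinAt

omit [CompactSpace N] [MeasurableSpace N] [BorelSpace N] in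
theorem dens_nonneg (z : EuclideanSpace ℝ (Fin m)) : 0 ≤ (localGraph hu c).dens z :=
  Real.sqrt_nonneg _

variable {c} {f : N → ℝ} {F : EuclideanSpace ℝ (Fin m) → ℝ}
  (hf : ∀ x ∈ Sg.tile c, f x = F (Sg.chartMap c x))
  (hm : AEStronglyMeasurable f ((volumeMeasure (Sg.inducedMetric u)).restrict (Sg.tile c)))

include hf hm

theorem integrableOn_tile_iff : IntegrableOn f (Sg.tile c) (volumeMeasure (Sg.inducedMetric u)) ↔
    IntegrableOn (fun z ↦ F z * (localGraph hu c).dens z) (Sg.shadow c) := by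
  rw [volumeMeasure_restrict_tile hu c] at hm
  rw [IntegrableOn, volumeMeasure_restrict_tile hu c, graphVolume,
    integrable_map_measure hm (aemeasurable_lift hu c),
    integrable_withDensity_iff_integrable_smul₀' (aemeasurable_dens hu c) (by simp)]
  refine integrable_congr ((ae_restrict_iff' (Sg.isOpen_shadow c).measurableSet).2
    (Eventually.of_forall fun z hz ↦ ?_))
  obtain ⟨h1, h2⟩ := lift_mem_tile c hz
  simp only [Function.comp_apply, ENNReal.toReal_ofReal (dens_nonneg hu c z), hf _ h1, h2,
    smul_eq_mul, mul_comm]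

theorem setIntegral_tile : ∫ x in Sg.tile c, f x ∂volumeMeasure (Sg.inducedMetric u) =
    ∫ z in Sg.shadow c, F z * (localGraph hu c).dens z := by
  rw [volumeMeasure_restrict_tile hu c] at hm
  rw [volumeMeasure_restrict_tile hu c, graphVolume, integral_map (aemeasurable_lift hu c) hm,
    integral_withDensity_eq_integral_toReal_smul₀ (aemeasurable_dens hu c) (by simp)]
  refine setIntegral_congr_fun (Sg.isOpen_shadow c).measurableSet fun z hz ↦ ?_
  obtain ⟨h1, h2⟩ := lift_mem_tile c hz
  simp only [ENNReal.toReal_ofReal (dens_nonneg hu c z), hf _ h1, h2, smul_eq_mul, mul_comm]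

end Integrals

section Integrability

variable [CompactSpace N] [MeasurableSpace N] [BorelSpace N] (hu : Sg.IsSpacelikeHeight u)
include hu

/-- The Riemannian volume is finite on compact subsets of the interior. -/
theorem volumeMeasure_lt_top {P : Set N} (hP : IsCompact P) (hPi : P ⊆ (𝓡∂ m).interior N) :
    volumeMeasure (Sg.inducedMetric u) P < ⊤ := by
  refine hP.measure_lt_top_of_nhdsWithin fun x hx ↦ ?_
  have hxt := mem_tile_self (Sg := Sg) (hPi hx)
  set c := Sg.proj x
  have hz : Sg.chartMap c x ∈ Sg.shadow c := ⟨x, hxt.1, hxt.2, rfl⟩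
  obtain ⟨r, hr, hrs⟩ := Metric.nhds_basis_closedBall.mem_iff.1 ((Sg.isOpen_shadow c).mem_nhds hz)
  have hU : Sg.tile c ∩ Sg.chartMap c ⁻¹' Metric.closedBall (Sg.chartMap c x) r ∈ 𝓝 x :=
    inter_mem ((Sg.isOpen_tile c).mem_nhds hxt)
      ((contMDiffAt_chartMap hxt.2).continuousAt (Metric.closedBall_mem_nhds _ hr))
  obtain ⟨t, ht, hto, hxm⟩ := mem_nhds_iff.1 hU
  refine ⟨t, mem_nhdsWithin_of_mem_nhds (hto.mem_nhds hxm), ?_⟩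
  have h1 : volumeMeasure (Sg.inducedMetric u) t = graphVolume hu c t := by
    rw [← volumeMeasure_restrict_tile hu c, Measure.restrict_apply hto.measurableSet,
      inter_eq_left.2 fun y hy ↦ (ht hy).1]
  rw [h1, graphVolume_apply hu c hto.measurableSet]
  have h2 : IntegrableOn (localGraph hu c).dens (Metric.closedBall (Sg.chartMap c x) r) :=
    ContinuousOn.integrableOn_compact (isCompact_closedBall _ _) fun z hz ↦
      (SplitPatch.Graph.contDiffAt_dens (u := localGraph hu c)
        (hrs hz)).continuousAt.continuousWithinAt
  refine (lintegral_mono_set ?_).trans_lt h2.lintegral_lt_top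
  rintro z ⟨hz, hzt⟩
  have := (ht hzt).2
  rwa [mem_preimage, (lift_mem_tile c hz).2] at this

theorem integrable_volumeMeasure [T2Space N] {f : N → ℝ} {P : Set N} (hP : IsCompact P)
    (hPi : P ⊆ (𝓡∂ m).interior N) (hf : ∀ x ∈ (𝓡∂ m).interior N, ContinuousAt f x)
    (h0 : ∀ x, x ∉ P → f x = 0) : Integrable f (volumeMeasure (Sg.inducedMetric u)) :=
  (ContinuousOn.integrableOn_of_subset_isCompact (fun x hx ↦ (hf x (hPi hx)).continuousWithinAt)
    hP hP.measurableSet subset_rfl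
      (volumeMeasure_lt_top hu hP hPi).ne).integrable_of_forall_notMem_eq_zero h0

end Integrability

end SpacelikeHypersurface

/-! ### Piecewise smooth curves -/

/-- A function on `[0, ∞)` that is monotone on the intervals free of break points is monotone. -/
theorem monotoneOn_Ici_of_pieces {g : ℝ → ℝ} {P : Set ℝ}
    (hP : ∀ a ∈ Ici (0 : ℝ), ∀ b ∈ Ici (0 : ℝ), (P ∩ Icc a b).Finite)
    (h : ∀ a ∈ Ici (0 : ℝ), ∀ b ∈ Ici (0 : ℝ), a < b → Disjoint P (Ioo a b) → g a ≤ g b) :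
    MonotoneOn g (Ici 0) := by
  have key : ∀ n : ℕ, ∀ a ∈ Ici (0 : ℝ), ∀ b ∈ Ici (0 : ℝ), a < b → (P ∩ Ioo a b).ncard = n →
      g a ≤ g b := by
    intro n
    induction n using Nat.strong_induction_on with
    | _ n ih =>
      intro a ha b hb hab hn
      have hfin : (P ∩ Ioo a b).Finite :=
        (hP a ha b hb).subset (inter_subset_inter_right _ Ioo_subset_Icc_self)
      rcases (P ∩ Ioo a b).eq_empty_or_nonempty with h0 | ⟨p, hp, hpa, hpb⟩
      · exact h a ha b hb hab (disjoint_iff_inter_eq_empty.2 h0)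
      · have hp0 : p ∈ Ici (0 : ℝ) := ha.out.trans hpa.le
        have h1 : (P ∩ Ioo a p).ncard < n := by
          rw [← hn]
          refine ncard_lt_ncard ⟨fun x hx ↦ ⟨hx.1, hx.2.1, hx.2.2.trans hpb⟩, fun hs ↦ ?_⟩ hfin
          exact (hs ⟨hp, hpa, hpb⟩).2.2.false
        have h2 : (P ∩ Ioo p b).ncard < n := by
          rw [← hn]
          refine ncard_lt_ncard ⟨fun x hx ↦ ⟨hx.1, hpa.trans hx.2.1, hx.2.2⟩, fun hs ↦ ?_⟩ hfin
          exact (hs ⟨hp, hpa, hpb⟩).2.1.false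
        exact (ih _ h1 a ha p hp0 hpa rfl).trans (ih _ h2 p hp0 b hb hpb rfl)
  intro a ha b hb hab
  rcases hab.eq_or_lt with rfl | hab
  · exact le_rfl
  · exact key _ a ha b hb hab rfl

section Curves

variable {m : ℕ} {S : Type*} [TopologicalSpace S]
  [ChartedSpace (EuclideanSpace ℝ (Fin m)) S] [IsManifold (𝓡 m) ∞ S]

/-- The differential of a function on `ℝ × S`, as a covector on the model space. -/
def splitDiff (g : ℝ × S → ℝ) (p : ℝ × S) : SplitVec m →L[ℝ] ℝ :=
  mfderiv (splitModel m) 𝓘(ℝ, ℝ) g p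

theorem hasDerivWithinAt_comp_curve {γ : ℝ → ℝ × S} {g : ℝ × S → ℝ} {s : Set ℝ} {t : ℝ}
    (hγ : MDifferentiableWithinAt 𝓘(ℝ, ℝ) (splitModel m) γ s t)
    (hg : MDifferentiableAt (splitModel m) 𝓘(ℝ, ℝ) g (γ t)) :
    HasDerivWithinAt (g ∘ γ) (splitDiff g (γ t)
      (mfderivWithin 𝓘(ℝ, ℝ) (splitModel m) γ s t (1 : ℝ))) s t := by
  let l : ℝ →L[ℝ] SplitVec m := mfderivWithin 𝓘(ℝ, ℝ) (splitModel m) γ s t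
  have h : HasFDerivWithinAt (g ∘ γ) (splitDiff g (γ t) ∘L l) s t :=
    (hg.hasMFDerivAt.comp_hasMFDerivWithinAt t hγ.hasMFDerivWithinAt).hasFDerivWithinAt
  exact h.hasDerivWithinAt

variable {Q : ∀ p : ℝ × S, TangentSpace (splitModel m) p → Prop} {γ : ℝ → ℝ × S}

theorem PiecewiseCurve.monotoneOn (hγ : PiecewiseCurve Q γ (Ici 0)) {g : ℝ × S → ℝ}
    (hg : ContMDiff (splitModel m) 𝓘(ℝ, ℝ) 1 g)
    (h : ∀ t ≥ 0, ∀ v : SplitVec m, Q (γ t) v → 0 ≤ splitDiff g (γ t) v) :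
    MonotoneOn (g ∘ γ) (Ici 0) := by
  obtain ⟨-, P, hP, hd⟩ := hγ
  refine monotoneOn_Ici_of_pieces hP fun a ha b hb hab hPab ↦ ?_
  obtain ⟨h1, h2⟩ := hd a ha b hb hab hPab
  have h3 : ∀ t ∈ Icc a b, HasDerivWithinAt (g ∘ γ) (splitDiff g (γ t)
      (mfderivWithin 𝓘(ℝ, ℝ) (splitModel m) γ (Icc a b) t (1 : ℝ))) (Icc a b) t := fun t ht ↦
    hasDerivWithinAt_comp_curve (h1.mdifferentiableOn (by simp) t ht)
      (hg.mdifferentiable (by simp) _)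
  refine monotoneOn_of_hasDerivWithinAt_nonneg (convex_Icc a b)
    (fun t ht ↦ (h3 t ht).continuousWithinAt)
    (fun t ht ↦ (h3 t (interior_subset ht)).mono interior_subset)
    (fun t ht ↦ ?_) (left_mem_Icc.2 hab.le) (right_mem_Icc.2 hab.le) hab.le
  have ht' := interior_subset ht
  exact h t (ha.out.trans ht'.1) _ (h2 t ht')

/-- A piecewise smooth curve has a velocity to the right. -/
theorem PiecewiseCurve.exists_hasDerivWithinAt (hγ : PiecewiseCurve Q γ (Ici 0)) {t : ℝ}
    (ht : 0 ≤ t) : ∃ v : SplitVec m, Q (γ t) v ∧ ∀ g : ℝ × S → ℝ,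
      MDifferentiableAt (splitModel m) 𝓘(ℝ, ℝ) g (γ t) →
        HasDerivWithinAt (g ∘ γ) (splitDiff g (γ t) v) (Ici t) t := by
  obtain ⟨-, P, hP, hd⟩ := hγ
  have h1 : (P ∩ Icc t (t + 1)) \ {t} ⊆ P ∩ Icc t (t + 1) := sdiff_subset
  have h2 : ((P ∩ Icc t (t + 1)) \ {t})ᶜ ∈ 𝓝 t :=
    ((hP t ht (t + 1) (by simp; linarith)).subset h1).isClosed.isOpen_compl.mem_nhds (by simp)
  have h2' : ((P ∩ Icc t (t + 1)) \ {t})ᶜ ∩ Iio (t + 1) ∈ 𝓝[>] t :=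
    mem_nhdsWithin_of_mem_nhds (inter_mem h2 (Iio_mem_nhds (by linarith)))
  obtain ⟨r, hr, hrs⟩ := mem_nhdsGT_iff_exists_Ioo_subset.1 h2'
  have h3 : Disjoint P (Ioo t r) := by
    rw [Set.disjoint_left]
    intro s hs hst
    obtain ⟨h4, h5⟩ := hrs hst
    exact h4 ⟨⟨hs, hst.1.le, h5.out.le⟩, hst.1.ne'⟩
  obtain ⟨h4, h5⟩ := hd t ht r (ht.trans hr.out.le) hr h3
  have htr := left_mem_Icc.2 hr.out.le
  refine ⟨_, h5 t htr, fun g hg ↦ ?_⟩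
  exact (hasDerivWithinAt_comp_curve
    (h4.mdifferentiableOn (by simp) t htr) hg).mono_of_mem_nhdsWithin
    (Icc_mem_nhdsGE hr)

end Curves

section Causal

variable {m : ℕ} {S : Type*} [TopologicalSpace S]
  [ChartedSpace (EuclideanSpace ℝ (Fin m)) S] [IsManifold (𝓡 m) ∞ S] (M : SplitMetric m S)

namespace SplitMetric

/-- Causal vectors that are future pointing for `ε = 1` and past pointing for `ε = -1`. -/
def IsCausal (ε : ℝ) (p : ℝ × S) (v : TangentSpace (splitModel m) p) : Prop :=
  M.sigma p v v ≤ v.1 ^ 2 ∧ 0 < ε * v.1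

variable {M}

theorem sigma_le_of_metric {p : ℝ × S} {v : SplitVec m} (h : M.metric p v v ≤ 0) :
    M.sigma p v v ≤ v.1 ^ 2 := by
  have h1 := nonpos_of_mul_nonpos_right h (pow_pos (M.lapse_pos p) 2)
  have h2 : -(v.1 * v.1) + M.sigma p v v ≤ 0 := h1
  linarith [sq v.1]

theorem metric_observer (p : ℝ × S) (v : SplitVec m) :
    M.metric p (M.observer p) v = -(M.lapse p * v.1) := by
  refine (M.metric_time_apply p _ v).trans ?_
  have := (M.lapse_pos p).ne'
  field_simp

theorem FutureCausal.isCausal {p : ℝ × S} {v : SplitVec m} (h : M.FutureCausal p v) :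
    M.IsCausal 1 p v := by
  obtain ⟨h1, h2⟩ := h
  have h3 := (metric_observer p v).symm.trans_lt h2
  refine ⟨sigma_le_of_metric h1, ?_⟩
  rw [one_mul]
  exact pos_of_mul_pos_right (neg_neg_iff_pos.1 h3) (M.lapse_pos p).le

theorem PastCausal.isCausal {p : ℝ × S} {v : SplitVec m} (h : M.PastCausal p v) :
    M.IsCausal (-1) p v := by
  obtain ⟨h1, h2⟩ := h
  have h3 := h2.trans_eq (metric_observer p v)
  refine ⟨sigma_le_of_metric h1, ?_⟩
  have h4 := M.lapse_pos p
  nlinarith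

theorem sigma_nonneg (p : ℝ × S) (v : SplitVec m) : 0 ≤ M.sigma p v v := by
  have h : p.2 ∈ (extChartAt (𝓡 m) p.2).source := mem_extChartAt_source p.2
  refine (SplitPatch.sigma_nonneg (A := chartPatch M p.2)
    (p := (p.1, extChartAt (𝓡 m) p.2 p.2)) ((extChartAt (𝓡 m) p.2).map_source h) _).trans_eq
    (sigma_eq_coord M h v v).symm

end SplitMetric

theorem PiecewiseCurve.mono {Q Q' : ∀ p : ℝ × S, TangentSpace (splitModel m) p → Prop}
    {γ : ℝ → ℝ × S} {J : Set ℝ} (h : PiecewiseCurve Q γ J) (hQ : ∀ p v, Q p v → Q' p v) :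
    PiecewiseCurve Q' γ J :=
  ⟨h.1, h.2.imp fun _ hP ↦ ⟨hP.1, fun a ha b hb hab hd ↦ ⟨(hP.2 a ha b hb hab hd).1,
    fun t ht ↦ hQ _ _ ((hP.2 a ha b hb hab hd).2 t ht)⟩⟩⟩

end Causal

/-! ### Causal curves in compact sets -/

section Causal

variable {m : ℕ} {S : Type*} [TopologicalSpace S]
  [ChartedSpace (EuclideanSpace ℝ (Fin m)) S] [IsManifold (𝓡 m) ∞ S]

theorem splitDiff_fst (p : ℝ × S) (v : SplitVec m) : splitDiff Prod.fst p v = v.1 :=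
  DFunLike.congr_fun (mfderiv_fst (I := 𝓘(ℝ, ℝ)) (I' := 𝓡 m) (x := p)) v

theorem splitDiff_add {f g : ℝ × S → ℝ} {p : ℝ × S}
    (hf : MDifferentiableAt (splitModel m) 𝓘(ℝ, ℝ) f p)
    (hg : MDifferentiableAt (splitModel m) 𝓘(ℝ, ℝ) g p) (v : SplitVec m) :
    splitDiff (fun q ↦ f q + g q) p v = splitDiff f p v + splitDiff g p v :=
  DFunLike.congr_fun (hf.hasMFDerivAt.add hg.hasMFDerivAt).mfderiv v

theorem splitDiff_const_mul {f : ℝ × S → ℝ} {p : ℝ × S} (k : ℝ)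
    (hf : MDifferentiableAt (splitModel m) 𝓘(ℝ, ℝ) f p) (v : SplitVec m) :
    splitDiff (fun q ↦ k * f q) p v = k * splitDiff f p v :=
  DFunLike.congr_fun (hf.hasMFDerivAt.const_smul k).mfderiv v

theorem splitDiff_comp_snd {c : S} {p : ℝ × S} (hc : p.2 ∈ (extChartAt (𝓡 m) c).source) {f : S → ℝ}
    (hf : ContMDiffAt (𝓡 m) 𝓘(ℝ, ℝ) 1 f p.2) (v : SplitVec m) :
    splitDiff (f ∘ Prod.snd) p v = fderiv ℝ (f ∘ (extChartAt (𝓡 m) c).symm)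
      (extChartAt (𝓡 m) c p.2) (coordVec c p.2 v).2 := by
  have hi : p.2 ∈ (𝓡 m).interior S := BoundarylessManifold.isInteriorPoint
  have h1 := (contDiffAt_comp_chart_symm hi hc (by simp) hf).differentiableAt (by simp)
  rw [extChartAt_source] at hc
  have h2 := (mdifferentiableAt_extChartAt (I := 𝓡 m) hc).hasMFDerivAt
  have h3 := h1.hasFDerivAt.hasMFDerivAt.comp p (h2.comp p (hasMFDerivAt_snd (I := 𝓘(ℝ, ℝ)) p))
  have h4 : f ∘ Prod.snd =ᶠ[𝓝 p] (f ∘ (extChartAt (𝓡 m) c).symm) ∘ (extChartAt (𝓡 m) c) ∘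
      Prod.snd := by
    rw [← extChartAt_source (𝓡 m)] at hc
    have := (continuous_snd.tendsto p).eventually ((isOpen_extChartAt_source c).mem_nhds hc)
    exact this.mono fun q hq ↦ congrArg f ((extChartAt (𝓡 m) c).left_inv hq).symm
  have h5 := (h3.congr_of_eventuallyEq h4).mfderiv
  refine (DFunLike.congr_fun h5 v).trans ?_
  have h6 := tangentCoordChange_def (I := 𝓡 m) (x := p.2) (y := c) (z := p.2)
  have h7 := (mdifferentiableAt_extChartAt (I := 𝓡 m) hc).mfderiv
  exact congrArg (fderiv ℝ (f ∘ (extChartAt (𝓡 m) c).symm) (extChartAt (𝓡 m) c p.2))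
    (DFunLike.congr_fun h7 v.2)

variable (M : SplitMetric m S)

/-- A bump function varies along a causal curve at most at a rate proportional to time. -/
theorem SplitMetric.exists_sq_splitDiff_le [T2Space S] {y : S} (χ : SmoothBumpFunction (𝓡 m) y)
    (a b : ℝ) : ∃ C, 0 ≤ C ∧ ∀ p : ℝ × S, p.1 ∈ Icc a b → ∀ v : SplitVec m,
      (splitDiff (χ ∘ Prod.snd) p v) ^ 2 ≤ C * M.sigma p v v := by
  set ψ := extChartAt (𝓡 m) y with hψ
  have hK : IsCompact (ψ '' tsupport χ) := χ.hasCompactSupport.isCompact.image_of_continuousOn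
    ((continuousOn_extChartAt y).mono χ.tsupport_subset_extChartAt_source)
  have hQ : IsCompact (Icc a b ×ˢ (ψ '' tsupport χ)) := isCompact_Icc.prod hK
  have hb : ∀ z ∈ ψ '' tsupport χ, z ∈ ψ.target := by
    rintro _ ⟨q, hq, rfl⟩
    exact ψ.map_source (χ.tsupport_subset_extChartAt_source hq)
  obtain ⟨k, hk⟩ := SplitPatch.exists_elliptic (A := chartPatch M y) hQ fun p hp ↦ hb _ hp.2
  have hcont : ContinuousOn (fderiv ℝ (χ ∘ ψ.symm)) (ψ '' tsupport χ) := by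
    rintro _ ⟨q, hq, rfl⟩
    have h1 : ContDiffAt ℝ ∞ (χ ∘ ψ.symm) (ψ q) :=
      contDiffAt_comp_chart_symm BoundarylessManifold.isInteriorPoint
        (χ.tsupport_subset_extChartAt_source hq) le_rfl χ.contMDiffAt
    exact (h1.fderiv_right (m := 0) (by simp)).continuousAt.continuousWithinAt
  obtain ⟨B, hB⟩ := hK.exists_bound_of_continuousOn hcont
  refine ⟨B ^ 2 * |k|, by positivity, fun p hp v ↦ ?_⟩
  have hσ := M.sigma_nonneg p v
  by_cases hs : p.2 ∈ tsupport χ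
  · have hc := χ.tsupport_subset_extChartAt_source hs
    have hz : ψ p.2 ∈ ψ '' tsupport χ := mem_image_of_mem _ hs
    rw [splitDiff_comp_snd hc (χ.contMDiffAt.of_le (by simp))]
    set w := (coordVec y p.2 v).2
    have h1 : M.sigma p v v = (chartPatch M y).sigma (p.1, ψ p.2) (0, w) (0, w) :=
      (sigma_eq_coord M hc v v).trans
        (SplitPatch.sigma_eq (A := chartPatch M y) (p := (p.1, ψ p.2)) (hb _ hz) _ _)
    have h2 := hk (p.1, ψ p.2) ⟨hp, hz⟩ w
    rw [← h1] at h2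
    have h3 := (fderiv ℝ (χ ∘ ψ.symm) (ψ p.2)).le_of_opNorm_le (hB _ hz) w
    rw [Real.norm_eq_abs] at h3
    calc _ = |fderiv ℝ (χ ∘ ψ.symm) (ψ p.2) w| ^ 2 := (sq_abs _).symm
      _ ≤ (B * ‖w‖) ^ 2 := pow_le_pow_left₀ (abs_nonneg _) h3 2
      _ = B ^ 2 * ‖w‖ ^ 2 := by ring
      _ ≤ B ^ 2 * (|k| * M.sigma p v v) := mul_le_mul_of_nonneg_left
          (h2.trans (mul_le_mul_of_nonneg_right (le_abs_self k) hσ)) (sq_nonneg B)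
      _ = _ := by ring
  · have h1 : χ ∘ Prod.snd =ᶠ[𝓝 p] fun _ ↦ (0 : ℝ) :=
      (continuous_snd.tendsto p).eventually (notMem_tsupport_iff_eventuallyEq.1 hs)
    have h2 : splitDiff (m := m) (χ ∘ Prod.snd) p v = 0 :=
      DFunLike.congr_fun (h1.mfderiv_eq.trans mfderiv_const) v
    rw [h2, zero_pow two_ne_zero]
    exact mul_nonneg (by positivity) hσ

variable {M}

/-- An inextendible causal curve cannot stay in a compact set `[a, b] × K`: time is monotone along
the curve, hence convergent, and so is every bump function. -/
theorem exists_tendsto_of_mem_compact [T2Space S] {ε : ℝ} (hε : ε ^ 2 = 1) {γ : ℝ → ℝ × S}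
    (hγ : PiecewiseCurve (M.IsCausal ε) γ (Ici 0)) {a b : ℝ} {K : Set S} (hK : IsCompact K)
    (h : ∀ t ≥ 0, γ t ∈ Icc a b ×ˢ K) : ∃ q, Tendsto γ atTop (𝓝 q) := by
  have hlim : ∀ {g : ℝ × S → ℝ}, Continuous g → MonotoneOn (g ∘ γ) (Ici 0) →
      ∃ l, Tendsto (g ∘ γ) atTop (𝓝 l) := by
    intro g hg hm
    obtain ⟨B, hB⟩ := (isCompact_Icc.prod hK).exists_bound_of_continuousOn hg.continuousOn
    have h1 : Monotone fun t ↦ (g ∘ γ) (max t 0) := fun s t hst ↦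
      hm (mem_Ici.2 (le_max_right s 0)) (mem_Ici.2 (le_max_right t 0)) (max_le_max_right 0 hst)
    refine ⟨_, (tendsto_atTop_ciSup h1 ⟨B, ?_⟩).congr' ?_⟩
    · rintro _ ⟨t, rfl⟩
      exact (le_abs_self _).trans (hB _ (h _ (le_max_right _ _)))
    · filter_upwards [eventually_ge_atTop 0] with t ht
      simp [max_eq_left ht]
  have hfst : ContMDiff (splitModel m) 𝓘(ℝ, ℝ) 1 (Prod.fst : ℝ × S → ℝ) := contMDiff_fst
  have hfst' : ∀ k : ℝ, ContMDiff (splitModel m) 𝓘(ℝ, ℝ) 1 (fun p : ℝ × S ↦ k * p.1) :=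
    fun k ↦ (contDiff_const.mul contDiff_id : ContDiff ℝ 1 fun t : ℝ ↦ k * t).contMDiff.comp hfst
  have htime : ∀ k : ℝ, 0 ≤ k → ∃ l, Tendsto (fun t ↦ k * ε * (γ t).1) atTop (𝓝 l) := by
    intro k hk
    refine hlim (g := fun p ↦ k * ε * p.1) (by fun_prop) (hγ.monotoneOn (hfst' _) ?_)
    intro t ht v hv
    rw [splitDiff_const_mul _ (hfst.mdifferentiable (by simp) _), splitDiff_fst, mul_assoc]
    exact mul_nonneg hk hv.2.le
  obtain ⟨l, hl⟩ := htime 1 zero_le_one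
  have hτ : Tendsto (fun t ↦ (γ t).1) atTop (𝓝 (ε * l)) := by
    refine (hl.const_mul ε).congr fun t ↦ ?_
    rw [one_mul, ← mul_assoc, ← sq, hε, one_mul]
  -- the limit in `S` is a cluster point
  obtain ⟨y, -, hy⟩ := hK.exists_mapClusterPt (f := atTop) (u := fun t ↦ (γ t).2)
    (by simpa using (eventually_ge_atTop 0).mono fun t ht ↦ (h t ht).2)
  refine ⟨(ε * l, y), hτ.prodMk_nhds ?_⟩
  refine (SmoothBumpFunction.nhds_basis_support (I := 𝓡 m) (c := y)
    univ_mem).tendsto_right_iff.2 fun χ _ ↦ ?_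
  obtain ⟨C, hC, hbound⟩ := M.exists_sq_splitDiff_le χ a b
  have hχ : ContMDiff (splitModel m) 𝓘(ℝ, ℝ) 1 (χ ∘ Prod.snd : ℝ × S → ℝ) :=
    (χ.contMDiff.of_le (by simp)).comp contMDiff_snd
  -- `χ` itself need not be monotone along the curve, but it is after adding a multiple of time
  have hmono : ∃ l, Tendsto (fun t ↦ √C * ε * (γ t).1 + χ (γ t).2) atTop (𝓝 l) := by
    refine hlim (g := fun p ↦ √C * ε * p.1 + (χ ∘ Prod.snd) p) ?_
      (hγ.monotoneOn ((hfst' _).add hχ) ?_)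
    · exact (continuous_const.mul continuous_fst).add (χ.continuous.comp continuous_snd)
    intro t ht v hv
    rw [splitDiff_add ((hfst' _).mdifferentiable (by simp) _) (hχ.mdifferentiable (by simp) _),
      splitDiff_const_mul _ (hfst.mdifferentiable (by simp) _), splitDiff_fst, mul_assoc]
    have h1 : (splitDiff (χ ∘ Prod.snd) (γ t) v) ^ 2 ≤ (√C * (ε * v.1)) ^ 2 := by
      rw [mul_pow, Real.sq_sqrt hC, mul_pow, hε, one_mul]
      exact (hbound _ (h t ht).1 v).trans (mul_le_mul_of_nonneg_left hv.1 hC)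
    have h2 := abs_le_of_sq_le_sq h1 (mul_nonneg (Real.sqrt_nonneg C) hv.2.le)
    linarith [neg_abs_le (splitDiff (χ ∘ Prod.snd) (γ t) v)]
  obtain ⟨l₁, h1⟩ := hmono
  obtain ⟨l₂, h2⟩ := htime (√C) (Real.sqrt_nonneg C)
  have h3 : Tendsto (fun t ↦ χ (γ t).2) atTop (𝓝 (l₁ - l₂)) :=
    (h1.sub h2).congr fun t ↦ by ring
  have h4 : 1 / 2 ≤ l₁ - l₂ := by
    by_contra hlt
    have h5 : ∀ᶠ t in atTop, χ (γ t).2 < 1 / 2 := h3.eventually_lt_const (not_le.1 hlt)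
    have h6 : {q | 1 / 2 < χ q} ∈ 𝓝 y :=
      (isOpen_lt continuous_const χ.continuous).mem_nhds (by simp; norm_num)
    obtain ⟨t, h7, h8⟩ := ((mapClusterPt_iff_frequently.1 hy _ h6).and_eventually h5).exists
    exact lt_asymm h7 h8
  have h9 : ∀ᶠ t in atTop, 0 < χ (γ t).2 := h3.eventually_const_lt (by linarith)
  exact h9.mono fun t ht ↦ ht.ne'

end Causal

/-! ### Spacelike graphs lie in the Cauchy development -/

/-- A function with positive derivative to the right is eventually larger than its value. -/
theorem eventually_lt_of_hasDerivWithinAt_pos {f : ℝ → ℝ} {f' t : ℝ}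
    (hf : HasDerivWithinAt f f' (Ici t) t) (hf' : 0 < f') : ∀ᶠ s in 𝓝[>] t, f t < f s := by
  have h1 := (hasDerivWithinAt_iff_tendsto_slope.1 hf).eventually_const_lt hf'
  rw [Ici_sdiff_left] at h1
  filter_upwards [h1, self_mem_nhdsWithin] with s hs hst
  rw [slope_def_field] at hs
  have := (div_pos_iff_of_pos_right (sub_pos.2 hst)).1 hs
  linarith

namespace SpacelikeHypersurface

variable {m : ℕ} [NeZero m] {S : Type*} [TopologicalSpace S]
  [ChartedSpace (EuclideanSpace ℝ (Fin m)) S] [IsManifold (𝓡 m) ∞ S] {M : SplitMetric m S}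
  {N : Type*} [TopologicalSpace N] [ChartedSpace (EuclideanHalfSpace m) N]
  [IsManifold (𝓡∂ m) ∞ N] [Nonempty N] {Sg : SpacelikeHypersurface M N} {u : N → ℝ}

section Lift

variable {x : N} (hx : x ∈ (𝓡∂ m).interior N)
include hx

theorem contMDiffAt_comp_lift {f : N → ℝ} (hf : ContMDiffAt (𝓡∂ m) 𝓘(ℝ, ℝ) 1 f x) :
    ContMDiffAt (𝓡 m) 𝓘(ℝ, ℝ) 1 (f ∘ Sg.lift) (Sg.proj x) := by
  have hc : Sg.proj x ∈ (extChartAt (𝓡 m) (Sg.proj x)).source := mem_extChartAt_source _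
  have h1 : ContDiffAt ℝ 1 (Sg.inChart f (Sg.proj x)) (Sg.chartMap (Sg.proj x) x) :=
    contDiffAt_inChart hx hc (by simp) hf
  have h2 := h1.contMDiffAt.comp (Sg.proj x) (contMDiffAt_extChartAt (I := 𝓡 m) (n := 1)
    (x := Sg.proj x))
  refine h2.congr_of_eventuallyEq ?_
  filter_upwards [(isOpen_extChartAt_source (I := 𝓡 m) (Sg.proj x)).mem_nhds hc] with q hq
  exact congrArg (f ∘ Sg.lift) ((extChartAt (𝓡 m) (Sg.proj x)).left_inv hq).symm

/-- Invariance of domain for the projection of the interior to `S`. -/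
theorem range_proj_mem_nhds : range Sg.proj ∈ 𝓝 (Sg.proj x) := by
  have hc : Sg.proj x ∈ (extChartAt (𝓡 m) (Sg.proj x)).source := mem_extChartAt_source _
  have h1 := (continuousAt_extChartAt (I := 𝓡 m) (Sg.proj x)).eventually
    (eventually_mem_shadow hx hc)
  filter_upwards [h1, (isOpen_extChartAt_source (I := 𝓡 m) (Sg.proj x)).mem_nhds hc] with q hq hqs
  obtain ⟨x', -, hc', h⟩ := hq
  exact ⟨x', (extChartAt (𝓡 m) (Sg.proj x)).injOn hc' hqs h⟩

/-- A causal curve crosses a spacelike graph transversally. -/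
theorem splitDiff_sub_height_pos (hu : Sg.IsSpacelikeHeight u) {ε : ℝ} (hε : ε ^ 2 = 1)
    {v : SplitVec m} (hv : M.IsCausal ε (Sg.graphMap u x) v) :
    MDifferentiableAt (splitModel m) 𝓘(ℝ, ℝ) (fun p ↦ p.1 + -1 * u (Sg.lift p.2))
      (Sg.graphMap u x) ∧
    0 < ε * splitDiff (fun p ↦ p.1 + -1 * u (Sg.lift p.2)) (Sg.graphMap u x) v := by
  set c := Sg.proj x with hcdef
  have hc : (Sg.graphMap u x).2 ∈ (extChartAt (𝓡 m) c).source := mem_extChartAt_source _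
  have h1 := contMDiffAt_comp_lift (Sg := Sg) hx ((hu.smooth x).of_le (by simp))
  have h2 : ContMDiffAt (splitModel m) 𝓘(ℝ, ℝ) 1 ((u ∘ Sg.lift) ∘ Prod.snd) (Sg.graphMap u x) :=
    ContMDiffAt.comp (Sg.graphMap u x) h1 contMDiffAt_snd
  have h3 : ContMDiffAt (splitModel m) 𝓘(ℝ, ℝ) 1 (Prod.fst : ℝ × S → ℝ) (Sg.graphMap u x) :=
    contMDiffAt_fst
  have h3' := h3.mdifferentiableAt (by simp)
  have h2' := h2.mdifferentiableAt (by simp)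
  have h4 : MDifferentiableAt (splitModel m) 𝓘(ℝ, ℝ)
      (fun p : ℝ × S ↦ -1 * ((u ∘ Sg.lift) ∘ Prod.snd) p) (Sg.graphMap u x) :=
    (h2'.hasMFDerivAt.const_smul (-1 : ℝ)).mdifferentiableAt
  refine ⟨(h3'.hasMFDerivAt.add h4.hasMFDerivAt).mdifferentiableAt, ?_⟩
  have h5 : splitDiff (fun p ↦ p.1 + -1 * u (Sg.lift p.2)) (Sg.graphMap u x) v =
      v.1 + -1 * fderiv ℝ (Sg.inChart u c) (Sg.chartMap c x) (coordVec c c v).2 := by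
    refine (splitDiff_add h3' h4 v).trans ?_
    rw [splitDiff_fst, splitDiff_const_mul _ h2', splitDiff_comp_snd hc h1]
    rfl
  rw [h5]
  set a := (coordVec c c v).2
  have h6 : M.sigma (Sg.graphMap u x) v v =
      (chartPatch M c).sigma ((localGraph hu c).pt (Sg.chartMap c x)) (0, a) (0, a) := by
    rw [localGraph_pt hu hc]
    exact (sigma_eq_coord M hc v v).trans (SplitPatch.sigma_eq (A := chartPatch M c)
      (p := (u x, Sg.chartMap c x)) ((extChartAt (𝓡 m) c).map_source hc) _ _)
  have h7 : ε * v.1 = |v.1| := by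
    rw [← abs_of_pos hv.2, abs_mul, ← Real.sqrt_sq_eq_abs ε, hε, Real.sqrt_one, one_mul]
  have h8 : |fderiv ℝ (Sg.inChart u c) (Sg.chartMap c x) a| < |v.1| := by
    by_cases ha : a = 0
    · rw [ha, map_zero, abs_zero, ← h7]; exact hv.2
    · refine sq_lt_sq.1 (((localGraph hu c).spacelike _ (chartMap_mem_dom hu hx hc)
        a ha).trans_le ?_)
      exact h6.symm.trans_le hv.1
  have h9 : ε * fderiv ℝ (Sg.inChart u c) (Sg.chartMap c x) a ≤
      |fderiv ℝ (Sg.inChart u c) (Sg.chartMap c x) a| := by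
    refine (le_abs_self _).trans_eq ?_
    rw [abs_mul, ← Real.sqrt_sq_eq_abs ε, hε, Real.sqrt_one, one_mul]
  linarith

end Lift

section Development

variable [CompactSpace N] [T2Space S]

theorem continuousOn_lift_range : ContinuousOn Sg.lift (range Sg.proj) := by
  have h := (Sg.contMDiff_proj.continuous.isClosedEmbedding Sg.proj_injective).isInducing
  rw [h.continuousOn_iff]
  refine continuousOn_id.congr ?_
  rintro _ ⟨x, rfl⟩
  rw [Function.comp_apply, Sg.lift_proj]; rfl

/-- Causal curves that start on a spacelike graph, on the side of the graph on which the
hypersurface lies, cannot recross the graph. They stay between the graph and the hypersurface until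
they meet the latter. -/
theorem exists_mem_range_of_isCausal (hu : Sg.IsSpacelikeHeight u) {ε : ℝ} (hε : ε ^ 2 = 1)
    {γ : ℝ → ℝ × S} (hγ : PiecewiseCurve (M.IsCausal ε) γ (Ici 0))
    (hinext : ¬ ∃ q, Tendsto γ atTop (𝓝 q)) {x₀ : N} (h0 : γ 0 = Sg.graphMap u x₀)
    (hside : 0 ≤ ε * (Sg.time x₀ - u x₀)) : ∃ s ≥ 0, γ s ∈ range Sg.emb := by
  by_contra! hmiss
  let f : ℝ × S → ℝ := fun p ↦ p.1 + -1 * Sg.time (Sg.lift p.2)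
  let g : ℝ × S → ℝ := fun p ↦ p.1 + -1 * u (Sg.lift p.2)
  let G : Set ℝ := {t | (γ t).2 ∈ range Sg.proj ∧ ε * f (γ t) ≤ 0 ∧ 0 ≤ ε * g (γ t)}
  have hε0 : ε ≠ 0 := by rintro rfl; norm_num at hε
  have hstrict : ∀ t ≥ 0, ∀ x, Sg.proj x = (γ t).2 → f (γ t) ≠ 0 := by
    intro t ht x hx hf
    refine hmiss t ht ⟨x, Prod.ext ?_ hx⟩
    have h1 : (γ t).1 + -1 * Sg.time (Sg.lift (γ t).2) = 0 := hf
    rw [← hx, Sg.lift_proj] at h1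
    change Sg.time x = _
    linarith
  have hsnd : ∀ {r : ℝ} {s : Set ℝ}, ContinuousWithinAt γ s r →
      ContinuousWithinAt (fun t ↦ (γ t).2) s r := fun h ↦
        continuous_snd.continuousAt.comp_continuousWithinAt h
  have hcont : ∀ {h : N → ℝ}, Continuous h → ContinuousOn (fun p : ℝ × S ↦
      ε * (p.1 + -1 * h (Sg.lift p.2))) (univ ×ˢ range Sg.proj) := by
    intro h hh
    refine continuousOn_const.mul (continuousOn_fst.add (continuousOn_const.mul ?_))
    exact hh.comp_continuousOn (continuousOn_lift_range.comp continuousOn_snd fun p hp ↦ hp.2)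
  have hfc := hcont Sg.contMDiff_time.continuous
  have hgc := hcont hu.smooth.continuous
  -- `G` is closed, and open to the right: off the boundary of the hypersurface the curve moves
  -- away from the graph, and it never meets the hypersurface
  have hall : ∀ b ≥ 0, Icc 0 b ⊆ G := by
    intro b hb
    have hγb : ContinuousOn γ (Icc 0 b) := hγ.1.mono fun t ht ↦ ht.1
    refine IsClosed.Icc_subset_of_forall_exists_gt ?_ ?_ ?_
    · have h1 : IsClosed (Icc 0 b ∩ γ ⁻¹' (univ ×ˢ range Sg.proj)) :=
        hγb.preimage_isClosed_of_isClosed isClosed_Icc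
          (isClosed_univ.prod (isCompact_range Sg.contMDiff_proj.continuous).isClosed)
      have h2 := (hfc.comp (hγb.mono inter_subset_left)
        fun t ht ↦ ht.2).preimage_isClosed_of_isClosed h1 (isClosed_Iic (a := 0))
      have h3 := (hgc.comp (hγb.mono inter_subset_left)
        fun t ht ↦ ht.2).preimage_isClosed_of_isClosed h1 (isClosed_Ici (a := 0))
      convert h2.inter h3 using 1
      ext t
      constructor
      · rintro ⟨⟨h4, h5, h6⟩, h7⟩
        exact ⟨⟨⟨h7, trivial, h4⟩, h5⟩, ⟨⟨h7, trivial, h4⟩, h6⟩⟩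
      · rintro ⟨⟨⟨h7, -, h4⟩, h5⟩, -, h6⟩
        exact ⟨⟨h4, h5, h6⟩, h7⟩
    · refine ⟨⟨x₀, by rw [h0]; rfl⟩, ?_, ?_⟩
      · have : f (γ 0) = u x₀ + -1 * Sg.time x₀ := by
          rw [h0]; exact congrArg (fun y ↦ u x₀ + -1 * Sg.time y) (Sg.lift_proj x₀)
        rw [this]; linarith
      · have : g (γ 0) = u x₀ + -1 * u x₀ := by
          rw [h0]; exact congrArg (fun y ↦ u x₀ + -1 * u y) (Sg.lift_proj x₀)
        rw [this]; simp
    · rintro r ⟨⟨⟨x, hx⟩, hf, hg⟩, hr0, hrb⟩ y hy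
      have hf' : ε * f (γ r) < 0 := lt_of_le_of_ne hf (mul_ne_zero hε0 (hstrict r hr0 x hx))
      have hlift : Sg.lift (γ r).2 = x := by rw [← hx, Sg.lift_proj]
      -- over the boundary the graph meets the hypersurface, so the curve would meet it as well
      have hxi : x ∈ (𝓡∂ m).interior N := by
        by_contra hxb
        rw [← mem_compl_iff, ModelWithCorners.compl_interior] at hxb
        have h1 : u x = Sg.time x := hu.boundary x hxb
        have h2 : f (γ r) = g (γ r) := by
          change (γ r).1 + -1 * Sg.time (Sg.lift (γ r).2) = (γ r).1 + -1 * u (Sg.lift (γ r).2)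
          rw [hlift, h1]
        rw [h2] at hf'
        exact hf'.not_ge hg
      have hK := range_proj_mem_nhds (Sg := Sg) hxi
      rw [hx] at hK
      have hK' : univ ×ˢ range Sg.proj ∈ 𝓝 (γ r) := prod_mem_nhds univ_mem hK
      have hγr : Tendsto γ (𝓝[>] r) (𝓝 (γ r)) :=
        (hγ.1 r hr0).mono fun t ht ↦ hr0.trans (mem_Ioi.1 ht).le
      have e1 : ∀ᶠ t in 𝓝[>] r, (γ t).2 ∈ range Sg.proj :=
        (hγr.eventually hK').mono fun t ht ↦ ht.2
      have e2 : ∀ᶠ t in 𝓝[>] r, ε * f (γ t) < 0 :=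
        hγr.eventually ((hfc.continuousAt hK').eventually_lt_const hf')
      have e3 : ∀ᶠ t in 𝓝[>] r, 0 < ε * g (γ t) := by
        rcases hg.eq_or_lt with hg0 | hg0
        · have h1 : γ r = Sg.graphMap u x := by
            refine Prod.ext ?_ hx.symm
            have h2 : (γ r).1 + -1 * u (Sg.lift (γ r).2) = 0 :=
              (mul_eq_zero.1 hg0.symm).resolve_left hε0
            rw [hlift] at h2
            change (γ r).1 = u x
            linarith
          obtain ⟨v, hv, hd⟩ := hγ.exists_hasDerivWithinAt hr0
          rw [h1] at hv hd
          obtain ⟨h3, h4⟩ := splitDiff_sub_height_pos hxi hu hε hv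
          have h5 := eventually_lt_of_hasDerivWithinAt_pos ((hd g h3).const_mul ε) h4
          refine h5.mono fun t ht ↦ ?_
          have : ε * (g ∘ γ) r = 0 := hg0.symm
          rwa [this] at ht
        · exact hγr.eventually ((hgc.continuousAt hK').eventually_const_lt hg0)
      obtain ⟨t, h1, h2, h3, h4⟩ :=
        (e1.and (e2.and (e3.and (Ioc_mem_nhdsGT hy)))).exists
      exact ⟨t, ⟨h1, h2.le, h3.le⟩, h4⟩
  obtain ⟨B₁, hB₁⟩ := isCompact_univ.exists_bound_of_continuousOn
    Sg.contMDiff_time.continuous.continuousOn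
  obtain ⟨B₂, hB₂⟩ := isCompact_univ.exists_bound_of_continuousOn hu.smooth.continuous.continuousOn
  refine hinext (exists_tendsto_of_mem_compact hε hγ (a := -max B₁ B₂) (b := max B₁ B₂)
    (isCompact_range Sg.contMDiff_proj.continuous) fun t ht ↦ ?_)
  obtain ⟨h1, h2, h3⟩ := hall t ht (right_mem_Icc.2 ht)
  refine ⟨?_, h1⟩
  have h4 := abs_le.1 (hB₁ (Sg.lift (γ t).2) trivial)
  have h5 := abs_le.1 (hB₂ (Sg.lift (γ t).2) trivial)
  have h6 := le_max_left B₁ B₂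
  have h7 := le_max_right B₁ B₂
  change ε * ((γ t).1 + -1 * Sg.time (Sg.lift (γ t).2)) ≤ 0 at h2
  change 0 ≤ ε * ((γ t).1 + -1 * u (Sg.lift (γ t).2)) at h3
  rcases mul_self_eq_one_iff.1 ((sq ε).symm.trans hε) with rfl | rfl
  all_goals constructor <;> linarith

/-- Points of the graph below the hypersurface lie in its past Cauchy development, points above it
in the future one. -/
theorem graphMap_mem_cauchyDevelopment (hu : Sg.IsSpacelikeHeight u) (x : N) :
    Sg.graphMap u x ∈ M.cauchyDevelopment (range Sg.emb) := by
  rcases le_total (u x) (Sg.time x) with h | h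
  · refine Or.inr fun γ hγ ↦ ?_
    exact exists_mem_range_of_isCausal hu (ε := 1) (by norm_num)
      (hγ.1.mono fun _ _ h ↦ SplitMetric.FutureCausal.isCausal h) hγ.2.2 hγ.2.1 (by linarith)
  · refine Or.inl fun γ hγ ↦ ?_
    exact exists_mem_range_of_isCausal hu (ε := -1) (by norm_num)
      (hγ.1.mono fun _ _ h ↦ SplitMetric.PastCausal.isCausal h) hγ.2.2 hγ.2.1 (by linarith)

/-- Admissible height functions are uniformly bounded. -/
theorem exists_height_mem_Icc (hC : IsCompact (closure (M.cauchyDevelopment (range Sg.emb)))) :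
    ∃ a b : ℝ, ∀ u : N → ℝ, Sg.IsSpacelikeHeight u → ∀ x, u x ∈ Icc a b := by
  obtain ⟨B, hB⟩ := hC.exists_bound_of_continuousOn continuous_fst.continuousOn
  exact ⟨-B, B, fun u hu x ↦
    abs_le.1 (hB _ (subset_closure (graphMap_mem_cauchyDevelopment hu x)))⟩

end Development

end SpacelikeHypersurface

/-! ### The integral estimate on the hypersurface -/

namespace SpacelikeHypersurface

variable {m : ℕ} [NeZero m] {S : Type*} [TopologicalSpace S]
  [ChartedSpace (EuclideanSpace ℝ (Fin m)) S] [IsManifold (𝓡 m) ∞ S] {M : SplitMetric m S}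
  {N : Type*} [TopologicalSpace N] [ChartedSpace (EuclideanHalfSpace m) N]
  [IsManifold (𝓡∂ m) ∞ N] [Nonempty N] {Sg : SpacelikeHypersurface M N} {u : N → ℝ}
  [CompactSpace N] [T2Space S]

theorem t2Space (Sg : SpacelikeHypersurface M N) : T2Space N :=
  T2Space.of_injective_continuous Sg.proj_injective Sg.contMDiff_proj.continuous

section Pointwise

variable (hu : Sg.IsSpacelikeHeight u) {η : N → ℝ} (hη : ContMDiff (𝓡∂ m) 𝓘(ℝ, ℝ) 1 η)
  (hs : tsupport η ⊆ (𝓡∂ m).interior N)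
include hu

theorem gradSq_inducedMetric_nonneg (hs : tsupport η ⊆ (𝓡∂ m).interior N) (x : N) :
    0 ≤ gradSq (Sg.inducedMetric u) η x := by
  by_cases hx : x ∈ tsupport η
  · have hc := mem_tile_self (Sg := Sg) (hs hx)
    obtain ⟨g, hg, hgi⟩ := exists_isInner hu hc.1 hc.2
    exact gradSq_nonneg hg (fun a b ↦ (inducedMetric_eq hu hc.1 hc.2 a b).trans (hgi a b).symm) η
  · exact (gradSq_eq_zero _ hx).ge

theorem secondFFSq_nonneg {x : N} (hx : x ∈ (𝓡∂ m).interior N) : 0 ≤ Sg.secondFFSq u x := by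
  have hc := mem_tile_self (Sg := Sg) hx
  rw [secondFFSq_eq hu hc.1 hc.2]
  exact SplitPatch.Graph.shapeSq_nonneg (chartMap_mem_dom hu hc.1 hc.2)

theorem sq_fderiv_inChart_le {c : S} {x : N} (hx : x ∈ Sg.tile c)
    (hη : ContMDiffAt (𝓡∂ m) 𝓘(ℝ, ℝ) 1 η x) (a : EuclideanSpace ℝ (Fin m)) :
    fderiv ℝ (Sg.inChart η c) (Sg.chartMap c x) a ^ 2 ≤
      gradSq (Sg.inducedMetric u) η x * (localGraph hu c).ind (Sg.chartMap c x) a a := by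
  obtain ⟨e, he⟩ := exists_chartDeriv_equiv hx.2
  obtain ⟨v, rfl⟩ : ∃ v, Sg.chartDeriv c x v = a := ⟨e.symm a, by simp [← he]⟩
  obtain ⟨g, hg, hgi⟩ := exists_isInner hu hx.1 hx.2
  have h := sq_mfderiv_le_gradSq hg
    (fun a b ↦ (inducedMetric_eq hu hx.1 hx.2 a b).trans (hgi a b).symm) η v
  rwa [← fderiv_inChart_eq_differential hx.1 hx.2 hη, hgi] at h

variable [MeasurableSpace N] [BorelSpace N]
include hη hs

theorem integrable_gradSq :
    Integrable (gradSq (Sg.inducedMetric u) η) (volumeMeasure (Sg.inducedMetric u)) :=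
  haveI := Sg.t2Space
  integrable_volumeMeasure hu (isClosed_tsupport η).isCompact hs
    (fun _ hx ↦ continuousAt_gradSq hu hx hη) fun _ hx ↦ gradSq_eq_zero _ hx

theorem integrable_sq_mul {f : N → ℝ} (hf : ∀ x ∈ (𝓡∂ m).interior N, ContinuousAt f x) :
    Integrable (fun x ↦ η x ^ 2 * f x) (volumeMeasure (Sg.inducedMetric u)) :=
  haveI := Sg.t2Space
  integrable_volumeMeasure hu (isClosed_tsupport η).isCompact hs
    (fun x hx ↦ (hη.continuous.continuousAt.pow 2).mul (hf x hx))
    fun x hx ↦ by rw [image_eq_zero_of_notMem_tsupport hx]; ring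

end Pointwise

/-- The integral estimate, localized by a fixed bump function on `S`. The constant depends on the
bump function and on the range of heights only. -/
theorem exists_estimate_of_bump [MeasurableSpace N] [BorelSpace N]
    (Sg : SpacelikeHypersurface M N) {c : S} (χ : SmoothBumpFunction (𝓡 m) c) (a b : ℝ) :
    ∃ C, 0 ≤ C ∧ ∀ u : N → ℝ, Sg.IsSpacelikeHeight u → (∀ x, u x ∈ Icc a b) →
      ∀ η : N → ℝ, ContMDiff (𝓡∂ m) 𝓘(ℝ, ℝ) 1 η → tsupport η ⊆ (𝓡∂ m).interior N →
        ∫ x, χ (Sg.proj x) ^ 2 * (η x ^ 2 * Sg.secondFFSq u x)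
          ∂(volumeMeasure (Sg.inducedMetric u)) ≤
        C * ∫ x, (gradSq (Sg.inducedMetric u) η x + η x ^ 2 * Sg.meanCurvature u x ^ 2 +
          η x ^ 2 * Sg.tilt u x ^ 2) ∂(volumeMeasure (Sg.inducedMetric u)) := by
  set ψ := extChartAt (𝓡 m) c with hψ
  have hχs : tsupport χ ⊆ ψ.source := χ.tsupport_subset_extChartAt_source
  have hK : IsCompact (ψ '' tsupport χ) := χ.hasCompactSupport.isCompact.image_of_continuousOn
    ((continuousOn_extChartAt c).mono hχs)
  have hKb : ψ '' tsupport χ ⊆ (chartPatch M c).base := by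
    rintro _ ⟨q, hq, rfl⟩
    exact ψ.map_source (hχs hq)
  have hχ : ContDiffOn ℝ 1 (χ ∘ ψ.symm) (chartPatch M c).base := fun z hz ↦ by
    have h1 := contDiffAt_comp_chart_symm (I := 𝓡 m) (n := 1) (f := χ) (c := c)
      BoundarylessManifold.isInteriorPoint (ψ.map_target hz) (by simp)
      (χ.contMDiffAt.of_le (by simp))
    rw [ψ.right_inv hz] at h1
    exact h1.contDiffWithinAt
  have hχK : ∀ z ∈ (chartPatch M c).base, z ∉ ψ '' tsupport χ → χ ∘ ψ.symm =ᶠ[𝓝 z] 0 := by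
    intro z hz hzK
    have h1 : ψ.symm z ∉ tsupport χ := fun h ↦ hzK ⟨_, h, ψ.right_inv hz⟩
    have h2 : ContinuousAt ψ.symm z := continuousAt_extChartAt_symm'' hz
    exact h2.eventually (notMem_tsupport_iff_eventuallyEq.1 h1)
  obtain ⟨C, hC, hest⟩ := (chartPatch M c).exists_local_estimate hK hKb hχ hχK a b
  obtain ⟨Λ, hΛ⟩ := ((isCompact_Icc (a := a) (b := b)).prod
    (isCompact_range Sg.contMDiff_proj.continuous)).exists_bound_of_continuousOn
      M.lapse_smooth.continuous.continuousOn
  refine ⟨C * max 1 (Λ ^ 2), by positivity, fun u hu hab η hη hs ↦ ?_⟩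
  have := Sg.t2Space
  set μ := volumeMeasure (Sg.inducedMetric u) with hμ
  have hto := (Sg.isOpen_tile c).measurableSet
  set w := localGraph hu c with hw
  -- the left-hand side in the chart
  have hleft : ∫ x, χ (Sg.proj x) ^ 2 * (η x ^ 2 * Sg.secondFFSq u x) ∂μ =
      ∫ z in w.dom, ((χ ∘ ψ.symm) z * Sg.inChart η c z) ^ 2 * w.shapeSq z * w.dens z := by
    have hint : Integrable (fun x ↦ η x ^ 2 * (χ (Sg.proj x) ^ 2 * Sg.secondFFSq u x)) μ :=
      integrable_sq_mul hu hη hs fun x hx ↦ ((χ.continuous.comp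
        Sg.contMDiff_proj.continuous).continuousAt.pow 2).mul (continuousAt_secondFFSq hu hx)
    have hint' : Integrable (fun x ↦ χ (Sg.proj x) ^ 2 * (η x ^ 2 * Sg.secondFFSq u x)) μ :=
      hint.congr (Eventually.of_forall fun x ↦ by ring)
    rw [← setIntegral_eq_integral_of_forall_compl_eq_zero (s := Sg.tile c) fun x hx ↦ ?_]
    · refine setIntegral_tile hu (fun x hx ↦ ?_) hint'.aestronglyMeasurable.restrict
      rw [inChart_chartMap hx.2, secondFFSq_eq hu hx.1 hx.2, Function.comp_apply, chartMap,
        ψ.left_inv hx.2]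
      ring
    · by_cases hx1 : x ∈ tsupport η
      · have h1 : Sg.proj x ∉ tsupport χ := fun h ↦ hx ⟨hs hx1, hχs h⟩
        rw [image_eq_zero_of_notMem_tsupport h1]; ring
      · rw [image_eq_zero_of_notMem_tsupport hx1]; ring
  -- the right-hand side in the chart
  have hlapse : Continuous fun x ↦ M.lapse (Sg.graphMap u x) :=
    M.lapse_smooth.continuous.comp hu.contMDiff_graphMap.continuous
  let B : N → ℝ := fun x ↦ gradSq (Sg.inducedMetric u) η x + η x ^ 2 * Sg.meanCurvature u x ^ 2 +
    η x ^ 2 * (M.lapse (Sg.graphMap u x) * Sg.tilt u x) ^ 2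
  let q := Sg.inChart (gradSq (Sg.inducedMetric u) η) c
  let G : EuclideanSpace ℝ (Fin m) → ℝ := fun z ↦ q z + Sg.inChart η c z ^ 2 * w.meanCurv z ^ 2 +
    Sg.inChart η c z ^ 2 * w.coordTilt z ^ 2
  have hgrad := integrable_gradSq hu hη hs
  have hH := integrable_sq_mul hu hη hs fun x hx ↦ (continuousAt_meanCurvature hu hx).pow 2
  have hT := integrable_sq_mul hu hη hs fun x hx ↦ (continuousAt_tilt hu hx).pow 2
  have hB : Integrable B μ := (hgrad.add hH).add (integrable_sq_mul hu hη hs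
    fun x hx ↦ (hlapse.continuousAt.mul (continuousAt_tilt hu hx)).pow 2)
  have hpre : MeasurableSet (Sg.proj ⁻¹' tsupport χ) :=
    ((isClosed_tsupport χ).preimage Sg.contMDiff_proj.continuous).measurableSet
  have hmemK : ∀ x ∈ Sg.tile c, Sg.chartMap c x ∈ ψ '' tsupport χ → Sg.proj x ∈ tsupport χ := by
    rintro x hx ⟨y, hy, hyx⟩
    rwa [← ψ.injOn (hχs hy) hx.2 hyx]
  have hright : ∫ x in Sg.tile c, (Sg.proj ⁻¹' tsupport χ).indicator B x ∂μ =
      ∫ z in w.dom ∩ ψ '' tsupport χ, G z * w.dens z := by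
    rw [← setIntegral_indicator hK.measurableSet]
    refine (setIntegral_tile (F := (ψ '' tsupport χ).indicator G) hu (fun x hx ↦ ?_)
      (hB.indicator hpre).aestronglyMeasurable.restrict).trans ?_
    · by_cases h1 : Sg.proj x ∈ tsupport χ
      · rw [indicator_of_mem (by exact h1), indicator_of_mem
          (show Sg.chartMap c x ∈ ψ '' tsupport χ from mem_image_of_mem ψ h1)]
        have h2 : M.lapse (Sg.graphMap u x) * Sg.tilt u x = w.coordTilt (Sg.chartMap c x) := by
          rw [tilt_eq hu hx.1 hx.2, mul_inv_cancel_left₀ (M.lapse_pos _).ne']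
        simp only [B, G, q]
        rw [h2, inChart_chartMap hx.2, inChart_chartMap hx.2, meanCurvature_eq hu hx.1 hx.2]
      · rw [indicator_of_notMem (by exact h1), indicator_of_notMem fun h ↦ h1 (hmemK x hx h)]
    · refine setIntegral_congr_fun (Sg.isOpen_shadow c).measurableSet fun z _ ↦ ?_
      simp only [indicator_mul_left]
      rfl
  have hqint : IntegrableOn (fun z ↦ q z * w.dens z) w.dom :=
    (integrableOn_tile_iff hu (f := gradSq (Sg.inducedMetric u) η)
      (fun x hx ↦ (inChart_chartMap hx.2 _).symm)
      hgrad.aestronglyMeasurable.restrict).1 hgrad.integrableOn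
  have hQ : IsCompact (tsupport η ∩ Sg.proj ⁻¹' tsupport χ) :=
    ((isClosed_tsupport η).inter
      ((isClosed_tsupport χ).preimage Sg.contMDiff_proj.continuous)).isCompact
  have main := hest w (fun z _ ↦ hab _) (Sg.inChart η c) ?_
    (Sg.chartMap c '' (tsupport η ∩ Sg.proj ⁻¹' tsupport χ)) (hQ.image_of_continuousOn ?_) ?_ ?_ q
    (fun z _ ↦ gradSq_inducedMetric_nonneg hu hs _) ?_ (hqint.mono_set inter_subset_left)
  · rw [hleft]
    refine main.trans ?_
    rw [← hright, mul_assoc]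
    refine mul_le_mul_of_nonneg_left ?_ hC
    rw [← integral_const_mul]
    have hR0 : ∀ x, 0 ≤ gradSq (Sg.inducedMetric u) η x + η x ^ 2 * Sg.meanCurvature u x ^ 2 +
        η x ^ 2 * Sg.tilt u x ^ 2 := fun x ↦ by
      have := gradSq_inducedMetric_nonneg hu hs x
      positivity
    have hR := ((hgrad.add hH).add hT).const_mul (max 1 (Λ ^ 2))
    refine le_trans ?_ (setIntegral_le_integral (s := Sg.tile c) hR
      (Eventually.of_forall fun x ↦ mul_nonneg (by positivity) (hR0 x)))
    refine setIntegral_mono_on (hB.indicator hpre).integrableOn hR.integrableOn hto fun x hx ↦ ?_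
    refine indicator_le' (g := fun x ↦ max 1 (Λ ^ 2) * (gradSq (Sg.inducedMetric u) η x +
      η x ^ 2 * Sg.meanCurvature u x ^ 2 + η x ^ 2 * Sg.tilt u x ^ 2)) (fun x _ ↦ ?_)
      (fun x _ ↦ mul_nonneg (by positivity) (hR0 x)) x
    have h1 : (1 : ℝ) ≤ max 1 (Λ ^ 2) := le_max_left _ _
    have h2 : M.lapse (Sg.graphMap u x) ^ 2 ≤ max 1 (Λ ^ 2) := by
      refine le_trans ?_ (le_max_right _ _)
      have h3 := hΛ (Sg.graphMap u x) ⟨hab x, mem_range_self x⟩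
      rw [Real.norm_of_nonneg (M.lapse_pos _).le] at h3
      exact pow_le_pow_left₀ (M.lapse_pos _).le h3 2
    have h3 := gradSq_inducedMetric_nonneg hu hs x
    have h4 : 0 ≤ η x ^ 2 * Sg.meanCurvature u x ^ 2 := by positivity
    have h5 : 0 ≤ η x ^ 2 * Sg.tilt u x ^ 2 := by positivity
    have h6 := mul_le_mul_of_nonneg_right h2 h5
    have h7 := mul_le_mul_of_nonneg_right h1 h3
    have h8 := mul_le_mul_of_nonneg_right h1 h4
    simp only [B, mul_pow]
    linarith
  · rintro _ ⟨x, hx, hc, rfl⟩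
    exact contDiffAt_inChart hx hc (by simp) (hη x)
  · exact fun x hx ↦ (contMDiffAt_chartMap (hχs hx.2)).continuousAt.continuousWithinAt
  · rintro _ ⟨x, hx, rfl⟩
    exact ⟨x, hs hx.1, hχs hx.2, rfl⟩
  · rintro _ ⟨⟨x, hx, hc, rfl⟩, hzK⟩ hne
    rw [inChart_chartMap hc] at hne
    exact mem_image_of_mem _ ⟨subset_tsupport _ hne, hmemK x ⟨hx, hc⟩ hzK⟩
  · rintro _ ⟨x, hx, hc, rfl⟩ v
    change _ ≤ Sg.inChart (gradSq (Sg.inducedMetric u) η) c _ * _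
    rw [inChart_chartMap hc]
    exact sq_fderiv_inChart_le hu ⟨hx, hc⟩ (hη x) v

end SpacelikeHypersurface

end Lorentz

end

theorem mainTheorem5 {m : ℕ} [NeZero m]
    {S : Type*} [TopologicalSpace S] [T2Space S] [SecondCountableTopology S]
    [ChartedSpace (EuclideanSpace ℝ (Fin m)) S] [IsManifold (𝓡 m) ∞ S]
    (M : Lorentz.SplitMetric m S) (hM : M.CauchySlices)
    {N : Type*} [TopologicalSpace N] [CompactSpace N] [ConnectedSpace N]
    [ChartedSpace (EuclideanHalfSpace m) N] [IsManifold (𝓡∂ m) ∞ N]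
    [MeasurableSpace N] [BorelSpace N]
    (Sg : Lorentz.SpacelikeHypersurface M N)
    (hC : IsCompact (closure (M.cauchyDevelopment (range Sg.emb)))) :
    ∃ C : ℝ, ∀ u : N → ℝ, Sg.IsSpacelikeHeight u →
      ∀ η : N → ℝ, ContMDiff (𝓡∂ m) 𝓘(ℝ, ℝ) 1 η → tsupport η ⊆ (𝓡∂ m).interior N →
        Integrable (fun x ↦ η x ^ 2 * Sg.secondFFSq u x)
          (Lorentz.volumeMeasure (Sg.inducedMetric u)) ∧
        ∫ x, η x ^ 2 * Sg.secondFFSq u x ∂(Lorentz.volumeMeasure (Sg.inducedMetric u)) ≤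
          C * ((∫ x, Lorentz.gradSq (Sg.inducedMetric u) η x
                ∂(Lorentz.volumeMeasure (Sg.inducedMetric u))) +
              (∫ x, η x ^ 2 * Sg.meanCurvature u x ^ 2
                ∂(Lorentz.volumeMeasure (Sg.inducedMetric u))) +
              (∫ x, η x ^ 2 * Sg.tilt u x ^ 2
                ∂(Lorentz.volumeMeasure (Sg.inducedMetric u)))) := by
  obtain ⟨a, b, hab⟩ := Lorentz.SpacelikeHypersurface.exists_height_mem_Icc hC
  let χ : ∀ c : S, SmoothBumpFunction (𝓡 m) c := fun c ↦ Classical.arbitrary _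
  choose C hC0 hest using fun c ↦ Sg.exists_estimate_of_bump (χ c) a b
  -- finitely many bump functions such that at every point of `Σ` one of them equals one
  obtain ⟨t, -, ht⟩ := (isCompact_range Sg.contMDiff_proj.continuous).elim_nhds_subcover
    (fun c ↦ {q | χ c q = 1}) fun c _ ↦ (χ c).eventuallyEq_one
  refine ⟨∑ c ∈ t, C c, fun u hu η hη hs ↦ ?_⟩
  have hgrad := Sg.integrable_gradSq hu hη hs
  have hH := Sg.integrable_sq_mul hu hη hs fun x hx ↦ (Sg.continuousAt_meanCurvature hu hx).pow 2
  have hT := Sg.integrable_sq_mul hu hη hs fun x hx ↦ (Sg.continuousAt_tilt hu hx).pow 2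
  have hII := Sg.integrable_sq_mul hu hη hs fun x hx ↦ Sg.continuousAt_secondFFSq hu hx
  have hχ : ∀ c, Integrable (fun x ↦ χ c (Sg.proj x) ^ 2 * (η x ^ 2 * Sg.secondFFSq u x))
      (Lorentz.volumeMeasure (Sg.inducedMetric u)) := fun c ↦
    (Sg.integrable_sq_mul hu hη hs fun x hx ↦ (((χ c).continuous.comp
      Sg.contMDiff_proj.continuous).continuousAt.pow 2).mul
        (Sg.continuousAt_secondFFSq hu hx)).congr (Eventually.of_forall fun x ↦ by
          simp only [Pi.mul_apply, Pi.pow_apply, Function.comp_apply]; ring)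
  refine ⟨hII, ?_⟩
  have hnonneg : ∀ x, 0 ≤ η x ^ 2 * Sg.secondFFSq u x := fun x ↦ by
    by_cases hx : x ∈ tsupport η
    · exact mul_nonneg (sq_nonneg _) (Sg.secondFFSq_nonneg hu (hs hx))
    · rw [image_eq_zero_of_notMem_tsupport hx]; simp
  have hle : ∀ x, η x ^ 2 * Sg.secondFFSq u x ≤
      ∑ c ∈ t, χ c (Sg.proj x) ^ 2 * (η x ^ 2 * Sg.secondFFSq u x) := fun x ↦ by
    obtain ⟨c, hc, hcx⟩ := mem_iUnion₂.1 (ht (mem_range_self x))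
    have hcx' : χ c (Sg.proj x) = 1 := hcx
    refine le_trans (le_of_eq ?_) (Finset.single_le_sum
      (f := fun c ↦ χ c (Sg.proj x) ^ 2 * (η x ^ 2 * Sg.secondFFSq u x))
      (fun c _ ↦ mul_nonneg (sq_nonneg _) (hnonneg x)) hc)
    simp only [hcx', one_pow, one_mul]
  refine (integral_mono hII (integrable_finsetSum t fun c _ ↦ hχ c) hle).trans ?_
  rw [integral_finsetSum t fun c _ ↦ hχ c, Finset.sum_mul]
  refine Finset.sum_le_sum fun c _ ↦ (hest c u hu (hab u hu) η hη hs).trans_eq ?_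
  congr 1
  exact (integral_add (hgrad.add hH) hT).trans (congrArg (· + _) (integral_add hgrad hH))
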